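/- Let $\mathbb{k}$ be an algebraically closed field and let $R=\bigoplus_{\gamma\in\mathbb{R}_{\ge 0}}R_\gamma$ be an $\mathbb{R}_{\ge 0}$-graded integral domain, finitely generated as an algebra over $R_0=\mathbb{k}$, of Krull dimension $n\ge 1$. For a finitely generated torsion-free $\mathbb{R}$-graded $R$-module $N=\bigoplus_{\lambda\in\mathbb{R}}N_\lambda$ put $N_{\le x}:=\bigoplus_{\lambda\le x}N_\lambda$. Then there are unique real numbers $a_n(N)$, $a_{n-1}(N)$ such that $$\dim_{\mathbb{k}} N_{\le x}=\frac{a_n(N)}{n!}x^n+O(x^{n-1})\quad(x\to\infty),$$ $$\lim_{T\to\infty}\frac1{T^n}\int_1^T\Bigl(\dim_{\mathbb{k}} N_{\le x}-\frac{a_n(N)}{n!}x^n-\frac{a_{n-1}(N)}{(n-1)!}x^{n-1}\Bigr)dx=0 ;$$ this applies in particular to $N=R$. Put $\deg(N):=a_{n-1}(N)-\operatorname{rank}(N)\,a_{n-1}(R)$ and, when $a_n(N)\ne 0$ (equivalently, $N\neq 0$), $\mu(N):=\deg(N)/a_n(N)$. A nonzero finitely generated torsion-free $\mathbb{R}$-graded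 $R$-module $N$ is called semistable if $\mu(N')\le\mu(N)$ for every nonzero graded submodule $N'\subseteq N$. Let $M$ be a finitely generated torsion-free $\mathbb{R}$-graded $R$-module. Then there exists a unique filtration $$0=M_0\subset M_1\subset\dots\subset M_l=M$$ (of some length $l\ge 0$, which is also unique) by graded submodules such that 1. each $M_i/M_{i-1}$ $(1\le i\le l)$, with the induced grading, is nonzero, torsion-free and semistable; 2. $\mu(M_1)>\mu(M_2/M_1)>\dots>\mu(M_l/M_{l-1})$. -/

import Mathlib

open Filter Topology Asymptotics

noncomputable section

/-- `dim_k (M_{≤ x})`, where `M_{≤ x}` is the sum of the graded pieces `M_t` with `t ≤ x`. -/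
def dimLE {k M : Type*} [Field k] [AddCommGroup M] [Module k M]
    (ℳ : ℝ → Submodule k M) (x : ℝ) : ℝ :=
  (Module.finrank k (⨆ t : Set.Iic x, ℳ t : Submodule k M) : ℝ)

/-- `a = a_n(M)` and `b = a_{n-1}(M)` are Riemann-Roch coefficients of the graded module `M`
(for `n ≥ 1`): `dim M_{≤ x} = a / n! * x ^ n + O(x ^ (n - 1))`, and the remainder after subtracting
`a / n! * x ^ n + b / (n - 1)! * x ^ (n - 1)` averages out in the sense of Cesàro. -/
structure IsRiemannRoch {k M : Type*} [Field k] [AddCommGroup M] [Module k M]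
    (n : ℕ) (ℳ : ℝ → Submodule k M) (a b : ℝ) : Prop where
  leading : (fun x : ℝ => dimLE ℳ x - a / (n.factorial : ℝ) * x ^ n)
    =O[atTop] (fun x : ℝ => x ^ (n - 1))
  cesaro : Tendsto (fun T : ℝ => 1 / T ^ n *
      ∫ x in (1 : ℝ)..T, (dimLE ℳ x - a / (n.factorial : ℝ) * x ^ n
        - b / ((n - 1).factorial : ℝ) * x ^ (n - 1)))
    atTop (𝓝 0)

/-- The pair `(a_n(M), a_{n-1}(M))` of Riemann-Roch coefficients. -/
def rrCoeff {k M : Type*} [Field k] [AddCommGroup M] [Module k M]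
    (n : ℕ) (ℳ : ℝ → Submodule k M) : ℝ × ℝ :=
  Classical.epsilon fun c : ℝ × ℝ => IsRiemannRoch n ℳ c.1 c.2

section Graded

variable {k R M : Type*} [Field k] [CommRing R] [Algebra k R]
  [AddCommGroup M] [Module R M] [Module k M] [IsScalarTower k R M]

/-- The degree `a_{n-1}(M) - rank(M) * a_{n-1}(R)`. For a domain `R`, `Module.finrank R M` is the
rank of the finitely generated module `M`. -/
def gradedDegree (n : ℕ) (𝒜 : ℝ → Submodule k R) (ℳ : ℝ → Submodule k M) : ℝ :=
  (rrCoeff n ℳ).2 - (Module.finrank R M : ℝ) * (rrCoeff n 𝒜).2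

/-- The slope `deg(M) / a_n(M)` (meaningful when `a_n(M) ≠ 0`). -/
def gradedSlope (n : ℕ) (𝒜 : ℝ → Submodule k R) (ℳ : ℝ → Submodule k M) : ℝ :=
  gradedDegree n 𝒜 ℳ / (rrCoeff n ℳ).1

/-- `N` is a graded submodule: `N` is the sum of the subspaces `N ∩ M_t`. -/
def IsGradedSubmodule (ℳ : ℝ → Submodule k M) (N : Submodule R M) : Prop :=
  N.restrictScalars k = ⨆ t : ℝ, N.restrictScalars k ⊓ ℳ t

/-- For a graded module this is Mathlib's notion of a homogeneous submodule. -/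
theorem isGradedSubmodule_iff_isHomogeneous (ℳ : ℝ → Submodule k M) [DirectSum.Decomposition ℳ]
    (N : Submodule R M) : IsGradedSubmodule ℳ N ↔ N.IsHomogeneous ℳ := by
  classical
  constructor
  · intro h i m hm
    have hm' : m ∈ ⨆ t : ℝ, N.restrictScalars k ⊓ ℳ t := by
      rw [← h]; exact hm
    refine Submodule.iSup_induction (fun t : ℝ => N.restrictScalars k ⊓ ℳ t)
      (motive := fun m => (DirectSum.decompose ℳ m i : M) ∈ N) hm' ?_ ?_ ?_
    · rintro t x ⟨hx, hxt⟩
      by_cases hti : t = i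
      · subst hti
        rw [DirectSum.decompose_of_mem_same ℳ hxt]; exact hx
      · rw [DirectSum.decompose_of_mem_ne ℳ hxt hti]; exact N.zero_mem
    · simp
    · intro x y hx hy
      simpa using N.add_mem hx hy
  · intro h
    refine le_antisymm ?_ (iSup_le fun t => inf_le_left)
    intro m hm
    rw [← DirectSum.sum_support_decompose ℳ m]
    refine Submodule.sum_mem _ fun t _ => ?_
    exact Submodule.mem_iSup_of_mem t ⟨h t hm, (DirectSum.decompose ℳ m t).2⟩

/-- The induced grading on a submodule `P`: `P_t = P ∩ M_t`. -/
def subGrading (ℳ : ℝ → Submodule k M) (P : Submodule R M) : ℝ → Submodule k P :=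
  fun t => (ℳ t).comap (P.subtype.restrictScalars k)

/-- The induced grading on a quotient `M / N`: `(M / N)_t` is the image of `M_t`. -/
def quotGrading (ℳ : ℝ → Submodule k M) (N : Submodule R M) : ℝ → Submodule k (M ⧸ N) :=
  fun t => (ℳ t).map (N.mkQ.restrictScalars k)

/-- The induced grading on `P / N` for `N ≤ P ≤ M`. -/
def subquotGrading (ℳ : ℝ → Submodule k M) (N P : Submodule R M) :
    ℝ → Submodule k (P ⧸ N.submoduleOf P) :=
  quotGrading (subGrading ℳ P) (N.submoduleOf P)

/-- A graded module `M` is torsion-free and semistable. The condition `a_n(M) ≠ 0`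
(equivalently `M ≠ 0`, for torsion-free `M`) is the one under which the slope of `M` is defined. -/
structure IsSemistable (n : ℕ) (𝒜 : ℝ → Submodule k R) (ℳ : ℝ → Submodule k M) : Prop where
  torsionFree : Module.IsTorsionFree R M
  leading_ne_zero : (rrCoeff n ℳ).1 ≠ 0
  slope_le : ∀ N : Submodule R M, IsGradedSubmodule ℳ N → N ≠ ⊥ →
    gradedSlope n 𝒜 (subGrading ℳ N) ≤ gradedSlope n 𝒜 ℳ

/-- `0 = F 0 ⊆ F 1 ⊆ ⋯ ⊆ F l = M` is a Harder-Narasimhan filtration of the graded module `M`. -/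
structure IsHarderNarasimhan (n : ℕ) (𝒜 : ℝ → Submodule k R) (ℳ : ℝ → Submodule k M)
    {l : ℕ} (F : Fin (l + 1) → Submodule R M) : Prop where
  graded : ∀ i, IsGradedSubmodule ℳ (F i)
  mono : Monotone F
  bot : F 0 = ⊥
  top : F (Fin.last l) = ⊤
  semistable : ∀ i : Fin l, IsSemistable n 𝒜 (subquotGrading ℳ (F i.castSucc) (F i.succ))
  slope_strictAnti : StrictAnti fun i : Fin l =>
    gradedSlope n 𝒜 (subquotGrading ℳ (F i.castSucc) (F i.succ))

end Graded

end

/-!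
The Hilbert function of a graded subquotient is a finite sum of shifts of counting functions
`c x = #{a ∈ ℕ ^ d | ∑ i, a i * w i ≤ x}`, the weights `w i` being degrees of algebra generators.
By Noether normalization it is `O(x ^ n)`, so only `d ≤ n` occurs. With `σ = ∑ i, w i` and
`π = ∏ i, w i` one has `x ^ d ≤ d! π c(x) ≤ (x + σ) ^ d`, while `(d + 1)! π ∫₀ˣ c` agrees with
`(x + σ / 2) ^ (d + 1)` in its two leading terms; this yields `a_n` and `a_{n-1}`.

Both coefficients are modular on the lattice of graded submodules, and `a_n` is the rank times
`a_n(R)`. If `N ≤ P` have the same rank, `a_{n-1}(P) - a_{n-1}(N)` lies in a finitely generated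
monoid of nonnegative reals, because all counts for `P / N` have `d < n`. Adding one homogeneous
generator at a time, it follows that the values of `-a_{n-1}` are partially well ordered. This
replaces the discreteness of degrees over an integral grading: some submodule has maximal slope, and
the classical construction of the maximal destabilizing submodule, carried out in a modular
valuation setting on a lattice, gives existence and uniqueness of the filtration.
-/

namespace HarderNarasimhan

variable {L : Type*} [Lattice L]

/-- The slope of the interval `[x, y]`, for `a` and `b` thought of as rank and degree. -/
noncomputable def intervalSlope (a b : L → ℝ) (x y : L) : ℝ := (b y - b x) / (a y - a x)

/-- The deficit of `z` with respect to the slope `μ`. Along the line of slope `μ` through the point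
`(a x, b x)` it is constant, so that slopes of intervals `[x, z]` are compared with `μ` by comparing
the deficits of `x` and `z`. -/
def deficit (a b : L → ℝ) (μ : ℝ) (z : L) : ℝ := μ * a z - b z

/-- A valuation on a lattice. -/
def IsModularFun (f : L → ℝ) : Prop := ∀ x y, f (x ⊔ y) + f (x ⊓ y) = f x + f y

/-- The interval `[x, y]` is a semistable piece: the lattice version of a nonzero torsion-free
semistable subquotient. -/
structure IsStep (a b : L → ℝ) (x y : L) : Prop where
  lt : x < y
  rank_lt : ∀ z, x < z → z ≤ y → a x < a z
  slope_le : ∀ z, x < z → z ≤ y → intervalSlope a b x z ≤ intervalSlope a b x y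

/-- `F` is a Harder-Narasimhan filtration of the interval `[x, ⊤]`. -/
structure IsFiltration [OrderTop L] (a b : L → ℝ) (x : L) {l : ℕ} (F : Fin (l + 1) → L) : Prop where
  zero : F 0 = x
  last : F (Fin.last l) = ⊤
  step : ∀ i : Fin l, IsStep a b (F i.castSucc) (F i.succ)
  strictAnti : StrictAnti fun i : Fin l => intervalSlope a b (F i.castSucc) (F i.succ)

/-- `[x, y]` is the maximal destabilizing interval above `x`: its slope `μ` is the largest slope of
an interval `[x, z]`, and `y` is the largest element for which it is attained. -/
structure IsDestabilizing (a b : L → ℝ) (x y : L) (μ : ℝ) : Prop where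
  rank_lt : a x < a y
  deficit_le : ∀ z, x ≤ z → deficit a b μ x ≤ deficit a b μ z
  isGreatest : IsGreatest {z | x ≤ z ∧ deficit a b μ z = deficit a b μ x} y

variable {a b : L → ℝ} {x y z : L} {μ : ℝ}

omit [Lattice L] in
theorem intervalSlope_le_iff (h : a x < a z) :
    intervalSlope a b x z ≤ μ ↔ deficit a b μ x ≤ deficit a b μ z := by
  rw [intervalSlope, div_le_iff₀ (sub_pos.2 h), deficit, deficit]
  constructor <;> intro h <;> linarith

omit [Lattice L] in
theorem intervalSlope_lt_iff (h : a x < a z) :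
    intervalSlope a b x z < μ ↔ deficit a b μ x < deficit a b μ z := by
  rw [intervalSlope, div_lt_iff₀ (sub_pos.2 h), deficit, deficit]
  constructor <;> intro h <;> linarith

omit [Lattice L] in
theorem intervalSlope_eq_iff (h : a x < a z) :
    intervalSlope a b x z = μ ↔ deficit a b μ z = deficit a b μ x := by
  rw [intervalSlope, div_eq_iff (sub_pos.2 h).ne', deficit, deficit]
  constructor <;> intro h <;> linarith

theorem IsModularFun.deficit (ha : IsModularFun a) (hb : IsModularFun b) (μ : ℝ) :
    IsModularFun (deficit a b μ) := by
  intro x y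
  simp only [HarderNarasimhan.deficit]
  linear_combination μ * ha x y - hb x y

theorem IsStep.deficit_lt (h : IsStep a b x y) (hμ : intervalSlope a b x y < μ) (hz : x < z)
    (hzy : z ≤ y) : deficit a b μ x < deficit a b μ z :=
  (intervalSlope_lt_iff (h.rank_lt z hz hzy)).1 ((h.slope_le z hz hzy).trans_lt hμ)

theorem IsStep.deficit_le (h : IsStep a b x y) (hz : x ≤ z) (hzy : z ≤ y) :
    deficit a b (intervalSlope a b x y) x ≤ deficit a b (intervalSlope a b x y) z := by
  rcases hz.eq_or_lt with rfl | hz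
  · exact le_rfl
  · exact (intervalSlope_le_iff (h.rank_lt z hz hzy)).1 (h.slope_le z hz hzy)

namespace IsDestabilizing

theorem lt (h : IsDestabilizing a b x y μ) : x < y :=
  h.isGreatest.1.1.lt_of_ne fun hxy => h.rank_lt.ne (congrArg a hxy)

theorem slope_eq (h : IsDestabilizing a b x y μ) : intervalSlope a b x y = μ :=
  (intervalSlope_eq_iff h.rank_lt).2 h.isGreatest.1.2

theorem slope_le_of_isDestabilizing {y' : L} {μ' : ℝ} (h : IsDestabilizing a b x y μ)
    (h' : IsDestabilizing a b x y' μ') : μ ≤ μ' := by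
  rw [← h.slope_eq, intervalSlope_le_iff h.rank_lt]
  exact h'.deficit_le y h.lt.le

theorem unique {y' : L} {μ' : ℝ} (h : IsDestabilizing a b x y μ)
    (h' : IsDestabilizing a b x y' μ') : y = y' := by
  obtain rfl : μ = μ' :=
    (h.slope_le_of_isDestabilizing h').antisymm (h'.slope_le_of_isDestabilizing h)
  exact h.isGreatest.unique h'.isGreatest

theorem isStep (h : IsDestabilizing a b x y μ) (hx : ∀ z, x < z → a x < a z) :
    IsStep a b x y where
  lt := h.lt
  rank_lt z hz _ := hx z hz
  slope_le z hz _ := by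
    rw [h.slope_eq, intervalSlope_le_iff (hx z hz)]
    exact h.deficit_le z hz.le

theorem deficit_lt (h : IsDestabilizing a b x y μ) (hz : y < z) :
    deficit a b μ y < deficit a b μ z := by
  have hxz : x ≤ z := h.lt.le.trans hz.le
  rw [h.isGreatest.1.2]
  refine (h.deficit_le z hxz).lt_of_ne fun heq => ?_
  exact hz.not_ge (h.isGreatest.2 ⟨hxz, heq.symm⟩)

theorem slope_lt (h : IsDestabilizing a b x y μ) (hz : y < z) (hyz : a y < a z) :
    intervalSlope a b y z < μ :=
  (intervalSlope_lt_iff hyz).2 (h.deficit_lt hz)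

theorem rank_lt_of_lt (h : IsDestabilizing a b x y μ) (hmono : Monotone a)
    (hb : ∀ x y, x ≤ y → a x = a y → b x ≤ b y) (hz : y < z) : a y < a z := by
  refine (hmono hz.le).lt_of_ne fun heq => ?_
  have hlt := h.deficit_lt hz
  rw [deficit, deficit, heq] at hlt
  linarith [hb y z hz.le heq]

end IsDestabilizing

section Filtration

variable [OrderTop L] {l : ℕ}

namespace IsFiltration

theorem length_eq_zero {F : Fin (l + 1) → L} (h : IsFiltration a b ⊤ F) : l = 0 := by
  cases l with
  | zero => rfl
  | succ l => exact absurd (h.zero ▸ (h.step 0).lt) not_top_lt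

theorem step_zero {F : Fin (l + 1 + 1) → L} (h : IsFiltration a b x F) : IsStep a b x (F 1) := by
  simpa only [Fin.castSucc_zero, h.zero, Fin.succ_zero_eq_one] using h.step 0

theorem tail {F : Fin (l + 1 + 1) → L} (h : IsFiltration a b x F) :
    IsFiltration a b (F 1) (Fin.tail F) where
  zero := rfl
  last := h.last
  step _ := h.step (Fin.succ _)
  strictAnti _ _ hij := h.strictAnti (Fin.succ_lt_succ_iff.2 hij)

theorem slope_tail_lt {F : Fin (l + 1 + 1) → L} (h : IsFiltration a b x F) (i : Fin l) :
    intervalSlope a b (Fin.tail F i.castSucc) (Fin.tail F i.succ) < intervalSlope a b x (F 1) := by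
  have hlt := h.strictAnti (Fin.succ_pos i)
  simp only [Fin.castSucc_zero, h.zero] at hlt
  exact hlt

theorem deficit_lt (ha : IsModularFun a) (hb : IsModularFun b) : ∀ {l : ℕ} {x : L}
    {F : Fin (l + 1) → L}, IsFiltration a b x F →
    (∀ i : Fin l, intervalSlope a b (F i.castSucc) (F i.succ) < μ) → ∀ z, x < z →
    deficit a b μ x < deficit a b μ z
  | 0, x, F, h, _, z, hz => absurd ((h.zero.symm.trans h.last) ▸ hz) not_top_lt
  | l + 1, x, F, h, hμ, z, hz => by
    have hslope : intervalSlope a b x (F 1) < μ := by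
      simpa only [Fin.castSucc_zero, h.zero, Fin.succ_zero_eq_one] using hμ 0
    have htail := deficit_lt ha hb h.tail fun i => hμ i.succ
    have hmod := ha.deficit hb μ z (F 1)
    rcases (le_inf hz.le h.step_zero.lt.le : x ≤ z ⊓ F 1).eq_or_lt with hinf | hinf
    · have hlt : F 1 < z ⊔ F 1 := by
        refine le_sup_right.lt_of_ne fun heq => hz.ne ?_
        rw [hinf, inf_eq_left.2 (heq ▸ le_sup_left)]
      rw [← hinf] at hmod
      linarith [htail _ hlt]
    · have hsup : deficit a b μ (F 1) ≤ deficit a b μ (z ⊔ F 1) := by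
        rcases (le_sup_right : F 1 ≤ z ⊔ F 1).eq_or_lt with heq | hlt
        · rw [← heq]
        · exact (htail _ hlt).le
      linarith [h.step_zero.deficit_lt hslope hinf inf_le_right]

theorem isDestabilizing (ha : IsModularFun a) (hb : IsModularFun b) {F : Fin (l + 1 + 1) → L}
    (h : IsFiltration a b x F) : IsDestabilizing a b x (F 1) (intervalSlope a b x (F 1)) := by
  set μ := intervalSlope a b x (F 1) with hμ
  have hlt := h.step_zero.lt
  have hrank := h.step_zero.rank_lt _ hlt le_rfl
  have heq := (intervalSlope_eq_iff hrank).1 hμ.symm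
  have htail : ∀ z, F 1 < z → deficit a b μ (F 1) < deficit a b μ z :=
    h.tail.deficit_lt ha hb h.slope_tail_lt
  have hinf : ∀ z, x ≤ z → deficit a b μ x ≤ deficit a b μ (z ⊓ F 1) := fun z hz =>
    h.step_zero.deficit_le (le_inf hz hlt.le) inf_le_right
  refine ⟨hrank, fun z hz => ?_, ⟨hlt.le, heq⟩, fun z ⟨hz, hzeq⟩ => ?_⟩
  · rcases (le_sup_right : F 1 ≤ z ⊔ F 1).eq_or_lt with hsup | hsup
    · rw [← inf_eq_left.2 (sup_eq_right.1 hsup.symm)]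
      exact hinf z hz
    · linarith [htail _ hsup, hinf z hz, ha.deficit hb μ z (F 1)]
  · by_contra hzF
    have hsup : F 1 < z ⊔ F 1 := right_lt_sup.2 hzF
    linarith [htail _ hsup, hinf z hz, ha.deficit hb μ z (F 1)]

theorem unique (ha : IsModularFun a) (hb : IsModularFun b) {F : Fin (l + 1) → L} {l' : ℕ}
    {G : Fin (l' + 1) → L} (hF : IsFiltration a b x F) (hG : IsFiltration a b x G) :
    (⟨l, F⟩ : (l : ℕ) × (Fin (l + 1) → L)) = ⟨l', G⟩ := by
  induction l generalizing x l' with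
  | zero =>
    obtain rfl : x = ⊤ := hF.zero.symm.trans hF.last
    obtain rfl := hG.length_eq_zero
    congr 1
    funext i
    rw [Fin.fin_one_eq_zero i, hF.zero, hG.zero]
  | succ l ih =>
    cases l' with
    | zero =>
      obtain rfl : x = ⊤ := hG.zero.symm.trans hG.last
      exact absurd hF.length_eq_zero l.succ_ne_zero
    | succ l' =>
      have hone : F 1 = G 1 := (hF.isDestabilizing ha hb).unique (hG.isDestabilizing ha hb)
      obtain ⟨rfl, htail⟩ := Sigma.mk.inj_iff.1 (ih hF.tail (hone ▸ hG.tail))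
      congr 1
      rw [← Fin.cons_self_tail F, ← Fin.cons_self_tail G, eq_of_heq htail, hF.zero, hG.zero]

theorem slope_lt_of_isDestabilizing {F : Fin (l + 1) → L} (h : IsFiltration a b y F)
    (hy : IsDestabilizing a b x y μ) (i : Fin l) :
    intervalSlope a b (F i.castSucc) (F i.succ) < μ := by
  cases l with
  | zero => exact i.elim0
  | succ l =>
    have hfirst : intervalSlope a b y (F 1) < μ :=
      hy.slope_lt h.step_zero.lt (h.step_zero.rank_lt _ h.step_zero.lt le_rfl)
    refine (h.strictAnti.antitone (Fin.zero_le i)).trans_lt ?_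
    simpa only [Fin.castSucc_zero, h.zero, Fin.succ_zero_eq_one] using hfirst

theorem cons {F : Fin (l + 1) → L} (h : IsFiltration a b y F)
    (hy : IsDestabilizing a b x y μ) (hx : ∀ z, x < z → a x < a z) :
    IsFiltration a b x (Fin.cons x F : Fin (l + 1 + 1) → L) where
  zero := rfl
  last := h.last
  step i := by
    cases i using Fin.cases with
    | zero => simpa [h.zero] using hy.isStep hx
    | succ i => simpa [← Fin.succ_castSucc] using h.step i
  strictAnti i j hij := by
    cases j using Fin.cases with
    | zero => exact absurd hij (Fin.not_lt_zero i)
    | succ j =>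
      cases i using Fin.cases with
      | zero =>
        have hlt := h.slope_lt_of_isDestabilizing hy j
        rw [← hy.slope_eq] at hlt
        simpa [h.zero, ← Fin.succ_castSucc] using hlt
      | succ i => simpa [← Fin.succ_castSucc] using h.strictAnti (Fin.succ_lt_succ_iff.1 hij)

end IsFiltration

omit [OrderTop L] in
theorem exists_slope_le (hfin : (Set.range a).Finite) (hpwo : (Set.range fun z => -b z).IsPWO)
    (hx : ∀ z, x < z → a x < a z) (hxy : x < y) :
    ∃ z, x < z ∧ ∀ w, x < w → intervalSlope a b x w ≤ intervalSlope a b x z := by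
  have hsub : (fun z => -intervalSlope a b x z) '' Set.Ioi x ⊆ ⋃ r ∈ Set.range a ∩ Set.Ioi (a x),
      (fun t => (t + b x) / (r - a x)) '' Set.range fun z => -b z := by
    rintro _ ⟨z, hz, rfl⟩
    refine Set.mem_biUnion ⟨⟨z, rfl⟩, hx z hz⟩ ⟨_, ⟨z, rfl⟩, ?_⟩
    simp only [intervalSlope]
    ring
  have hslopes : ((fun z => -intervalSlope a b x z) '' Set.Ioi x).IsWF := by
    refine Set.IsPWO.isWF (Set.IsPWO.mono ?_ hsub)
    have hfin' := hfin.subset (Set.inter_subset_left (t := Set.Ioi (a x)))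
    rw [← hfin'.coe_toFinset]
    refine (Finset.isPWO_bUnion _).2 fun r hr => ?_
    have hr : 0 < r - a x := sub_pos.2 (hfin'.mem_toFinset.1 hr).2
    exact hpwo.image_of_monotone fun s t hst => by gcongr
  have hne : ((fun z => -intervalSlope a b x z) '' Set.Ioi x).Nonempty := ⟨_, y, hxy, rfl⟩
  obtain ⟨z, hz, hmin⟩ := hslopes.min_mem hne
  refine ⟨z, hz, fun w hw => neg_le_neg_iff.1 ?_⟩
  exact hmin.le.trans (hslopes.min_le hne ⟨w, hw, rfl⟩)

theorem exists_isDestabilizing [WellFoundedGT L] (ha : IsModularFun a) (hb : IsModularFun b)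
    (hfin : (Set.range a).Finite) (hpwo : (Set.range fun z => -b z).IsPWO)
    (hx : ∀ z, x < z → a x < a z) (hxt : x < ⊤) : ∃ y μ, IsDestabilizing a b x y μ := by
  obtain ⟨z, hz, hmax⟩ := exists_slope_le hfin hpwo hx hxt
  set μ := intervalSlope a b x z with hμ
  have hle : ∀ w, x ≤ w → deficit a b μ x ≤ deficit a b μ w := by
    intro w hw
    rcases hw.eq_or_lt with rfl | hw
    exacts [le_rfl, (intervalSlope_le_iff (hx w hw)).1 (hmax w hw)]
  obtain ⟨y, ⟨hxy, hy⟩, hymax⟩ := WellFounded.has_min (wellFounded_gt (α := L))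
    {w | x < w ∧ deficit a b μ w = deficit a b μ x}
    ⟨z, hz, (intervalSlope_eq_iff (hx z hz)).1 hμ.symm⟩
  refine ⟨y, μ, hx y hxy, hle, ⟨hxy.le, hy⟩, fun w ⟨hw, hweq⟩ => ?_⟩
  by_contra hwy
  have hsup : deficit a b μ (w ⊔ y) = deficit a b μ x := by
    linarith [hle (w ⊔ y) (hw.trans le_sup_left), hle (w ⊓ y) (le_inf hw hxy.le),
      ha.deficit hb μ w y]
  exact hymax (w ⊔ y) ⟨hxy.trans_le le_sup_right, hsup⟩ (right_lt_sup.2 hwy)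

theorem exists_isFiltration [WellFoundedGT L] (ha : IsModularFun a) (hb : IsModularFun b)
    (hmono : Monotone a) (hmono' : ∀ x y, x ≤ y → a x = a y → b x ≤ b y)
    (hfin : (Set.range a).Finite) (hpwo : (Set.range fun z => -b z).IsPWO) (x : L)
    (hx : ∀ z, x < z → a x < a z) :
    ∃ F : (l : ℕ) × (Fin (l + 1) → L), IsFiltration a b x F.2 := by
  induction x using WellFoundedGT.induction with
  | ind x ih =>
    rcases (le_top : x ≤ ⊤).eq_or_lt with rfl | hxt
    · exact ⟨⟨0, fun _ => ⊤⟩, rfl, rfl, fun i => i.elim0, fun i => i.elim0⟩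
    · obtain ⟨y, μ, hy⟩ := exists_isDestabilizing ha hb hfin hpwo hx hxt
      obtain ⟨F, hF⟩ := ih y hy.lt fun z hz => hy.rank_lt_of_lt hmono hmono' hz
      exact ⟨⟨_, _⟩, hF.cons hy hx⟩

theorem existsUnique_isFiltration [WellFoundedGT L] (ha : IsModularFun a) (hb : IsModularFun b)
    (hmono : Monotone a) (hmono' : ∀ x y, x ≤ y → a x = a y → b x ≤ b y)
    (hfin : (Set.range a).Finite) (hpwo : (Set.range fun z => -b z).IsPWO)
    (hx : ∀ z, x < z → a x < a z) :
    ∃! F : (l : ℕ) × (Fin (l + 1) → L), IsFiltration a b x F.2 := by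
  obtain ⟨F, hF⟩ := exists_isFiltration ha hb hmono hmono' hfin hpwo x hx
  exact ⟨F, hF, fun G hG => hG.unique ha hb hF⟩

end Filtration

end HarderNarasimhan

section PowerInequalities

variable {u v : ℝ}

theorem mul_sub_mul_pow_le_pow_sub_pow (hv : 0 ≤ v) (huv : v ≤ u) (p : ℕ) :
    (p + 1) * (u - v) * v ^ p ≤ u ^ (p + 1) - v ^ (p + 1) := by
  induction p with
  | zero => simp
  | succ p ih =>
    have hpow : v ^ (p + 1) ≤ u ^ (p + 1) := by gcongr
    have := mul_le_mul_of_nonneg_left ih hv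
    push_cast
    linear_combination this + (u - v) * hpow

theorem pow_sub_pow_le_mul_sub_mul_pow (hv : 0 ≤ v) (huv : v ≤ u) (p : ℕ) :
    u ^ (p + 1) - v ^ (p + 1) ≤ (p + 1) * (u - v) * u ^ p := by
  induction p with
  | zero => simp
  | succ p ih =>
    have hpow : v ^ (p + 1) ≤ u ^ (p + 1) := by gcongr
    have := mul_le_mul_of_nonneg_left ih (hv.trans huv)
    push_cast
    linear_combination this + (u - v) * hpow

theorem pow_sub_pow_le_trapezoid (hv : 0 ≤ v) (huv : v ≤ u) (p : ℕ) :
    u ^ (p + 1) - v ^ (p + 1) ≤ (p + 1) * (u - v) * ((u ^ p + v ^ p) / 2) := by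
  induction p with
  | zero => simp
  | succ p ih =>
    have hpow : v ^ p ≤ u ^ p := by gcongr
    have hrearrange : 0 ≤ (u - v) ^ 2 * (u ^ p - v ^ p) :=
      mul_nonneg (sq_nonneg _) (sub_nonneg.2 hpow)
    have := mul_le_mul_of_nonneg_left ih (add_nonneg (hv.trans huv) hv)
    push_cast
    linear_combination this / 2 + (p + 1) / 4 * hrearrange

theorem midpoint_le_pow_sub_pow (hv : 0 ≤ v) (huv : v ≤ u) (p : ℕ) :
    (p + 1) * (u - v) * ((u + v) / 2) ^ p ≤ u ^ (p + 1) - v ^ (p + 1) := by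
  induction p with
  | zero => simp
  | succ p ih =>
    have hmean : ((u + v) / 2) ^ (p + 1) ≤ (u ^ (p + 1) + v ^ (p + 1)) / 2 := by
      have := add_pow_le (hv.trans huv) hv (p + 1)
      rw [div_pow, div_le_div_iff₀ (by positivity) two_pos, pow_succ 2]
      rw [Nat.add_sub_cancel] at this
      linarith
    have := mul_le_mul_of_nonneg_left ih (add_nonneg (hv.trans huv) hv)
    push_cast
    linear_combination this / 2 + (u - v) * hmean

theorem midpoint_le_pow_sub_posPart_pow {y h : ℝ} (hy : 0 ≤ y) (hh : 0 ≤ h) {p : ℕ} (hp : 1 ≤ p) :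
    (p + 1) * (2 * h) * y ^ p ≤ (y + h) ^ (p + 1) - (y - h)⁺ ^ (p + 1) := by
  rcases le_total h y with hhy | hyh
  · rw [posPart_eq_self.2 (sub_nonneg.2 hhy)]
    refine le_of_eq_of_le ?_ (midpoint_le_pow_sub_pow (sub_nonneg.2 hhy) (by linarith) p)
    ring_nf
  · rw [posPart_eq_zero.2 (sub_nonpos.2 hyh), zero_pow p.succ_ne_zero, sub_zero]
    have htangent := mul_sub_mul_pow_le_pow_sub_pow (u := y + h) (v := 2 * y) (by positivity)
      (by linarith) p
    have htwo : (2 : ℝ) ≤ 2 ^ p := le_self_pow₀ one_le_two (by lia)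
    have hcoef : 2 * y ^ p ≤ (2 * y) ^ p := by rw [mul_pow]; gcongr
    have hfirst : (p + 1) * (2 * y) * y ^ p ≤ (2 * y) ^ (p + 1) := by
      have hp2 : ((p : ℝ) + 1) ≤ 2 ^ p := by exact_mod_cast Nat.lt_two_pow_self
      calc (p + 1) * (2 * y) * y ^ p ≤ 2 ^ p * (2 * y) * y ^ p := by gcongr
        _ = (2 * y) ^ (p + 1) := by ring
    have hsecond := mul_le_mul_of_nonneg_left hcoef
      (by have := sub_nonneg.2 hyh; positivity : 0 ≤ ((p : ℝ) + 1) * (h - y))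
    linear_combination htangent + hfirst + hsecond

end PowerInequalities

section StepRecurrence

variable {w : ℝ}

theorem induction_on_step (hw : 0 < w) {motive : ℝ → Prop} (neg : ∀ x < 0, motive x)
    (step : ∀ x, 0 ≤ x → motive (x - w) → motive x) (x : ℝ) : motive x := by
  obtain ⟨N, hN⟩ := exists_nat_gt (x / w)
  rw [div_lt_iff₀ hw] at hN
  induction N generalizing x with
  | zero => exact neg x (by simpa using hN)
  | succ N ih =>
    rcases lt_or_ge x 0 with hx | hx
    · exact neg x hx
    · push_cast at hN
      exact step x hx (ih (x - w) (by linarith))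

variable {f g G : ℝ → ℝ} {C : ℝ}

theorem mul_le_of_step_recurrence (hw : 0 < w) (hneg : ∀ x < 0, f x = 0)
    (hstep : ∀ x, f x = g x + f (x - w)) (hG : ∀ x < 0, 0 ≤ G x)
    (h : ∀ x, 0 ≤ x → C * g x + G (x - w) ≤ G x) (x : ℝ) : C * f x ≤ G x := by
  induction x using induction_on_step hw with
  | neg x hx => simpa only [hneg x hx, mul_zero] using hG x hx
  | step x hx ih =>
    rw [hstep, mul_add]
    linarith [h x hx]

theorem le_mul_of_step_recurrence (hw : 0 < w) (hneg : ∀ x < 0, f x = 0)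
    (hstep : ∀ x, f x = g x + f (x - w)) (hG : G 0 ≤ 0)
    (h : ∀ x, 0 ≤ x → G x ≤ C * g x + G (x - w)⁺) {x : ℝ} (hx : 0 ≤ x) : G x ≤ C * f x := by
  suffices ∀ x, G x⁺ ≤ C * f x by simpa only [posPart_eq_self.2 hx] using this x
  intro x
  induction x using induction_on_step hw with
  | neg x hx => rwa [hneg x hx, mul_zero, posPart_eq_zero.2 hx.le]
  | step x hx ih =>
    rw [posPart_eq_self.2 hx, hstep, mul_add]
    linarith [h x hx]

end StepRecurrence

section WeightCount

/-- The number of `a : ℕ ^ ws` with `∑ i, a i * ws i ≤ x`: the Hilbert function of a polynomial ring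
whose variables have degrees `ws`. -/
noncomputable def weightCount : List ℝ → ℝ → ℝ
  | [], x => if 0 ≤ x then 1 else 0
  | w :: ws, x => ∑ i ∈ Finset.range (⌊x / w⌋₊ + 1), weightCount ws (x - i * w)

variable {w : ℝ} {ws : List ℝ}

theorem weightCount_nonneg (ws : List ℝ) (x : ℝ) : 0 ≤ weightCount ws x := by
  induction ws generalizing x with
  | nil => unfold weightCount; split_ifs <;> simp
  | cons w ws ih => exact Finset.sum_nonneg fun i _ => ih _

theorem weightCount_of_neg (hws : ∀ w ∈ ws, 0 < w) {x : ℝ} (hx : x < 0) :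
    weightCount ws x = 0 := by
  induction ws generalizing x with
  | nil => exact if_neg hx.not_ge
  | cons w ws ih =>
    refine Finset.sum_eq_zero fun i _ => ih (List.forall_mem_of_forall_mem_cons hws) ?_
    have : 0 ≤ i * w := mul_nonneg i.cast_nonneg (hws w List.mem_cons_self).le
    linarith

theorem weightCount_cons_eq_sum_range (hws : ∀ v ∈ w :: ws, 0 < v) {x : ℝ} {N : ℕ}
    (hN : ⌊x / w⌋₊ + 1 ≤ N) :
    weightCount (w :: ws) x = ∑ i ∈ Finset.range N, weightCount ws (x - i * w) := by
  have hw : 0 < w := hws w List.mem_cons_self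
  refine Finset.sum_subset (Finset.range_mono hN) fun i _ hi =>
    weightCount_of_neg (List.forall_mem_of_forall_mem_cons hws) ?_
  have hi : ⌊x / w⌋₊ < i := by simpa using hi
  rwa [sub_neg, ← div_lt_iff₀ hw, ← Nat.floor_lt' (by lia)]

theorem weightCount_cons (hws : ∀ v ∈ w :: ws, 0 < v) (x : ℝ) :
    weightCount (w :: ws) x = weightCount ws x + weightCount (w :: ws) (x - w) := by
  rw [weightCount_cons_eq_sum_range hws
      (show _ ≤ max ⌊x / w⌋₊ ⌊(x - w) / w⌋₊ + 1 + 1 by lia), Finset.sum_range_succ',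
    weightCount_cons_eq_sum_range hws (x := x - w)
      (show _ ≤ max ⌊x / w⌋₊ ⌊(x - w) / w⌋₊ + 1 by lia), add_comm]
  push_cast
  simp only [zero_mul, sub_zero, add_mul, one_mul, sub_add_eq_sub_sub, sub_right_comm _ w]

theorem weightCount_monotone (hws : ∀ w ∈ ws, 0 < w) : Monotone (weightCount ws) := by
  induction ws with
  | nil =>
    intro x y hxy
    simp only [weightCount]
    split_ifs <;> linarith
  | cons w ws ih =>
    intro x y
    induction y using induction_on_step (hws w List.mem_cons_self) generalizing x with
    | neg y hy =>
      intro hxy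
      rw [weightCount_of_neg hws hy, weightCount_of_neg hws (hxy.trans_lt hy)]
    | step y _ ihy =>
      intro hxy
      rw [weightCount_cons hws x, weightCount_cons hws y]
      exact add_le_add (ih (List.forall_mem_of_forall_mem_cons hws) hxy) (ihy (by linarith))

theorem intervalIntegrable_weightCount (hws : ∀ w ∈ ws, 0 < w) (S T : ℝ) :
    IntervalIntegrable (weightCount ws) MeasureTheory.volume S T :=
  (weightCount_monotone hws).intervalIntegrable

theorem integral_weightCount_of_nonpos (hws : ∀ w ∈ ws, 0 < w) {T : ℝ} (hT : T ≤ 0) :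
    ∫ x in (0 : ℝ)..T, weightCount ws x = 0 := by
  rw [intervalIntegral.integral_symm, neg_eq_zero]
  refine intervalIntegral.integral_zero_ae ?_
  filter_upwards [MeasureTheory.Measure.ae_ne MeasureTheory.volume 0] with x hx0 hx
  rw [Set.uIoc_of_le hT] at hx
  exact weightCount_of_neg hws (hx.2.lt_of_ne hx0)

theorem integral_weightCount_cons (hws : ∀ v ∈ w :: ws, 0 < v) (T : ℝ) :
    ∫ x in (0 : ℝ)..T, weightCount (w :: ws) x =
      (∫ x in (0 : ℝ)..T, weightCount ws x) + ∫ x in (0 : ℝ)..(T - w), weightCount (w :: ws) x := by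
  have hshift : ∫ x in (0 : ℝ)..T, weightCount (w :: ws) (x - w) =
      ∫ x in (0 : ℝ)..(T - w), weightCount (w :: ws) x := by
    have hneg := integral_weightCount_of_nonpos hws
      (sub_nonpos.2 (hws w List.mem_cons_self).le : 0 - w ≤ 0)
    rw [intervalIntegral.integral_comp_sub_right (weightCount (w :: ws)),
      ← intervalIntegral.integral_add_adjacent_intervals
        (intervalIntegrable_weightCount hws _ 0) (intervalIntegrable_weightCount hws 0 _),
      intervalIntegral.integral_symm, hneg, neg_zero, zero_add]
  have hint := (intervalIntegrable_weightCount hws (0 - w) (T - w)).comp_sub_right w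
  rw [sub_add_cancel, sub_add_cancel] at hint
  rw [← hshift, ← intervalIntegral.integral_add
    (intervalIntegrable_weightCount (List.forall_mem_of_forall_mem_cons hws) _ _) hint]
  exact intervalIntegral.integral_congr fun x _ => weightCount_cons hws x

end WeightCount

section WeightCountBounds

variable {ws : List ℝ}

theorem sub_posPart_sub_le (x w : ℝ) : x - (x - w)⁺ ≤ w := by
  linarith [le_posPart (x - w)]

theorem posPart_sub_le {x w : ℝ} (hx : 0 ≤ x) (hw : 0 ≤ w) : (x - w)⁺ ≤ x :=
  sup_le (sub_le_self x hw) hx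

theorem pow_le_weightCount (hws : ∀ w ∈ ws, 0 < w) {x : ℝ} (hx : 0 ≤ x) :
    x ^ ws.length ≤ ws.length.factorial * ws.prod * weightCount ws x := by
  induction ws generalizing x with
  | nil => simp [weightCount, hx]
  | cons w ws ih =>
    have hw : 0 < w := hws w List.mem_cons_self
    simp only [List.length_cons, List.prod_cons, Nat.factorial_succ, Nat.cast_mul, Nat.cast_succ]
    refine le_mul_of_step_recurrence hw (G := fun x => x ^ (ws.length + 1))
      (fun x hx => weightCount_of_neg hws hx) (weightCount_cons hws) (by simp) (fun x hx => ?_) hx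
    have hcount := mul_le_mul_of_nonneg_left (ih (List.forall_mem_of_forall_mem_cons hws) hx)
      (by positivity : 0 ≤ (ws.length + 1) * w)
    have hpow := pow_sub_pow_le_mul_sub_mul_pow (posPart_nonneg (x - w))
      (posPart_sub_le hx hw.le) ws.length
    have hstep := mul_le_mul_of_nonneg_left (sub_posPart_sub_le x w)
      (by positivity : 0 ≤ (ws.length + 1) * x ^ ws.length)
    linear_combination hpow + hstep + hcount

theorem weightCount_le_pow (hws : ∀ w ∈ ws, 0 < w) {x : ℝ} (hx : 0 ≤ x) :
    ws.length.factorial * ws.prod * weightCount ws x ≤ (x + ws.sum) ^ ws.length := by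
  induction ws generalizing x with
  | nil => simp [weightCount, hx]
  | cons w ws ih =>
    have hw : 0 < w := hws w List.mem_cons_self
    have hws' := List.forall_mem_of_forall_mem_cons hws
    have hσ : 0 ≤ ws.sum := List.sum_nonneg fun v hv => (hws' v hv).le
    simp only [List.length_cons, List.prod_cons, List.sum_cons, Nat.factorial_succ, Nat.cast_mul,
      Nat.cast_succ]
    rw [← posPart_eq_self.2 (by linarith : 0 ≤ x + (w + ws.sum))]
    refine mul_le_of_step_recurrence hw (G := fun x => (x + (w + ws.sum))⁺ ^ (ws.length + 1))
      (fun x hx => weightCount_of_neg hws hx) (weightCount_cons hws)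
      (fun x _ => by positivity) (fun x hx => ?_) x
    have hcount := mul_le_mul_of_nonneg_left (ih hws' hx)
      (by positivity : 0 ≤ (ws.length + 1) * w)
    have hpow := mul_sub_mul_pow_le_pow_sub_pow (by linarith : 0 ≤ x + ws.sum)
      (by linarith : x + ws.sum ≤ x + (w + ws.sum)) ws.length
    rw [show x - w + (w + ws.sum) = x + ws.sum by ring, posPart_eq_self.2 (by linarith),
      posPart_eq_self.2 (by linarith)]
    linear_combination hcount + hpow

theorem integral_weightCount_nil {T : ℝ} (hT : 0 ≤ T) :
    ∫ x in (0 : ℝ)..T, weightCount [] x = T := by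
  refine (intervalIntegral.integral_congr (g := fun _ => 1) fun x hx => ?_).trans (by simp)
  rw [Set.uIcc_of_le hT] at hx
  exact if_pos hx.1

theorem pow_add_pow_le_integral_weightCount (hws : ∀ w ∈ ws, 0 < w) {T : ℝ} (hT : 0 ≤ T) :
    T ^ (ws.length + 1) + (ws.length + 1) * (ws.sum / 2) * T ^ ws.length ≤
      (ws.length + 1).factorial * ws.prod * ∫ x in (0 : ℝ)..T, weightCount ws x := by
  induction ws generalizing T with
  | nil => simp [integral_weightCount_nil hT]
  | cons w ws ih =>
    have hw : 0 < w := hws w List.mem_cons_self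
    have hws' := List.forall_mem_of_forall_mem_cons hws
    have hσ : 0 ≤ ws.sum := List.sum_nonneg fun v hv => (hws' v hv).le
    simp only [List.length_cons, List.prod_cons, List.sum_cons, Nat.factorial_succ (ws.length + 1),
      Nat.cast_mul, Nat.cast_succ]
    refine le_mul_of_step_recurrence hw (G := fun T => T ^ (ws.length + 2) +
        (ws.length + 1 + 1) * ((w + ws.sum) / 2) * T ^ (ws.length + 1))
      (fun T hT => integral_weightCount_of_nonpos hws hT.le) (integral_weightCount_cons hws)
      (by simp) (fun T hT => ?_) hT
    have harea := mul_le_mul_of_nonneg_left (ih hws' hT)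
      (by positivity : 0 ≤ (ws.length + 1 + 1) * w)
    have htrapezoid := pow_sub_pow_le_trapezoid (posPart_nonneg (T - w))
      (posPart_sub_le hT hw.le) (ws.length + 1)
    have hstep := mul_le_mul_of_nonneg_left (sub_posPart_sub_le T w)
      (by positivity : 0 ≤ (ws.length + 1 + 1) * ((T ^ (ws.length + 1) +
        (T - w)⁺ ^ (ws.length + 1)) / 2))
    have htangent := mul_le_mul_of_nonneg_left (pow_sub_pow_le_mul_sub_mul_pow
      (posPart_nonneg (T - w)) (posPart_sub_le hT hw.le) ws.length)
      (by positivity : 0 ≤ (ws.length + 1 + 1) * (ws.sum / 2))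
    have hstep' := mul_le_mul_of_nonneg_left (sub_posPart_sub_le T w)
      (by positivity : 0 ≤ (ws.length + 1 + 1) * (ws.sum / 2) * (ws.length + 1) * T ^ ws.length)
    push_cast at harea htrapezoid
    linear_combination harea + htrapezoid + hstep + htangent + hstep'

theorem integral_weightCount_le_pow (hws : ∀ w ∈ ws, 0 < w) {T : ℝ} (hT : 0 ≤ T) :
    (ws.length + 1).factorial * ws.prod * ∫ x in (0 : ℝ)..T, weightCount ws x ≤
      (T + ws.sum / 2) ^ (ws.length + 1) := by
  induction ws generalizing T with
  | nil => simp [integral_weightCount_nil hT]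
  | cons w ws ih =>
    have hw : 0 < w := hws w List.mem_cons_self
    have hws' := List.forall_mem_of_forall_mem_cons hws
    have hσ : 0 ≤ ws.sum := List.sum_nonneg fun v hv => (hws' v hv).le
    simp only [List.length_cons, List.prod_cons, List.sum_cons, Nat.factorial_succ (ws.length + 1),
      Nat.cast_mul, Nat.cast_succ]
    rw [← posPart_eq_self.2 (by linarith : 0 ≤ T + (w + ws.sum) / 2)]
    refine mul_le_of_step_recurrence hw
      (G := fun T => (T + (w + ws.sum) / 2)⁺ ^ (ws.length + 2))
      (fun T hT => integral_weightCount_of_nonpos hws hT.le) (integral_weightCount_cons hws)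
      (fun T _ => by positivity) (fun T hT => ?_) T
    have harea := mul_le_mul_of_nonneg_left (ih hws' hT)
      (by positivity : 0 ≤ (ws.length + 1 + 1) * w)
    have hmidpoint := midpoint_le_pow_sub_posPart_pow (by linarith : 0 ≤ T + ws.sum / 2)
      (by positivity : 0 ≤ w / 2) (Nat.le_add_left 1 ws.length)
    rw [show T - w + (w + ws.sum) / 2 = T + ws.sum / 2 - w / 2 by ring,
      posPart_eq_self.2 (by linarith : 0 ≤ T + (w + ws.sum) / 2)]
    push_cast at harea hmidpoint
    linear_combination harea + hmidpoint

end WeightCountBounds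

section PowerAsymptotics

theorem isBigO_pow_of_le {m n : ℕ} (h : m ≤ n) :
    (fun x : ℝ => x ^ m) =O[atTop] fun x : ℝ => x ^ n :=
  (isBigO_pow_pow_cobounded_of_le h).mono IsOrderBornology.atTop_le_cobounded

theorem isBigO_sub_pow (c : ℝ) (m : ℕ) :
    (fun x : ℝ => (x - c) ^ m) =O[atTop] fun x : ℝ => x ^ m :=
  ((isBigO_refl id atTop).sub (isLittleO_const_id_atTop c).isBigO).pow m

theorem isBigO_sub_pow_sub_pow (c : ℝ) (m : ℕ) :
    (fun x : ℝ => (x - c) ^ m - x ^ m) =O[atTop] fun x : ℝ => x ^ (m - 1) := by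
  induction m with
  | zero => simpa using isBoundedUnder_const
  | succ m ih =>
    rcases m with _ | m
    · simpa using isBoundedUnder_const
    have hmul : (fun x : ℝ => x * ((x - c) ^ (m + 1) - x ^ (m + 1))) =O[atTop]
        fun x : ℝ => x ^ (m + 1) := by
      simpa only [Nat.add_sub_cancel, ← pow_succ'] using
        (isBigO_refl (fun x : ℝ => x) atTop).mul ih
    refine (hmul.sub ((isBigO_sub_pow c (m + 1)).const_mul_left c)).congr_left fun x => ?_
    ring

theorem isLittleO_sub_pow_sub_pow (c : ℝ) (m : ℕ) :
    (fun x : ℝ => (x - c) ^ (m + 1) - (x ^ (m + 1) - (m + 1) * c * x ^ m)) =o[atTop]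
      fun x : ℝ => x ^ m := by
  induction m with
  | zero => simp
  | succ m ih =>
    have hmul : (fun x : ℝ => x * ((x - c) ^ (m + 1) - (x ^ (m + 1) - (m + 1) * c * x ^ m)))
        =o[atTop] fun x : ℝ => x ^ (m + 1) := by
      simpa only [← pow_succ'] using (isBigO_refl (fun x : ℝ => x) atTop).mul_isLittleO ih
    have hfirst := ((isBigO_sub_pow_sub_pow c (m + 1)).trans_isLittleO
      (isLittleO_pow_pow_atTop_of_lt m.lt_succ_self)).const_mul_left c
    refine (hmul.sub hfirst).congr_left fun x => ?_
    push_cast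
    ring

theorem not_isLittleO_pow_self (n : ℕ) :
    ¬(fun x : ℝ => x ^ n) =o[atTop] fun x : ℝ => x ^ n :=
  isLittleO_irrefl ((eventually_gt_atTop 0).frequently.mono fun _ hx => (pow_pos hx n).ne')

theorem eq_zero_of_isLittleO_pow {c : ℝ} {n : ℕ}
    (h : (fun x : ℝ => c * x ^ n) =o[atTop] fun x : ℝ => x ^ n) : c = 0 := by
  by_contra hc
  exact not_isLittleO_pow_self n ((isLittleO_const_mul_left_iff hc).1 h)

theorem le_of_isBigO_pow {m n : ℕ} (h : (fun x : ℝ => x ^ m) =O[atTop] fun x : ℝ => x ^ n) :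
    m ≤ n :=
  not_lt.1 fun hnm =>
    not_isLittleO_pow_self m (h.trans_isLittleO (isLittleO_pow_pow_atTop_of_lt hnm))

end PowerAsymptotics

/-- `a` and `b` are the Riemann-Roch coefficients in degree `n` of the locally integrable function
`h`. The second order term is encoded through the growth of the primitive of `h`, so that the
definition is meaningful also for `n = 0`. -/
structure HasRiemannRoch (n : ℕ) (h : ℝ → ℝ) (a b : ℝ) : Prop where
  integrable : ∀ S T, IntervalIntegrable h MeasureTheory.volume S T
  leading : (fun x : ℝ => h x - a / n.factorial * x ^ n) =O[atTop] fun x : ℝ => x ^ (n - 1)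
  area : (fun T : ℝ => (∫ x in (0 : ℝ)..T, h x) -
    (a / (n + 1).factorial * T ^ (n + 1) + b / n.factorial * T ^ n)) =o[atTop] fun T : ℝ => T ^ n

namespace HasRiemannRoch

variable {n : ℕ} {h h' : ℝ → ℝ} {a b a' b' : ℝ}

theorem zero (n : ℕ) : HasRiemannRoch n 0 0 0 where
  integrable S T := intervalIntegrable_const
  leading := by simpa using isBigO_zero _ _
  area := by simp

theorem add (H : HasRiemannRoch n h a b) (H' : HasRiemannRoch n h' a' b') :
    HasRiemannRoch n (h + h') (a + a') (b + b') where
  integrable S T := (H.integrable S T).add (H'.integrable S T)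
  leading := (H.leading.add H'.leading).congr_left fun x => by simp only [Pi.add_apply]; ring
  area := (H.area.add H'.area).congr_left fun T => by
    simp only [Pi.add_apply]
    rw [intervalIntegral.integral_add (H.integrable _ _) (H'.integrable _ _)]
    ring

theorem neg (H : HasRiemannRoch n h a b) : HasRiemannRoch n (-h) (-a) (-b) where
  integrable S T := (H.integrable S T).neg
  leading := H.leading.neg_left.congr_left fun x => by simp only [Pi.neg_apply]; ring
  area := H.area.neg_left.congr_left fun T => by
    simp only [Pi.neg_apply, intervalIntegral.integral_neg]
    ring

theorem sub (H : HasRiemannRoch n h a b) (H' : HasRiemannRoch n h' a' b') :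
    HasRiemannRoch n (h - h') (a - a') (b - b') := by
  simpa only [sub_eq_add_neg] using H.add H'.neg

theorem unique (H : HasRiemannRoch n h a b) (H' : HasRiemannRoch n h a' b') :
    a = a' ∧ b = b' := by
  have hdiff := H'.area.sub H.area
  have ha : a = a' := by
    have hdegree := isLittleO_pow_pow_atTop_of_lt (𝕜 := ℝ) n.lt_succ_self
    have hzero : (a - a') / (n + 1).factorial = 0 := eq_zero_of_isLittleO_pow (n := n + 1)
      (((hdiff.trans hdegree).sub (hdegree.const_mul_left ((b - b') / n.factorial))).congr_left
        fun x => by ring)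
    rwa [div_eq_zero_iff, or_iff_left (by positivity), sub_eq_zero] at hzero
  subst ha
  have hzero : (b - b') / n.factorial = 0 := eq_zero_of_isLittleO_pow (n := n)
    (hdiff.congr_left fun x => by ring)
  rw [div_eq_zero_iff, or_iff_left (by positivity), sub_eq_zero] at hzero
  exact ⟨rfl, hzero⟩

theorem succ (H : HasRiemannRoch n h a b) : HasRiemannRoch (n + 1) h 0 a where
  integrable := H.integrable
  leading := by
    have hpow := (isBigO_refl (fun x : ℝ => x ^ n) atTop).const_mul_left (a / n.factorial)
    refine ((H.leading.trans (isBigO_pow_of_le (n.sub_le 1))).add hpow).congr_left fun x => ?_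
    ring
  area := by
    have hdegree := isLittleO_pow_pow_atTop_of_lt (𝕜 := ℝ) n.lt_succ_self
    refine ((H.area.trans hdegree).add
      (hdegree.const_mul_left (b / n.factorial))).congr_left fun T => ?_
    ring

theorem eq_zero_of_add_two_le (H : HasRiemannRoch n h a b) {m : ℕ} (hm : n + 2 ≤ m) :
    HasRiemannRoch m h 0 0 := by
  induction m, hm using Nat.le_induction with
  | base => exact H.succ.succ
  | succ m _ ih => exact ih.succ

theorem comp_sub_right (hn : 1 ≤ n) (H : HasRiemannRoch n h a b) (c : ℝ) :
    HasRiemannRoch n (fun x => h (x - c)) a (b - c * a) := by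
  obtain ⟨n, rfl⟩ := Nat.exists_eq_add_of_le' hn
  have hshift : Tendsto (fun x : ℝ => x - c) atTop atTop :=
    tendsto_atTop_add_const_right _ _ tendsto_id
  refine ⟨fun S T => ?_, ?_, ?_⟩
  · simpa using (H.integrable (S - c) (T - c)).comp_sub_right c
  · refine (((H.leading.comp_tendsto hshift).trans (isBigO_sub_pow c n)).add
      ((isBigO_sub_pow_sub_pow c (n + 1)).const_mul_left (a / (n + 1).factorial))).congr_left
        fun x => ?_
    simp only [Function.comp]
    ring
  · have hdegree := isLittleO_pow_pow_atTop_of_lt (𝕜 := ℝ) n.lt_succ_self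
    have hleading := (isLittleO_sub_pow_sub_pow c (n + 1)).const_mul_left
      (a / (n + 1 + 1).factorial)
    have hsecond := ((isBigO_sub_pow_sub_pow c (n + 1)).trans_isLittleO hdegree).const_mul_left
      (b / (n + 1).factorial)
    have hconst : (fun _ : ℝ => ∫ x in (0 - c)..0, h x) =o[atTop] fun x : ℝ => x ^ (n + 1) :=
      (isLittleO_const_id_atTop _).trans_isBigO
        ((isBigO_pow_of_le hn).congr_left pow_one)
    refine ((((H.area.comp_tendsto hshift).trans_isBigO (isBigO_sub_pow c (n + 1))).add
      hleading).add hsecond |>.add hconst).congr_left fun T => ?_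
    have hsplit : ∫ x in (0 : ℝ)..T, h (x - c) =
        (∫ x in (0 - c)..0, h x) + ∫ x in (0 : ℝ)..(T - c), h x := by
      rw [intervalIntegral.integral_comp_sub_right,
        intervalIntegral.integral_add_adjacent_intervals (H.integrable _ _) (H.integrable _ _)]
    have hfactorial : a / (n + 1).factorial = a / (n + 1 + 1).factorial * (n + 1 + 1) := by
      rw [Nat.factorial_succ (n + 1)]
      push_cast
      field_simp
    rw [hsplit, sub_div, mul_div_assoc, hfactorial]
    simp only [Function.comp]
    push_cast
    ring

end HasRiemannRoch

section WeightCountAsymptotics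

variable {ws : List ℝ}

theorem isBigO_pow_weightCount (hws : ∀ w ∈ ws, 0 < w) :
    (fun x : ℝ => x ^ ws.length) =O[atTop] weightCount ws := by
  refine .of_bound (ws.length.factorial * ws.prod) ?_
  filter_upwards [eventually_ge_atTop 0] with x hx
  rw [Real.norm_of_nonneg (by positivity), Real.norm_of_nonneg (weightCount_nonneg ws x)]
  exact pow_le_weightCount hws hx

theorem isBigO_weightCount_sub_pow (hws : ∀ w ∈ ws, 0 < w) :
    (fun x => weightCount ws x - ws.prod⁻¹ / ws.length.factorial * x ^ ws.length) =O[atTop]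
      fun x : ℝ => x ^ (ws.length - 1) := by
  have hprod : 0 < ws.prod := List.prod_pos hws
  refine .trans (.of_bound (ws.prod⁻¹ / ws.length.factorial) ?_)
    (isBigO_sub_pow_sub_pow (-ws.sum) ws.length)
  filter_upwards [eventually_ge_atTop 0] with x hx
  have hlower := pow_le_weightCount hws hx
  have hupper := weightCount_le_pow hws hx
  have hscale : weightCount ws x - ws.prod⁻¹ / ws.length.factorial * x ^ ws.length =
      ws.prod⁻¹ / ws.length.factorial *
        (ws.length.factorial * ws.prod * weightCount ws x - x ^ ws.length) := by
    field_simp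
  rw [hscale, norm_mul, Real.norm_of_nonneg (by positivity), sub_neg_eq_add]
  gcongr
  rw [Real.norm_of_nonneg (by linarith), Real.norm_of_nonneg (by linarith)]
  linarith

theorem isLittleO_integral_weightCount (hws : ∀ w ∈ ws, 0 < w) :
    (fun T => (∫ x in (0 : ℝ)..T, weightCount ws x) -
      (ws.prod⁻¹ / (ws.length + 1).factorial * T ^ (ws.length + 1) +
        ws.sum / 2 * ws.prod⁻¹ / ws.length.factorial * T ^ ws.length)) =o[atTop]
      fun T : ℝ => T ^ ws.length := by
  have hprod : 0 < ws.prod := List.prod_pos hws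
  refine IsBigO.trans_isLittleO (.of_bound (ws.prod⁻¹ / (ws.length + 1).factorial) ?_)
    (isLittleO_sub_pow_sub_pow (-(ws.sum / 2)) ws.length)
  filter_upwards [eventually_ge_atTop 0] with T hT
  have hlower := pow_add_pow_le_integral_weightCount hws hT
  have hupper := integral_weightCount_le_pow hws hT
  have hscale : (∫ x in (0 : ℝ)..T, weightCount ws x) -
      (ws.prod⁻¹ / (ws.length + 1).factorial * T ^ (ws.length + 1) +
        ws.sum / 2 * ws.prod⁻¹ / ws.length.factorial * T ^ ws.length) =
      ws.prod⁻¹ / (ws.length + 1).factorial *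
        ((ws.length + 1).factorial * ws.prod * (∫ x in (0 : ℝ)..T, weightCount ws x) -
          (T ^ (ws.length + 1) + (ws.length + 1) * (ws.sum / 2) * T ^ ws.length)) := by
    rw [Nat.factorial_succ]
    push_cast
    field_simp
  rw [hscale, norm_mul, Real.norm_of_nonneg (by positivity), sub_neg_eq_add]
  gcongr
  rw [Real.norm_of_nonneg (by linarith), Real.norm_of_nonneg (by linarith)]
  linarith

theorem hasRiemannRoch_weightCount (hws : ∀ w ∈ ws, 0 < w) :
    HasRiemannRoch ws.length (weightCount ws) ws.prod⁻¹ (ws.sum / 2 * ws.prod⁻¹) where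
  integrable := intervalIntegrable_weightCount hws
  leading := isBigO_weightCount_sub_pow hws
  area := isLittleO_integral_weightCount hws

end WeightCountAsymptotics

section WeightCone

/-- The Hilbert functions of the finite direct sums of shifted polynomial rings whose variables have
degrees forming a sublist of `W`. -/
def weightCone (W : List ℝ) : AddSubmonoid (ℝ → ℝ) :=
  AddSubmonoid.closure
    {h | ∃ (ws : List ℝ) (c : ℝ), ws.Sublist W ∧ h = fun x => weightCount ws (x - c)}

/-- The possible values of `d!` times the coefficient of `x ^ d` for functions in `weightCone W`
that grow like `x ^ d`. -/
def densityMonoid (W : List ℝ) (d : ℕ) : AddSubmonoid ℝ :=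
  AddSubmonoid.closure {t | ∃ ws : List ℝ, ws.Sublist W ∧ ws.length = d ∧ ws.prod⁻¹ = t}

variable {W : List ℝ} {h : ℝ → ℝ}

theorem weightCone_mono {W' : List ℝ} (hW : W.Sublist W') : weightCone W ≤ weightCone W' := by
  refine AddSubmonoid.closure_mono ?_
  rintro _ ⟨ws, c, hws, rfl⟩
  exact ⟨ws, c, hws.trans hW, rfl⟩

theorem indicator_Ici_mem_weightCone (W : List ℝ) (c : ℝ) :
    (fun x => if c ≤ x then 1 else 0) ∈ weightCone W :=
  AddSubmonoid.subset_closure ⟨[], c, W.nil_sublist, by simp only [weightCount, sub_nonneg]⟩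

theorem nonneg_of_mem_weightCone (hh : h ∈ weightCone W) : 0 ≤ h := by
  induction hh using AddSubmonoid.closure_induction with
  | mem h hh =>
    obtain ⟨ws, c, -, rfl⟩ := hh
    exact fun x => weightCount_nonneg ws (x - c)
  | zero => exact le_rfl
  | add h h' _ _ ih ih' => exact add_nonneg ih ih'

theorem exists_mem_weightCone_cons_eq_sum_range (hh : h ∈ weightCone W) (hW : ∀ v ∈ W, 0 < v)
    {w : ℝ} (hw : 0 < w) : ∃ g ∈ weightCone (w :: W),
      ∀ x, ∀ᶠ N in atTop, g x = ∑ i ∈ Finset.range N, h (x - i * w) := by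
  induction hh using AddSubmonoid.closure_induction with
  | mem h hh =>
    obtain ⟨ws, c, hws, rfl⟩ := hh
    refine ⟨_, AddSubmonoid.subset_closure ⟨w :: ws, c, hws.cons_cons w, rfl⟩, fun x => ?_⟩
    filter_upwards [eventually_ge_atTop (⌊(x - c) / w⌋₊ + 1)] with N hN
    rw [weightCount_cons_eq_sum_range
      (List.forall_mem_cons.2 ⟨hw, fun v hv => hW v (hws.subset hv)⟩) hN]
    simp only [sub_right_comm]
  | zero => exact ⟨0, zero_mem _, fun x => by simp⟩
  | add h h' _ _ ih ih' =>
    obtain ⟨g, hg, hgh⟩ := ih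
    obtain ⟨g', hg', hgh'⟩ := ih'
    refine ⟨g + g', add_mem hg hg', fun x => ?_⟩
    filter_upwards [hgh x, hgh' x] with N hN hN'
    simp only [Pi.add_apply, hN, hN', Finset.sum_add_distrib]

theorem nonneg_of_mem_densityMonoid (hW : ∀ v ∈ W, 0 < v) {d : ℕ} {t : ℝ}
    (ht : t ∈ densityMonoid W d) : 0 ≤ t := by
  induction ht using AddSubmonoid.closure_induction with
  | mem t ht =>
    obtain ⟨ws, hws, -, rfl⟩ := ht
    exact inv_nonneg.2 (List.prod_pos fun v hv => hW v (hws.subset hv)).le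
  | zero => exact le_rfl
  | add s t _ _ hs ht => exact add_nonneg hs ht

theorem isPWO_densityMonoid (hW : ∀ v ∈ W, 0 < v) (d : ℕ) :
    (densityMonoid W d : Set ℝ).IsPWO := by
  refine Set.IsPWO.addSubmonoid_closure
    (fun t ht => nonneg_of_mem_densityMonoid hW (AddSubmonoid.subset_closure ht))
    (((List.finite_toSet W.sublists).image fun ws => ws.prod⁻¹).subset ?_).isPWO
  rintro _ ⟨ws, hws, -, rfl⟩
  exact ⟨ws, List.mem_sublists.2 hws, rfl⟩

theorem exists_hasRiemannRoch_weightCount_sub {ws : List ℝ} (hws : ws.Sublist W)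
    (hW : ∀ v ∈ W, 0 < v) (c : ℝ) {n : ℕ} (hn : 1 ≤ n)
    (hO : (fun x => weightCount ws (x - c)) =O[atTop] fun x : ℝ => x ^ n) :
    ∃ a b, HasRiemannRoch n (fun x => weightCount ws (x - c)) a b ∧ a ∈ densityMonoid W n ∧
      (a = 0 → b ∈ densityMonoid W (n - 1)) := by
  have hpos : ∀ v ∈ ws, 0 < v := fun v hv => hW v (hws.subset hv)
  have hRR := hasRiemannRoch_weightCount hpos
  have hdensity : ∀ d, ws.length = d → ws.prod⁻¹ ∈ densityMonoid W d :=
    fun d hd => AddSubmonoid.subset_closure ⟨ws, hws, hd, rfl⟩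
  have hlen : ws.length ≤ n := by
    have hshift : Tendsto (fun x : ℝ => x - -c) atTop atTop :=
      tendsto_atTop_add_const_right _ _ tendsto_id
    refine le_of_isBigO_pow ((isBigO_pow_weightCount hpos).trans
      (((hO.comp_tendsto hshift).trans (isBigO_sub_pow (-c) n)).congr_left fun x => ?_))
    simp [Function.comp]
  rcases hlen.eq_or_lt with rfl | hlt
  · exact ⟨_, _, hRR.comp_sub_right hn c, hdensity _ rfl,
      fun ha => absurd ha (inv_ne_zero (List.prod_pos hpos).ne')⟩
  rcases (Nat.succ_le_of_lt hlt).eq_or_lt with rfl | hlt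
  · refine ⟨_, _, hRR.succ.comp_sub_right hn c, zero_mem _, fun _ => ?_⟩
    simpa using hdensity _ rfl
  · exact ⟨_, _, (hRR.eq_zero_of_add_two_le hlt).comp_sub_right hn c, zero_mem _, fun _ => by simp⟩

theorem isBigO_left_of_add {f g u : ℝ → ℝ} {l : Filter ℝ} (hf : 0 ≤ f) (hg : 0 ≤ g)
    (h : (f + g) =O[l] u) : f =O[l] u := by
  refine .trans (.of_norm_le fun x => ?_) h
  rw [Real.norm_of_nonneg (hf x)]
  exact le_add_of_nonneg_right (hg x)

theorem exists_hasRiemannRoch_of_mem_weightCone (hh : h ∈ weightCone W) (hW : ∀ v ∈ W, 0 < v)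
    {n : ℕ} (hn : 1 ≤ n) (hO : h =O[atTop] fun x : ℝ => x ^ n) :
    ∃ a b, HasRiemannRoch n h a b ∧ a ∈ densityMonoid W n ∧
      (a = 0 → b ∈ densityMonoid W (n - 1)) := by
  induction hh using AddSubmonoid.closure_induction with
  | mem h hh =>
    obtain ⟨ws, c, hws, rfl⟩ := hh
    exact exists_hasRiemannRoch_weightCount_sub hws hW c hn hO
  | zero => exact ⟨0, 0, .zero n, zero_mem _, fun _ => zero_mem _⟩
  | add h h' hh hh' ih ih' =>
    have hnonneg := nonneg_of_mem_weightCone hh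
    have hnonneg' := nonneg_of_mem_weightCone hh'
    obtain ⟨a, b, hRR, ha, hb⟩ := ih (isBigO_left_of_add hnonneg hnonneg' hO)
    obtain ⟨a', b', hRR', ha', hb'⟩ :=
      ih' (isBigO_left_of_add hnonneg' hnonneg (add_comm h h' ▸ hO))
    refine ⟨_, _, hRR.add hRR', add_mem ha ha', fun hsum => ?_⟩
    obtain ⟨ha0, ha0'⟩ := (add_eq_zero_iff_of_nonneg (nonneg_of_mem_densityMonoid hW ha)
      (nonneg_of_mem_densityMonoid hW ha')).1 hsum
    exact add_mem (hb ha0) (hb' ha0')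

end WeightCone

section Truncation

variable {k M : Type*} [Field k] [AddCommGroup M] [Module k M]

/-- The subspace `M_{≤ x}` of a graded vector space. -/
def gradedLE (ℳ : ℝ → Submodule k M) (x : ℝ) : Submodule k M := ⨆ t : Set.Iic x, ℳ t

/-- The Hilbert function `x ↦ dim U_{≤ x}` of a homogeneous subspace `U`. -/
noncomputable def hilbertFun (ℳ : ℝ → Submodule k M) (U : Submodule k M) (x : ℝ) : ℝ :=
  Module.finrank k (U ⊓ gradedLE ℳ x : Submodule k M)

variable {ℳ : ℝ → Submodule k M}

theorem le_gradedLE {t x : ℝ} (h : t ≤ x) : ℳ t ≤ gradedLE ℳ x :=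
  le_iSup (fun t : Set.Iic x => ℳ t) ⟨t, h⟩

theorem gradedLE_mono {x y : ℝ} (h : x ≤ y) : gradedLE ℳ x ≤ gradedLE ℳ y :=
  iSup_le fun t => le_gradedLE (t.2.trans h)

theorem gradedLE_eq_bot {c : ℝ} (hc : ∀ t < c, ℳ t = ⊥) {x : ℝ} (hx : x < c) :
    gradedLE ℳ x = ⊥ :=
  iSup_eq_bot.2 fun t => hc t (t.2.trans_lt hx)

theorem hilbertFun_eq_zero {c : ℝ} (hc : ∀ t < c, ℳ t = ⊥) (U : Submodule k M) {x : ℝ}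
    (hx : x < c) : hilbertFun ℳ U x = 0 := by
  rw [hilbertFun, gradedLE_eq_bot hc hx, inf_bot_eq, finrank_bot, Nat.cast_zero]

theorem hilbertFun_top (x : ℝ) : hilbertFun ℳ ⊤ x = dimLE ℳ x := by
  rw [hilbertFun, top_inf_eq]
  rfl

theorem hilbertFun_bot (x : ℝ) : hilbertFun ℳ ⊥ x = 0 := by
  rw [hilbertFun, bot_inf_eq, finrank_bot, Nat.cast_zero]

theorem hilbertFun_nonneg (U : Submodule k M) (x : ℝ) : 0 ≤ hilbertFun ℳ U x :=
  Nat.cast_nonneg _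

theorem finiteDimensional_inf_gradedLE (hfin : ∀ x, FiniteDimensional k (gradedLE ℳ x))
    (U : Submodule k M) (x : ℝ) : FiniteDimensional k (U ⊓ gradedLE ℳ x : Submodule k M) :=
  have := hfin x
  Submodule.finiteDimensional_of_le inf_le_right

theorem hilbertFun_mono (hfin : ∀ x, FiniteDimensional k (gradedLE ℳ x)) {U V : Submodule k M}
    (h : U ≤ V) (x : ℝ) : hilbertFun ℳ U x ≤ hilbertFun ℳ V x :=
  have := finiteDimensional_inf_gradedLE hfin V x
  Nat.cast_le.2 (Submodule.finrank_mono (inf_le_inf_right _ h))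

variable [DirectSum.Decomposition ℳ]

open scoped Classical in
/-- The projection of a graded vector space `M` onto `M_{≤ x}` along the pieces of degree `> x`. -/
noncomputable def truncation (ℳ : ℝ → Submodule k M) [DirectSum.Decomposition ℳ] (x : ℝ) :
    M →ₗ[k] M :=
  DirectSum.toModule k ℝ M (fun t => if t ≤ x then (ℳ t).subtype else 0) ∘ₗ
    (DirectSum.decomposeLinearEquiv ℳ).toLinearMap

theorem truncation_of_mem {t x : ℝ} {m : M} (hm : m ∈ ℳ t) :
    truncation ℳ x m = if t ≤ x then m else 0 := by
  classical
  have : DirectSum.decomposeLinearEquiv ℳ m = DirectSum.lof k ℝ (fun t => ℳ t) t ⟨m, hm⟩ :=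
    DirectSum.decompose_of_mem ℳ hm
  simp only [truncation, LinearMap.comp_apply, LinearEquiv.coe_coe, this, DirectSum.toModule_lof]
  split_ifs <;> simp

theorem truncation_mem_gradedLE (x : ℝ) (m : M) : truncation ℳ x m ∈ gradedLE ℳ x := by
  induction m using DirectSum.Decomposition.inductionOn ℳ with
  | zero => simp
  | @homogeneous t m =>
    rw [truncation_of_mem m.2]
    split_ifs with h
    · exact le_gradedLE h m.2
    · exact zero_mem _
  | add a b ha hb => rw [map_add]; exact add_mem ha hb

theorem truncation_eq_self {x : ℝ} {m : M} (hm : m ∈ gradedLE ℳ x) : truncation ℳ x m = m := by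
  have : gradedLE ℳ x ≤ LinearMap.eqLocus (truncation ℳ x) LinearMap.id := by
    refine iSup_le fun t m hm => ?_
    have ht : (t : ℝ) ≤ x := t.2
    simp [truncation_of_mem hm, ht]
  exact this hm

theorem truncation_mem {U : Submodule k M} (hU : U.IsHomogeneous ℳ) (x : ℝ) {m : M}
    (hm : m ∈ U) : truncation ℳ x m ∈ U := by
  classical
  rw [← DirectSum.sum_support_decompose ℳ m, map_sum]
  refine sum_mem fun t _ => ?_
  rw [truncation_of_mem (DirectSum.decompose ℳ m t).2]
  split_ifs
  · exact hU t hm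
  · exact zero_mem _

theorem map_truncation {U : Submodule k M} (hU : U.IsHomogeneous ℳ) (x : ℝ) :
    U.map (truncation ℳ x) = U ⊓ gradedLE ℳ x := by
  refine le_antisymm ?_ fun m hm => ⟨m, hm.1, truncation_eq_self hm.2⟩
  rintro _ ⟨m, hm, rfl⟩
  exact ⟨truncation_mem hU x hm, truncation_mem_gradedLE x m⟩

section Homogeneous

variable {S : Type*} [Semiring S] [Module S M] {U V : Submodule S M}

theorem isHomogeneous_sup (hU : U.IsHomogeneous ℳ) (hV : V.IsHomogeneous ℳ) :
    (U ⊔ V).IsHomogeneous ℳ := by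
  intro t m hm
  obtain ⟨u, hu, v, hv, rfl⟩ := Submodule.mem_sup.1 hm
  rw [DirectSum.decompose_add, DirectSum.add_apply]
  exact Submodule.add_mem_sup (hU t hu) (hV t hv)

theorem isHomogeneous_inf (hU : U.IsHomogeneous ℳ) (hV : V.IsHomogeneous ℳ) :
    (U ⊓ V).IsHomogeneous ℳ :=
  fun t _ hm => ⟨hU t hm.1, hV t hm.2⟩

theorem isHomogeneous_bot : (⊥ : Submodule S M).IsHomogeneous ℳ := by
  intro t m hm
  rw [(Submodule.mem_bot S).1 hm]
  simp

theorem isHomogeneous_top : (⊤ : Submodule S M).IsHomogeneous ℳ :=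
  fun _ _ _ => Submodule.mem_top

end Homogeneous

theorem isHomogeneous_span_singleton {t : ℝ} {m : M} (hm : m ∈ ℳ t) :
    (Submodule.span k {m}).IsHomogeneous ℳ := by
  intro i v hv
  obtain ⟨c, rfl⟩ := Submodule.mem_span_singleton.1 hv
  by_cases hi : t = i
  · subst hi
    rwa [DirectSum.decompose_of_mem_same ℳ ((ℳ t).smul_mem c hm)]
  · rw [DirectSum.decompose_of_mem_ne ℳ ((ℳ t).smul_mem c hm) hi]
    exact zero_mem _

theorem hilbertFun_span_singleton {t : ℝ} {m : M} (hm : m ∈ ℳ t) (hm0 : m ≠ 0) (x : ℝ) :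
    hilbertFun ℳ (Submodule.span k {m}) x = if t ≤ x then 1 else 0 := by
  rw [hilbertFun, ← map_truncation (isHomogeneous_span_singleton hm), Submodule.map_span,
    Set.image_singleton, truncation_of_mem hm]
  by_cases ht : t ≤ x
  · rw [if_pos ht, if_pos ht, finrank_span_singleton hm0, Nat.cast_one]
  · rw [if_neg ht, if_neg ht, Submodule.span_zero_singleton, finrank_bot, Nat.cast_zero]

theorem sup_inf_gradedLE {U V : Submodule k M} (hU : U.IsHomogeneous ℳ) (hV : V.IsHomogeneous ℳ)
    (x : ℝ) : (U ⊔ V) ⊓ gradedLE ℳ x = U ⊓ gradedLE ℳ x ⊔ V ⊓ gradedLE ℳ x := by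
  rw [← map_truncation (isHomogeneous_sup hU hV), ← map_truncation hU, ← map_truncation hV,
    Submodule.map_sup]

theorem hilbertFun_sup_add_inf (hfin : ∀ x, FiniteDimensional k (gradedLE ℳ x))
    {U V : Submodule k M} (hU : U.IsHomogeneous ℳ) (hV : V.IsHomogeneous ℳ) (x : ℝ) :
    hilbertFun ℳ (U ⊔ V) x + hilbertFun ℳ (U ⊓ V) x = hilbertFun ℳ U x + hilbertFun ℳ V x := by
  have := finiteDimensional_inf_gradedLE hfin U x
  have := finiteDimensional_inf_gradedLE hfin V x
  have hrank := Submodule.finrank_sup_add_finrank_inf_eq (U ⊓ gradedLE ℳ x) (V ⊓ gradedLE ℳ x)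
  rw [← sup_inf_gradedLE hU hV, ← inf_inf_distrib_right] at hrank
  simp only [hilbertFun]
  exact_mod_cast hrank

/-- The difference is a sum of indicator functions of half-lines, one for each new basis vector. -/
theorem hilbertFun_sup_span_sub_mem_weightCone (hfin : ∀ x, FiniteDimensional k (gradedLE ℳ x))
    {U : Submodule k M} (hU : U.IsHomogeneous ℳ) (W : List ℝ) (s : Finset M)
    (hs : ∀ m ∈ s, ∃ t, m ∈ ℳ t) :
    hilbertFun ℳ (U ⊔ Submodule.span k s) - hilbertFun ℳ U ∈ weightCone W := by
  classical
  induction s using Finset.induction_on generalizing U with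
  | empty => simp
  | insert m s _ ih =>
    obtain ⟨⟨t, hmt⟩, hs⟩ := Finset.forall_mem_insert _ _ _ |>.1 hs
    rw [Finset.coe_insert, Submodule.span_insert, ← sup_assoc]
    by_cases hmU : m ∈ U
    · rw [sup_eq_left.2 ((Submodule.span_singleton_le_iff_mem m U).2 hmU)]
      exact ih hU hs
    have hm0 : m ≠ 0 := fun h => hmU (h ▸ zero_mem U)
    have hspan := isHomogeneous_span_singleton hmt
    have hinf : U ⊓ Submodule.span k {m} = ⊥ :=
      ((Submodule.disjoint_span_singleton' hm0).2 hmU).eq_bot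
    have hstep : hilbertFun ℳ (U ⊔ Submodule.span k {m}) - hilbertFun ℳ U =
        fun x => if t ≤ x then 1 else 0 := by
      funext x
      have hsum := hilbertFun_sup_add_inf hfin hU hspan x
      rw [hinf, hilbertFun_bot, add_zero, hilbertFun_span_singleton hmt hm0] at hsum
      exact sub_eq_of_eq_add' hsum
    rw [← sub_add_sub_cancel _ (hilbertFun ℳ (U ⊔ Submodule.span k {m})), hstep]
    exact add_mem (ih (isHomogeneous_sup hU hspan) hs) (indicator_Ici_mem_weightCone W t)

end Truncation

section HomogeneousComponents

variable {k M : Type*} [Field k] [AddCommGroup M] [Module k M]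
  (ℳ : ℝ → Submodule k M) [DirectSum.Decomposition ℳ]

open scoped Classical in
/-- The nonzero homogeneous components of the elements of `s`, together with their degrees. -/
noncomputable def homogeneousComponents (s : Finset M) : Finset (M × ℝ) :=
  s.biUnion fun m => (DirectSum.decompose ℳ m).support.image
    fun t => ((DirectSum.decompose ℳ m t : M), t)

variable {ℳ} {s : Finset M}

theorem mem_homogeneousComponents {p : M × ℝ} : p ∈ homogeneousComponents ℳ s ↔
    ∃ m ∈ s, (DirectSum.decompose ℳ m p.2 : M) = p.1 ∧ p.1 ≠ 0 := by
  classical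
  obtain ⟨v, t⟩ := p
  simp only [homogeneousComponents, Finset.mem_biUnion, Finset.mem_image, DFinsupp.mem_support_iff,
    Prod.mk.injEq, ne_eq]
  refine exists_congr fun m => and_congr_right fun _ => ⟨?_, ?_⟩
  · rintro ⟨t, ht, rfl, rfl⟩
    exact ⟨rfl, by simpa using ht⟩
  · rintro ⟨rfl, ht⟩
    exact ⟨t, by simpa using ht, rfl, rfl⟩

theorem mem_of_mem_homogeneousComponents {p : M × ℝ} (hp : p ∈ homogeneousComponents ℳ s) :
    p.1 ∈ ℳ p.2 := by
  obtain ⟨m, -, hm, -⟩ := mem_homogeneousComponents.1 hp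
  exact hm ▸ (DirectSum.decompose ℳ m p.2).2

theorem mem_of_forall_homogeneousComponents {σ : Type*} [SetLike σ M] [AddSubmonoidClass σ M]
    {U : σ} (hU : ∀ p ∈ homogeneousComponents ℳ s, p.1 ∈ U) {m : M} (hm : m ∈ s) : m ∈ U := by
  classical
  rw [← DirectSum.sum_support_decompose ℳ m]
  refine sum_mem fun t ht => hU (_, t) (mem_homogeneousComponents.2 ⟨m, hm, rfl, ?_⟩)
  simpa using ht

end HomogeneousComponents

section Shift

variable {k V M : Type*} [Field k] [AddCommGroup V] [Module k V] [AddCommGroup M] [Module k M]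

theorem finrank_map_add_finrank_inf_ker (g : V →ₗ[k] M) (U : Submodule k V)
    [FiniteDimensional k U] :
    Module.finrank k (U.map g) + Module.finrank k (U ⊓ LinearMap.ker g : Submodule k V) =
      Module.finrank k U := by
  rw [← LinearMap.finrank_range_add_finrank_ker (g.domRestrict U), LinearMap.range_domRestrict,
    LinearMap.ker_domRestrict, ← Submodule.map_comap_subtype, Submodule.finrank_map_subtype_eq]

theorem finrank_sup_map_add_finrank_inf_comap (g : V →ₗ[k] M) (U : Submodule k V)
    (C : Submodule k M) [FiniteDimensional k U] [FiniteDimensional k C] :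
    Module.finrank k (C ⊔ U.map g : Submodule k M) +
      Module.finrank k (U ⊓ C.comap g : Submodule k V) =
    Module.finrank k C + Module.finrank k U := by
  have hmap : (U ⊓ C.comap g).map g = C ⊓ U.map g := by
    rw [inf_comm C]
    exact SetLike.coe_injective (Set.image_inter_preimage g U C)
  have hker : U ⊓ C.comap g ⊓ LinearMap.ker g = U ⊓ LinearMap.ker g := by
    rw [inf_assoc, inf_eq_right.2 (LinearMap.ker_le_comap g)]
  have : FiniteDimensional k (U ⊓ C.comap g : Submodule k V) :=
    Submodule.finiteDimensional_of_le inf_le_left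
  have hsup := Submodule.finrank_sup_add_finrank_inf_eq C (U.map g)
  have hU := finrank_map_add_finrank_inf_ker g U
  have hinf := finrank_map_add_finrank_inf_ker g (U ⊓ C.comap g)
  rw [hmap, hker] at hinf
  omega

variable {𝒱 : ℝ → Submodule k V} [DirectSum.Decomposition 𝒱]
  {ℳ : ℝ → Submodule k M} [DirectSum.Decomposition ℳ] {g : V →ₗ[k] M} {w : ℝ}
  (hg : ∀ t, ∀ v ∈ 𝒱 t, g v ∈ ℳ (t + w))

include hg

theorem decompose_map_shift (v : V) (t : ℝ) :
    (DirectSum.decompose ℳ (g v) (t + w) : M) = g (DirectSum.decompose 𝒱 v t) := by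
  induction v using DirectSum.Decomposition.inductionOn 𝒱 with
  | zero => simp
  | @homogeneous s v =>
    rw [DirectSum.decompose_of_mem ℳ (hg s v v.2), DirectSum.decompose_coe]
    by_cases h : s = t
    · subst h
      rw [DirectSum.of_eq_same, DirectSum.of_eq_same]
    · rw [DirectSum.of_eq_of_ne _ _ _ (fun h' => h (add_right_cancel h').symm),
        DirectSum.of_eq_of_ne _ _ _ (Ne.symm h), ZeroMemClass.coe_zero, ZeroMemClass.coe_zero,
        map_zero]
  | add a b ha hb => simp [DirectSum.decompose_add, ha, hb]

theorem truncation_comp_shift (x : ℝ) : truncation ℳ x ∘ₗ g = g ∘ₗ truncation 𝒱 (x - w) := by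
  ext v
  simp only [LinearMap.comp_apply]
  induction v using DirectSum.Decomposition.inductionOn 𝒱 with
  | zero => simp
  | @homogeneous s v =>
    simp only [truncation_of_mem (hg s v v.2), truncation_of_mem v.2, ← le_sub_iff_add_le]
    split_ifs <;> simp
  | add a b ha hb => simp [ha, hb]

theorem isHomogeneous_map_shift {U : Submodule k V} (hU : U.IsHomogeneous 𝒱) :
    (U.map g).IsHomogeneous ℳ := by
  rintro t _ ⟨u, hu, rfl⟩
  rw [← sub_add_cancel t w, decompose_map_shift hg]
  exact ⟨_, hU _ hu, rfl⟩

theorem isHomogeneous_comap_shift {C : Submodule k M} (hC : C.IsHomogeneous ℳ) :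
    (C.comap g).IsHomogeneous 𝒱 := by
  intro t v hv
  rw [Submodule.mem_comap, ← decompose_map_shift hg]
  exact hC _ hv

theorem map_inf_gradedLE_shift {U : Submodule k V} (hU : U.IsHomogeneous 𝒱) (x : ℝ) :
    (U ⊓ gradedLE 𝒱 (x - w)).map g = U.map g ⊓ gradedLE ℳ x := by
  rw [← map_truncation hU, ← map_truncation (isHomogeneous_map_shift hg hU),
    ← Submodule.map_comp, ← Submodule.map_comp, truncation_comp_shift hg]

omit [DirectSum.Decomposition 𝒱] [DirectSum.Decomposition ℳ] in
theorem gradedLE_le_comap_shift (x : ℝ) : gradedLE 𝒱 (x - w) ≤ (gradedLE ℳ x).comap g :=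
  iSup_le fun t v hv => le_gradedLE (le_sub_iff_add_le.1 t.2) (hg t v hv)

theorem hilbertFun_sup_map_shift (hfin : ∀ x, FiniteDimensional k (gradedLE ℳ x))
    (hfin' : ∀ x, FiniteDimensional k (gradedLE 𝒱 x)) {U : Submodule k V}
    (hU : U.IsHomogeneous 𝒱) {C : Submodule k M} (hC : C.IsHomogeneous ℳ) (x : ℝ) :
    hilbertFun ℳ (C ⊔ U.map g) x - hilbertFun ℳ C x =
      hilbertFun 𝒱 U (x - w) - hilbertFun 𝒱 (U ⊓ C.comap g) (x - w) := by
  have := finiteDimensional_inf_gradedLE hfin C x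
  have := finiteDimensional_inf_gradedLE hfin' U (x - w)
  have hcomap : U ⊓ gradedLE 𝒱 (x - w) ⊓ (C ⊓ gradedLE ℳ x).comap g =
      U ⊓ C.comap g ⊓ gradedLE 𝒱 (x - w) := by
    rw [Submodule.comap_inf, inf_inf_inf_comm,
      inf_eq_left.2 (gradedLE_le_comap_shift hg x)]
  have hrank := finrank_sup_map_add_finrank_inf_comap g (U ⊓ gradedLE 𝒱 (x - w))
    (C ⊓ gradedLE ℳ x)
  rw [map_inf_gradedLE_shift hg hU, hcomap,
    ← sup_inf_gradedLE hC (isHomogeneous_map_shift hg hU)] at hrank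
  rw [sub_eq_sub_iff_add_eq_add, add_comm (hilbertFun 𝒱 U _)]
  simp only [hilbertFun]
  exact_mod_cast hrank

end Shift

section AdjoinSpan

variable {k R M : Type*} [Field k] [CommRing R] [Algebra k R] [AddCommGroup M] [Module R M]

theorem exists_add_mul_of_mem_adjoin_insert {X : Set R} {f a : R}
    (ha : a ∈ Algebra.adjoin k (insert f X)) :
    ∃ a₀ ∈ Algebra.adjoin k X, ∃ a₁ : R, a = a₀ + f * a₁ := by
  induction ha using Algebra.adjoin_induction with
  | mem a ha =>
    rcases ha with rfl | ha
    · exact ⟨0, zero_mem _, 1, by simp⟩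
    · exact ⟨a, Algebra.subset_adjoin ha, 0, by simp⟩
  | algebraMap r => exact ⟨_, Subalgebra.algebraMap_mem _ r, 0, by simp⟩
  | add a b _ _ ha hb =>
    obtain ⟨a₀, ha₀, a₁, rfl⟩ := ha
    obtain ⟨b₀, hb₀, b₁, rfl⟩ := hb
    exact ⟨_, add_mem ha₀ hb₀, a₁ + b₁, by ring⟩
  | mul a b _ _ ha hb =>
    obtain ⟨a₀, ha₀, a₁, rfl⟩ := ha
    obtain ⟨b₀, hb₀, b₁, rfl⟩ := hb
    exact ⟨_, mul_mem ha₀ hb₀, a₁ * (b₀ + f * b₁) + a₀ * b₁, by ring⟩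

theorem exists_add_smul_of_mem_span_adjoin_insert {X : Set R} {f : R} {s : Set M} {q : M}
    (hq : q ∈ Submodule.span (Algebra.adjoin k (insert f X)) s) :
    ∃ q₀ ∈ Submodule.span (Algebra.adjoin k X) s, ∃ q₁ ∈ Submodule.span R s,
      q = q₀ + f • q₁ := by
  induction hq using Submodule.span_induction with
  | mem m hm => exact ⟨m, Submodule.subset_span hm, 0, zero_mem _, by simp⟩
  | zero => exact ⟨0, zero_mem _, 0, zero_mem _, by simp⟩
  | add x y _ _ hx hy =>
    obtain ⟨x₀, hx₀, x₁, hx₁, rfl⟩ := hx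
    obtain ⟨y₀, hy₀, y₁, hy₁, rfl⟩ := hy
    exact ⟨_, add_mem hx₀ hy₀, _, add_mem hx₁ hy₁, by rw [smul_add]; abel⟩
  | smul a x hx ih =>
    obtain ⟨x₀, hx₀, x₁, hx₁, rfl⟩ := ih
    obtain ⟨a₀, ha₀, a₁, ha⟩ := exists_add_mul_of_mem_adjoin_insert a.2
    refine ⟨_, Submodule.smul_mem _ (⟨a₀, ha₀⟩ : Algebra.adjoin k X) hx₀,
      a₁ • (x₀ + f • x₁) + a₀ • x₁, add_mem (Submodule.smul_mem _ _ ?_) ?_, ?_⟩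
    · exact Submodule.span_subset_span _ R s hx
    · exact Submodule.smul_mem _ _ hx₁
    · change (a : R) • _ = a₀ • x₀ + _
      rw [ha]
      module

theorem smul_mem_span_adjoin_image {X : Set R} (g : R) {s : Set M} {q : M}
    (hq : q ∈ Submodule.span (Algebra.adjoin k X) s) :
    g • q ∈ Submodule.span (Algebra.adjoin k X) ((g • ·) '' s) := by
  have hmap := Submodule.mem_map_of_mem
    (f := (LinearMap.lsmul R M g).restrictScalars (Algebra.adjoin k X)) hq
  rwa [Submodule.map_span] at hmap

theorem mem_span_of_mem_span_adjoin_empty [Module k M] [IsScalarTower k R M] {s : Set M} {q : M}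
    (hq : q ∈ Submodule.span (Algebra.adjoin k (∅ : Set R)) s) : q ∈ Submodule.span k s := by
  induction hq using Submodule.span_induction with
  | mem m hm => exact Submodule.subset_span hm
  | zero => exact zero_mem _
  | add x y _ _ hx hy => exact add_mem hx hy
  | smul a x _ hx =>
    obtain ⟨b, hb⟩ := Algebra.mem_bot.1 ((Algebra.adjoin_empty k R).le a.2)
    change (a : R) • x ∈ _
    rw [← hb, algebraMap_smul]
    exact Submodule.smul_mem _ _ hx

/-- The quotient `P / N` of submodules `N ≤ P` is finitely generated over the subalgebra `k[X]`;
the generators are chosen in `P`. -/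
def IsFiniteQuotientOver (k : Type*) [Field k] [Algebra k R] (X : Set R) (N P : Submodule R M) :
    Prop :=
  ∃ s : Finset M, (s : Set M) ⊆ P ∧
    ∀ p ∈ P, ∃ q ∈ Submodule.span (Algebra.adjoin k X) (s : Set M), p - q ∈ N

end AdjoinSpan

section PowerChain

variable {k R M : Type*} [Field k] [CommRing R] [Algebra k R] [AddCommGroup M] [Module R M]

/-- The descending chain of submodules `N + f ^ i P`. -/
def powerChain (f : R) (N P : Submodule R M) (i : ℕ) : Submodule R M :=
  N ⊔ P.map (LinearMap.lsmul R M (f ^ i))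

/-- The kernel of the surjection `P → (N + f ^ i P) / (N + f ^ (i + 1) P)` induced by `f ^ i`. -/
def powerKernel (f : R) (N P : Submodule R M) (i : ℕ) : Submodule R M :=
  P ⊓ (powerChain f N P (i + 1)).comap (LinearMap.lsmul R M (f ^ i))

variable {f : R} {N P : Submodule R M}

theorem mem_powerChain {i : ℕ} {m : M} :
    m ∈ powerChain f N P i ↔ ∃ a ∈ N, ∃ p ∈ P, a + f ^ i • p = m := by
  simp [powerChain, Submodule.mem_sup]

theorem add_smul_mem_powerChain {i : ℕ} {a p : M} (ha : a ∈ N) (hp : p ∈ P) :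
    a + f ^ i • p ∈ powerChain f N P i :=
  mem_powerChain.2 ⟨a, ha, p, hp, rfl⟩

theorem powerChain_zero (hNP : N ≤ P) : powerChain f N P 0 = P := by
  have : LinearMap.lsmul R M (f ^ 0) = LinearMap.id := by ext; simp
  rw [powerChain, this, Submodule.map_id, sup_eq_right.2 hNP]

theorem powerChain_succ_le (i : ℕ) : powerChain f N P (i + 1) ≤ powerChain f N P i := by
  intro m hm
  obtain ⟨a, ha, p, hp, rfl⟩ := mem_powerChain.1 hm
  rw [pow_succ, mul_smul]
  exact add_smul_mem_powerChain ha (P.smul_mem f hp)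

theorem powerChain_succ_sup (i : ℕ) : powerChain f N P (i + 1) ⊔
    P.map (LinearMap.lsmul R M (f ^ i)) = powerChain f N P i :=
  le_antisymm (sup_le (powerChain_succ_le i) le_sup_right) (sup_le_sup_right le_sup_left _)

theorem smul_mem_powerChain_succ {i : ℕ} {m : M} (hm : m ∈ powerChain f N P i) :
    f • m ∈ powerChain f N P (i + 1) := by
  obtain ⟨a, ha, p, hp, rfl⟩ := mem_powerChain.1 hm
  rw [smul_add, smul_smul, ← pow_succ']
  exact add_smul_mem_powerChain (N.smul_mem f ha) hp

theorem powerKernel_mono (f : R) (N P : Submodule R M) : Monotone (powerKernel f N P) := by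
  refine monotone_nat_of_le_succ fun i m ⟨hmP, hm⟩ => ⟨hmP, ?_⟩
  have := smul_mem_powerChain_succ hm
  rwa [LinearMap.lsmul_apply, smul_smul, ← pow_succ'] at this

theorem IsFiniteQuotientOver.powerChain {X : Set R}
    (h : IsFiniteQuotientOver k (insert f X) N P) (i : ℕ) :
    IsFiniteQuotientOver k X (powerChain f N P (i + 1)) (powerChain f N P i) := by
  classical
  obtain ⟨s, hsP, hs⟩ := h
  refine ⟨s.image (f ^ i • ·), ?_, fun m hm => ?_⟩
  · rw [Finset.coe_image]
    rintro _ ⟨p, hp, rfl⟩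
    exact Submodule.mem_sup_right ⟨p, hsP hp, rfl⟩
  · obtain ⟨a, ha, p, hp, rfl⟩ := mem_powerChain.1 hm
    obtain ⟨q, hq, hpq⟩ := hs p hp
    obtain ⟨q₀, hq₀, q₁, hq₁, rfl⟩ := exists_add_smul_of_mem_span_adjoin_insert hq
    refine ⟨f ^ i • q₀, ?_, ?_⟩
    · rw [Finset.coe_image]
      exact smul_mem_span_adjoin_image _ hq₀
    · have hsplit : a + f ^ i • p - f ^ i • q₀ =
          a + f ^ i • (p - (q₀ + f • q₁)) + f ^ (i + 1) • q₁ := by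
        rw [pow_succ]
        module
      rw [hsplit]
      exact add_smul_mem_powerChain (N.add_mem ha (N.smul_mem _ hpq)) (Submodule.span_le.2 hsP hq₁)

variable [Module k M] [IsScalarTower k R M] {𝒜 : ℝ → Submodule k R} {ℳ : ℝ → Submodule k M}

/-- The Hilbert function `x ↦ dim N_{≤ x}` of a graded submodule. -/
noncomputable def moduleHilbertFun (ℳ : ℝ → Submodule k M) (N : Submodule R M) (x : ℝ) : ℝ :=
  hilbertFun ℳ (N.restrictScalars k) x

variable [SetLike.GradedSMul 𝒜 ℳ] {w : ℝ}

theorem lsmul_mem_shift (hf : f ∈ 𝒜 w) (t : ℝ) (m : M) (hm : m ∈ ℳ t) :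
    (LinearMap.lsmul R M f).restrictScalars k m ∈ ℳ (t + w) := by
  have := SetLike.GradedSMul.smul_mem hf hm
  rwa [vadd_eq_add, add_comm] at this

variable [SetLike.GradedMonoid 𝒜]

theorem lsmul_pow_mem_shift (hf : f ∈ 𝒜 w) (i : ℕ) (t : ℝ) (m : M) (hm : m ∈ ℳ t) :
    (LinearMap.lsmul R M (f ^ i)).restrictScalars k m ∈ ℳ (t + i * w) := by
  have hfi := SetLike.pow_mem_graded i hf
  rw [nsmul_eq_mul] at hfi
  exact lsmul_mem_shift hfi t m hm

variable [DirectSum.Decomposition ℳ]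

theorem isHomogeneous_powerChain (hf : f ∈ 𝒜 w) (hN : N.IsHomogeneous ℳ)
    (hP : P.IsHomogeneous ℳ) (i : ℕ) : (powerChain f N P i).IsHomogeneous ℳ :=
  isHomogeneous_sup hN
    (isHomogeneous_map_shift (lsmul_pow_mem_shift hf i) (U := P.restrictScalars k) hP)

theorem moduleHilbertFun_powerChain_sub (hfin : ∀ x, FiniteDimensional k (gradedLE ℳ x))
    (hf : f ∈ 𝒜 w) (hN : N.IsHomogeneous ℳ) (hP : P.IsHomogeneous ℳ) (i : ℕ) (x : ℝ) :
    moduleHilbertFun ℳ (powerChain f N P i) x - moduleHilbertFun ℳ (powerChain f N P (i + 1)) x =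
      moduleHilbertFun ℳ P (x - i * w) - moduleHilbertFun ℳ (powerKernel f N P i) (x - i * w) := by
  rw [← powerChain_succ_sup i, moduleHilbertFun, Submodule.restrictScalars_sup]
  exact hilbertFun_sup_map_shift (lsmul_pow_mem_shift hf i) hfin hfin
    (U := P.restrictScalars k) hP (C := (powerChain f N P (i + 1)).restrictScalars k)
    (isHomogeneous_powerChain hf hN hP (i + 1)) x

theorem moduleHilbertFun_powerChain_eq (hfin : ∀ x, FiniteDimensional k (gradedLE ℳ x)) {c : ℝ}
    (hc : ∀ t < c, ℳ t = ⊥) (hf : f ∈ 𝒜 w) (hN : N.IsHomogeneous ℳ) (hP : P.IsHomogeneous ℳ)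
    {i : ℕ} {x : ℝ} (hx : x - i * w < c) :
    moduleHilbertFun ℳ (powerChain f N P i) x = moduleHilbertFun ℳ N x := by
  have h := hilbertFun_sup_map_shift (lsmul_pow_mem_shift (ℳ := ℳ) hf i) hfin hfin
    (U := P.restrictScalars k) hP (C := N.restrictScalars k) hN x
  rw [hilbertFun_eq_zero hc _ hx, hilbertFun_eq_zero hc _ hx, sub_zero, sub_eq_zero] at h
  rw [moduleHilbertFun, powerChain, Submodule.restrictScalars_sup]
  exact h

/-- Once the kernels are stable, the layers of the chain are shifts of a single one. -/
theorem moduleHilbertFun_powerChain_add_sub (hfin : ∀ x, FiniteDimensional k (gradedLE ℳ x))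
    (hf : f ∈ 𝒜 w) (hN : N.IsHomogeneous ℳ) (hP : P.IsHomogeneous ℳ) {J : ℕ}
    (hJ : ∀ j ≥ J, powerKernel f N P J = powerKernel f N P j) (j : ℕ) (x : ℝ) :
    moduleHilbertFun ℳ (powerChain f N P (J + j)) x -
        moduleHilbertFun ℳ (powerChain f N P (J + j + 1)) x =
      moduleHilbertFun ℳ (powerChain f N P J) (x - j * w) -
        moduleHilbertFun ℳ (powerChain f N P (J + 1)) (x - j * w) := by
  rw [moduleHilbertFun_powerChain_sub hfin hf hN hP, moduleHilbertFun_powerChain_sub hfin hf hN hP,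
    ← hJ _ (Nat.le_add_right J j)]
  push_cast
  ring_nf

end PowerChain

section HilbertFunctionDecomposition

variable {k R M : Type*} [Field k] [CommRing R] [Algebra k R] [AddCommGroup M] [Module R M]
  [Module k M] [IsScalarTower k R M] {𝒜 : ℝ → Submodule k R} [SetLike.GradedMonoid 𝒜]
  {ℳ : ℝ → Submodule k M} [DirectSum.Decomposition ℳ] [SetLike.GradedSMul 𝒜 ℳ]
  {N P : Submodule R M}

omit [SetLike.GradedSMul 𝒜 ℳ] [SetLike.GradedMonoid 𝒜] in
theorem moduleHilbertFun_sub_mem_weightCone_of_finite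
    (hfin : ∀ x, FiniteDimensional k (gradedLE ℳ x)) (W : List ℝ) (hNP : N ≤ P)
    (hN : N.IsHomogeneous ℳ) (hP : P.IsHomogeneous ℳ) (h : IsFiniteQuotientOver k ∅ N P) :
    moduleHilbertFun ℳ P - moduleHilbertFun ℳ N ∈ weightCone W := by
  classical
  obtain ⟨s, hsP, hs⟩ := h
  set u : Finset M := (homogeneousComponents ℳ s).image Prod.fst
  have hu_homogeneous : ∀ m ∈ u, ∃ t, m ∈ ℳ t := by
    intro m hm
    obtain ⟨p, hp, rfl⟩ := Finset.mem_image.1 hm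
    exact ⟨p.2, mem_of_mem_homogeneousComponents hp⟩
  have huP : (u : Set M) ⊆ P := by
    intro m hm
    obtain ⟨p, hp, rfl⟩ := Finset.mem_image.1 (Finset.mem_coe.1 hm)
    obtain ⟨m, hm, hmp, -⟩ := mem_homogeneousComponents.1 hp
    exact hmp ▸ hP p.2 (hsP hm)
  have hsu : Submodule.span k (s : Set M) ≤ Submodule.span k (u : Set M) :=
    Submodule.span_le.2 fun m hm => mem_of_forall_homogeneousComponents (ℳ := ℳ) (fun p hp =>
      Submodule.subset_span (Finset.mem_coe.2 (Finset.mem_image_of_mem _ hp))) hm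
  have hPu : P.restrictScalars k = N.restrictScalars k ⊔ Submodule.span k (u : Set M) := by
    refine le_antisymm (fun p hp => ?_) (sup_le hNP (Submodule.span_le.2 huP))
    obtain ⟨q, hq, hpq⟩ := hs p hp
    exact Submodule.mem_sup.2
      ⟨p - q, hpq, q, hsu (mem_span_of_mem_span_adjoin_empty hq), sub_add_cancel p q⟩
  have := hilbertFun_sup_span_sub_mem_weightCone hfin (U := N.restrictScalars k) hN W u
    hu_homogeneous
  rwa [← hPu] at this

theorem exists_moduleHilbertFun_powerChain_sub_mem_weightCone [IsNoetherian R M] {f : R} {w : ℝ}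
    {W : List ℝ} (hfin : ∀ x, FiniteDimensional k (gradedLE ℳ x)) {c : ℝ}
    (hc : ∀ t < c, ℳ t = ⊥) (hf : f ∈ 𝒜 w) (hw : 0 < w) (hW : ∀ v ∈ W, 0 < v)
    (hN : N.IsHomogeneous ℳ) (hP : P.IsHomogeneous ℳ)
    (hlayer : ∀ i, moduleHilbertFun ℳ (powerChain f N P i) -
      moduleHilbertFun ℳ (powerChain f N P (i + 1)) ∈ weightCone W) :
    ∃ J, moduleHilbertFun ℳ (powerChain f N P J) - moduleHilbertFun ℳ N ∈ weightCone (w :: W) := by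
  obtain ⟨J, hJ⟩ := monotone_stabilizes_iff_noetherian.2 ‹IsNoetherian R M›
    ⟨powerKernel f N P, powerKernel_mono f N P⟩
  obtain ⟨g, hg, hg_eq⟩ := exists_mem_weightCone_cons_eq_sum_range (hlayer J) hW hw
  suffices moduleHilbertFun ℳ (powerChain f N P J) - moduleHilbertFun ℳ N = g from ⟨J, this ▸ hg⟩
  funext x
  have hlarge : ∀ᶠ n : ℕ in atTop, x - ((J + n : ℕ) : ℝ) * w < c := by
    have hlim : Tendsto (fun n : ℕ => ((J + n : ℕ) : ℝ) * w) atTop atTop :=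
      (tendsto_natCast_atTop_atTop.comp
        (tendsto_atTop_mono (Nat.le_add_left · J) tendsto_id)).atTop_mul_const hw
    filter_upwards [hlim.eventually_gt_atTop (x - c)] with n hn using by linarith
  obtain ⟨n, hn, hgx⟩ := (hlarge.and (hg_eq x)).exists
  rw [hgx, Pi.sub_apply, ← moduleHilbertFun_powerChain_eq hfin hc hf hN hP hn]
  refine (Finset.sum_range_sub' (fun j => moduleHilbertFun ℳ (powerChain f N P (J + j)) x) n).symm
    |>.trans (Finset.sum_congr rfl fun j _ => ?_)
  exact moduleHilbertFun_powerChain_add_sub hfin hf hN hP hJ j x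

theorem moduleHilbertFun_sub_mem_weightCone [IsNoetherian R M]
    (hfin : ∀ x, FiniteDimensional k (gradedLE ℳ x)) {c : ℝ} (hc : ∀ t < c, ℳ t = ⊥)
    {gens : List (R × ℝ)} (hgens : ∀ p ∈ gens, p.1 ∈ 𝒜 p.2 ∧ 0 < p.2) (hNP : N ≤ P)
    (hN : N.IsHomogeneous ℳ) (hP : P.IsHomogeneous ℳ)
    (h : IsFiniteQuotientOver k {f | f ∈ gens.map Prod.fst} N P) :
    moduleHilbertFun ℳ P - moduleHilbertFun ℳ N ∈ weightCone (gens.map Prod.snd) := by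
  induction gens generalizing N P with
  | nil =>
    refine moduleHilbertFun_sub_mem_weightCone_of_finite hfin _ hNP hN hP ?_
    simpa using h
  | cons p gens ih =>
    obtain ⟨f, w⟩ := p
    obtain ⟨⟨hf, hw⟩, hgens⟩ := List.forall_mem_cons.1 hgens
    have hset : {g | g ∈ ((f, w) :: gens).map Prod.fst} =
        insert f {g | g ∈ gens.map Prod.fst} := by
      ext g
      simp
    rw [hset] at h
    have hlayer : ∀ i, moduleHilbertFun ℳ (powerChain f N P i) -
        moduleHilbertFun ℳ (powerChain f N P (i + 1)) ∈ weightCone (gens.map Prod.snd) := fun i =>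
      ih hgens (powerChain_succ_le i) (isHomogeneous_powerChain hf hN hP (i + 1))
        (isHomogeneous_powerChain hf hN hP i) (h.powerChain i)
    have hpos : ∀ v ∈ gens.map Prod.snd, 0 < v := List.forall_mem_map.2 fun p hp => (hgens p hp).2
    obtain ⟨J, hJ⟩ :=
      exists_moduleHilbertFun_powerChain_sub_mem_weightCone hfin hc hf hw hpos hN hP hlayer
    have htop : moduleHilbertFun ℳ P - moduleHilbertFun ℳ (powerChain f N P J) ∈
        weightCone (gens.map Prod.snd) := by
      have htel := Finset.sum_range_sub' (fun i => moduleHilbertFun ℳ (powerChain f N P i)) J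
      rw [powerChain_zero hNP] at htel
      rw [← htel]
      exact sum_mem fun i _ => hlayer i
    rw [← sub_add_sub_cancel]
    exact add_mem (weightCone_mono (List.sublist_cons_self w _) htop) hJ

end HilbertFunctionDecomposition

section NoetherNormalization

theorem ringKrullDim_eq_of_isIntegral (A B : Type*) [CommRing A] [CommRing B] [Algebra A B]
    [Algebra.IsIntegral A B] [FaithfulSMul A B] : ringKrullDim B = ringKrullDim A := by
  refine le_antisymm (Order.krullDim_le_of_strictMono
    (fun P : PrimeSpectrum B => PrimeSpectrum.comap (algebraMap A B) P) fun P Q hPQ =>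
      Ideal.IsIntegral.comap_lt_comap (R := A) hPQ) (iSup_le fun l => ?_)
  obtain ⟨Q, -, hQ, hQl⟩ := Ideal.exists_ideal_over_prime_of_isIntegral (S := B)
    (RelSeries.head l).asIdeal ⊥ (by
      rw [← RingHom.ker, (RingHom.injective_iff_ker_eq_bot _).1
        (FaithfulSMul.algebraMap_injective A B)]
      exact bot_le)
  have : Q.LiesOver (RelSeries.head l).asIdeal := ⟨hQl.symm⟩
  obtain ⟨l', hl', -, -⟩ := Ideal.exists_ltSeries_of_hasGoingUp l Q
  exact hl' ▸ Order.LTSeries.length_le_krullDim l'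

theorem exists_algebraicIndependent_finite_adjoin {k R : Type*} [Field k] [CommRing R]
    [IsDomain R] [Algebra k R] [Algebra.FiniteType k R] {n : ℕ} (hn : ringKrullDim R = n) :
    ∃ y : Fin n → R, AlgebraicIndependent k y ∧
      Module.Finite (Algebra.adjoin k (Set.range y)) R := by
  obtain ⟨s, φ, hinj, hfin⟩ := exists_finite_inj_algHom_of_fg k R
  have hφ : φ = MvPolynomial.aeval fun i => φ (MvPolynomial.X i) :=
    MvPolynomial.aeval_unique φ
  let := φ.toRingHom.toAlgebra
  have : Module.Finite (MvPolynomial (Fin s) k) R := hfin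
  have : FaithfulSMul (MvPolynomial (Fin s) k) R :=
    (faithfulSMul_iff_algebraMap_injective _ _).2 hinj
  have hdim := ringKrullDim_eq_of_isIntegral (MvPolynomial (Fin s) k) R
  rw [MvPolynomial.ringKrullDim_of_isNoetherianRing, ringKrullDim_eq_zero_of_field, hn,
    Nat.card_fin, zero_add] at hdim
  obtain rfl : n = s := by exact_mod_cast hdim
  refine ⟨fun i => φ (MvPolynomial.X i), ?_, ?_⟩
  · rw [AlgebraicIndependent, ← hφ]
    exact hinj
  · rw [Algebra.adjoin_range_eq_range_aeval, ← hφ]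
    let := φ.rangeRestrict.toRingHom.toAlgebra
    have : IsScalarTower (MvPolynomial (Fin n) k) φ.range R := .of_algebraMap_eq fun _ => rfl
    exact Module.Finite.of_restrictScalars_finite (MvPolynomial (Fin n) k) φ.range R

end NoetherNormalization

section BoxSpan

variable {k R M : Type*} [Field k] [CommRing R] [Algebra k R]
  [AddCommGroup M] [Module R M] [Module k M] [IsScalarTower k R M]

open scoped Pointwise in
theorem span_eq_top_of_forall_smul_mem {A : Set R} (hA : Algebra.adjoin k A = ⊤) {S X : Set M}
    (hS : Submodule.span R S = ⊤) (hSX : S ⊆ X) (hX : ∀ f ∈ A, ∀ m ∈ X, f • m ∈ X) :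
    Submodule.span k X = ⊤ := by
  have hclosure : (Submonoid.closure A : Set R) • S ⊆ X := by
    rintro _ ⟨f, hf, m, hm, rfl⟩
    refine Submonoid.closure_induction_left (motive := fun f _ => f • m ∈ X) ?_ ?_ hf
    · simpa using hSX hm
    · intro f hf g _ hg
      rw [mul_smul]
      exact hX f hf _ hg
  have hspan : Submodule.span k (Submonoid.closure A : Set R) = ⊤ := by
    rw [← Algebra.adjoin_eq_span, hA, Algebra.top_toSubmodule]
  rw [eq_top_iff, ← Submodule.restrictScalars_top k R M, ← hS,
    ← Submodule.span_smul_of_span_eq_top hspan]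
  exact Submodule.span_mono hclosure

variable {n : ℕ}

/-- The span of the elements `y ^ a • g` with `g ∈ G` and all exponents at most `j`. Its dimension
grows like `j ^ n`, so a filtration of `M` by such spans bounds the growth of `M`. -/
def boxSpan (k : Type*) [Field k] [Module k M] (y : Fin n → R) (G : Finset M) (j : ℕ) :
    Submodule k M :=
  Submodule.span k (Set.image2 (fun a g => (∏ i, y i ^ a i) • g) (Set.Iic fun _ => j) G)

section

omit [Algebra k R] [IsScalarTower k R M]

variable (y : Fin n → R) (G : Finset M)

theorem boxSpan_le_iff {j : ℕ} {U : Submodule k M} : boxSpan k y G j ≤ U ↔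
    ∀ a : Fin n → ℕ, (∀ i, a i ≤ j) → ∀ g ∈ G, (∏ i, y i ^ a i) • g ∈ U :=
  Submodule.span_le.trans Set.image2_subset_iff

theorem finrank_boxSpan_le (j : ℕ) : Module.finrank k (boxSpan k y G j) ≤ (j + 1) ^ n * G.card := by
  classical
  rw [boxSpan, ← Finset.coe_Iic, ← Finset.coe_image₂]
  refine (finrank_span_finset_le_card _).trans ((Finset.card_image₂_le _ _ _).trans_eq ?_)
  simp [Pi.card_Iic]

theorem finiteDimensional_boxSpan (j : ℕ) : FiniteDimensional k (boxSpan k y G j) :=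
  FiniteDimensional.span_of_finite k ((Set.finite_Iic _).image2 _ G.finite_toSet)

variable {G}

theorem prod_pow_smul_mem_boxSpan {j : ℕ} {a : Fin n → ℕ} (ha : ∀ i, a i ≤ j) {g : M}
    (hg : g ∈ G) : (∏ i, y i ^ a i) • g ∈ boxSpan k y G j :=
  (boxSpan_le_iff y G).1 le_rfl a ha g hg

variable (G)

theorem boxSpan_mono : Monotone (boxSpan k y G) := fun _ _ hij =>
  (boxSpan_le_iff y G).2 fun _ ha _ hg => prod_pow_smul_mem_boxSpan y (fun t => (ha t).trans hij) hg

theorem mem_iSup_boxSpan_iff {m : M} : m ∈ ⨆ j, boxSpan k y G j ↔ ∃ j, m ∈ boxSpan k y G j :=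
  Submodule.mem_iSup_of_directed _ (boxSpan_mono y G).directed_le

end

variable (y : Fin n → R) {G : Finset M}

theorem smul_mem_boxSpan {e j : ℕ} {f : R} (hf : ∀ g ∈ G, f • g ∈ boxSpan k y G e) {m : M}
    (hm : m ∈ boxSpan k y G j) : f • m ∈ boxSpan k y G (j + e) := by
  have hmonomial : ∀ a : Fin n → ℕ, (∀ i, a i ≤ j) → boxSpan k y G e ≤
      (boxSpan k y G (j + e)).comap (Algebra.lsmul k k M (∏ i, y i ^ a i)) := by
    refine fun a ha => (boxSpan_le_iff y G).2 fun b hb g hg => ?_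
    have := prod_pow_smul_mem_boxSpan (k := k) y (fun i => add_le_add (ha i) (hb i)) hg
    simpa only [Submodule.mem_comap, Algebra.lsmul_coe, pow_add, Finset.prod_mul_distrib,
      mul_smul] using this
  have hle : boxSpan k y G j ≤ (boxSpan k y G (j + e)).comap (Algebra.lsmul k k M f) := by
    refine (boxSpan_le_iff y G).2 fun a ha g hg => ?_
    simp only [Submodule.mem_comap, Algebra.lsmul_coe]
    rw [smul_comm]
    exact hmonomial a ha (hf g hg)
  exact hle hm

theorem exists_iSup_boxSpan_eq_top [Module.Finite (Algebra.adjoin k (Set.range y)) M] :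
    ∃ G : Finset M, ⨆ j, boxSpan k y G j = ⊤ := by
  obtain ⟨G, hG⟩ := Module.Finite.fg_top (R := Algebra.adjoin k (Set.range y)) (M := M)
  refine ⟨G, ?_⟩
  rw [← Submodule.span_eq (⨆ j, boxSpan k y G j)]
  refine span_eq_top_of_forall_smul_mem (Algebra.adjoin_adjoin_coe_preimage (R := k)) hG ?_ ?_
  · intro g hg
    have := prod_pow_smul_mem_boxSpan (k := k) y (a := 0) (fun _ => le_rfl (a := 0)) hg
    exact (mem_iSup_boxSpan_iff y G).2 ⟨0, by simpa using this⟩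
  · rintro f ⟨i, hi⟩ m hm
    obtain ⟨j, hj⟩ := (mem_iSup_boxSpan_iff y G).1 hm
    refine (mem_iSup_boxSpan_iff y G).2 ⟨j + 1, smul_mem_boxSpan y (fun g hg => ?_) hj⟩
    have := prod_pow_smul_mem_boxSpan (k := k) y (a := Pi.single i 1) (j := 1)
      (fun t => by by_cases h : t = i <;> simp [h]) hg
    simpa [Pi.single_apply, hi] using this

end BoxSpan

section Growth

variable {k R M : Type*} [Field k] [CommRing R] [Algebra k R]
  [AddCommGroup M] [Module R M] [Module k M] [IsScalarTower k R M]

theorem exists_homogeneous_algebra_generators (𝒜 : ℝ → Submodule k R) [GradedAlgebra 𝒜]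
    [Algebra.FiniteType k R] (hneg : ∀ t < 0, 𝒜 t = ⊥) (hzero : 𝒜 0 = 1) :
    ∃ gens : List (R × ℝ), (∀ p ∈ gens, p.1 ∈ 𝒜 p.2 ∧ 0 < p.2) ∧
      Algebra.adjoin k {f | f ∈ gens.map Prod.fst} = ⊤ := by
  classical
  obtain ⟨F, hF⟩ := Algebra.FiniteType.out (R := k) (A := R)
  have hmem : ∀ p, p ∈ ((homogeneousComponents 𝒜 F).filter (0 < ·.2)).toList ↔
      p ∈ homogeneousComponents 𝒜 F ∧ 0 < p.2 := fun p => by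
    rw [Finset.mem_toList, Finset.mem_filter]
  refine ⟨((homogeneousComponents 𝒜 F).filter (0 < ·.2)).toList, fun p hp => ?_, ?_⟩
  · exact ⟨mem_of_mem_homogeneousComponents ((hmem p).1 hp).1, ((hmem p).1 hp).2⟩
  · rw [← top_le_iff, ← hF, Algebra.adjoin_le_iff]
    refine fun r hr => mem_of_forall_homogeneousComponents (ℳ := 𝒜) (fun p hp => ?_) hr
    have hpdeg := mem_of_mem_homogeneousComponents hp
    rcases lt_trichotomy p.2 0 with hdeg | hdeg | hdeg
    · rw [hneg p.2 hdeg, Submodule.mem_bot] at hpdeg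
      exact hpdeg ▸ zero_mem _
    · rw [hdeg, hzero] at hpdeg
      obtain ⟨c, hc⟩ := Submodule.mem_one.1 hpdeg
      exact hc ▸ Subalgebra.algebraMap_mem _ _
    · exact Algebra.subset_adjoin (List.mem_map_of_mem ((hmem p).2 ⟨hp, hdeg⟩))

omit [Algebra k R] [IsScalarTower k R M] in
theorem exists_homogeneous_module_generators (ℳ : ℝ → Submodule k M) [DirectSum.Decomposition ℳ]
    [Module.Finite R M] : ∃ S : Finset (M × ℝ), (∀ p ∈ S, p.1 ∈ ℳ p.2) ∧
      Submodule.span R (Prod.fst '' (S : Set (M × ℝ))) = ⊤ := by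
  obtain ⟨F, hF⟩ := Module.Finite.fg_top (R := R) (M := M)
  refine ⟨homogeneousComponents ℳ F, fun p => mem_of_mem_homogeneousComponents, ?_⟩
  rw [← top_le_iff, ← hF, Submodule.span_le]
  exact fun m hm => mem_of_forall_homogeneousComponents (ℳ := ℳ)
    (fun p hp => Submodule.subset_span (Set.mem_image_of_mem _ hp)) hm

variable {𝒜 : ℝ → Submodule k R} {ℳ : ℝ → Submodule k M} [DirectSum.Decomposition ℳ]
  [SetLike.GradedSMul 𝒜 ℳ] {gens : List (R × ℝ)}

theorem gradedLE_le_of_generators {W : ℝ → Submodule k M} (hW : Monotone W)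
    (hgens : ∀ p ∈ gens, p.1 ∈ 𝒜 p.2) (htop : Algebra.adjoin k {f | f ∈ gens.map Prod.fst} = ⊤)
    {S : Finset (M × ℝ)} (hS : ∀ p ∈ S, p.1 ∈ ℳ p.2)
    (hStop : Submodule.span R (Prod.fst '' (S : Set (M × ℝ))) = ⊤) (hSW : ∀ p ∈ S, p.1 ∈ W p.2)
    (hsmul : ∀ p ∈ gens, ∀ t, ∀ m ∈ ℳ t, m ∈ W t → p.1 • m ∈ W (t + p.2)) (x : ℝ) :
    gradedLE ℳ x ≤ W x := by
  have hspan : Submodule.span k {m | ∃ t, m ∈ ℳ t ∧ m ∈ W t} = ⊤ := by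
    refine span_eq_top_of_forall_smul_mem htop hStop ?_ ?_
    · rintro _ ⟨p, hp, rfl⟩
      exact ⟨p.2, hS p hp, hSW p hp⟩
    · rintro f hf m ⟨t, hmt, hmW⟩
      obtain ⟨p, hp, rfl⟩ := List.mem_map.1 hf
      exact ⟨t + p.2, lsmul_mem_shift (hgens p hp) t m hmt, hsmul p hp t m hmt hmW⟩
  have hmap := map_truncation (isHomogeneous_top (ℳ := ℳ) (S := k)) x
  rw [top_inf_eq] at hmap
  rw [← hmap, ← hspan, Submodule.map_span, Submodule.span_le]
  rintro _ ⟨m, ⟨t, hmt, hmW⟩, rfl⟩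
  rw [truncation_of_mem hmt]
  split_ifs with ht
  · exact hW ht hmW
  · exact zero_mem _

theorem exists_forall_lt_eq_bot [Module.Finite R M] (hgens : ∀ p ∈ gens, p.1 ∈ 𝒜 p.2 ∧ 0 < p.2)
    (htop : Algebra.adjoin k {f | f ∈ gens.map Prod.fst} = ⊤) : ∃ c, ∀ t < c, ℳ t = ⊥ := by
  obtain ⟨S, hS, hStop⟩ := exists_homogeneous_module_generators (R := R) ℳ
  obtain ⟨c, hc⟩ : ∃ c : ℝ, ∀ p ∈ S, c ≤ p.2 :=
    ((eventually_all_finset S).2 fun p _ => eventually_le_atBot p.2).exists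
  let W : ℝ → Submodule k M := fun t => if c ≤ t then ⊤ else ⊥
  have hWtop : ∀ {t}, c ≤ t → W t = ⊤ := fun ht => if_pos ht
  have hWbot : ∀ {t}, t < c → W t = ⊥ := fun ht => if_neg ht.not_ge
  have hW : Monotone W := by
    intro s t hst
    rcases lt_or_ge s c with hs | hs
    · exact (hWbot hs).trans_le bot_le
    · exact le_top.trans_eq (hWtop (hs.trans hst)).symm
  refine ⟨c, fun t ht => le_bot_iff.1 ((le_gradedLE le_rfl).trans ?_)⟩
  rw [← hWbot ht]
  refine gradedLE_le_of_generators hW (fun p hp => (hgens p hp).1) htop hS hStop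
    (fun p hp => hWtop (hc p hp) ▸ Submodule.mem_top) (fun p hp s m _ hm => ?_) t
  rcases lt_or_ge s c with hs | hs
  · rw [hWbot hs, Submodule.mem_bot] at hm
    rw [hm, smul_zero]
    exact zero_mem _
  · rw [hWtop (by linarith [(hgens p hp).2])]
    exact Submodule.mem_top

theorem exists_gradedLE_le_boxSpan [Module.Finite R M]
    (hgens : ∀ p ∈ gens, p.1 ∈ 𝒜 p.2 ∧ 0 < p.2)
    (htop : Algebra.adjoin k {f | f ∈ gens.map Prod.fst} = ⊤) {c : ℝ} (hc : ∀ t < c, ℳ t = ⊥)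
    {n : ℕ} (y : Fin n → R) [Module.Finite (Algebra.adjoin k (Set.range y)) M] :
    ∃ (G : Finset M) (e : ℕ) (D : ℝ), ∀ x, gradedLE ℳ x ≤ boxSpan k y G (e + ⌊D * (x - c)⌋₊) := by
  obtain ⟨S, hS, hStop⟩ := exists_homogeneous_module_generators (R := R) ℳ
  obtain ⟨G, hG⟩ := exists_iSup_boxSpan_eq_top (k := k) (M := M) y
  have heventually : ∀ m, ∀ᶠ j in atTop, m ∈ boxSpan k y G j := fun m => by
    obtain ⟨j, hj⟩ := (mem_iSup_boxSpan_iff y G).1 (hG ▸ Submodule.mem_top : m ∈ _)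
    filter_upwards [eventually_ge_atTop j] with i hi using boxSpan_mono y G hi hj
  obtain ⟨e, he⟩ : ∃ e, ∀ p ∈ S, p.1 ∈ boxSpan k y G e :=
    ((eventually_all_finset S).2 fun p _ => heventually p.1).exists
  obtain ⟨d, hd⟩ : ∃ d, ∀ p ∈ {p | p ∈ gens}, ∀ g ∈ G, p.1 • g ∈ boxSpan k y G d :=
    ((List.finite_toSet gens).eventually_all.2 fun p _ =>
      (eventually_all_finset G).2 fun g _ => heventually (p.1 • g)).exists
  obtain ⟨D, hD0, hD⟩ : ∃ D : ℝ, 0 ≤ D ∧ ∀ p ∈ {p | p ∈ gens}, d ≤ D * p.2 :=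
    ((eventually_ge_atTop 0).and ((List.finite_toSet gens).eventually_all.2 fun p hp =>
      (tendsto_id.atTop_mul_const (hgens p hp).2).eventually_ge_atTop _)).exists
  have hmono : Monotone fun x => boxSpan k y G (e + ⌊D * (x - c)⌋₊) :=
    fun s t hst => boxSpan_mono y G (by gcongr)
  refine ⟨G, e, D, gradedLE_le_of_generators hmono (fun p hp => (hgens p hp).1) htop hS hStop
    (fun p hp => boxSpan_mono y G (Nat.le_add_right _ _) (he p hp)) fun p hp t m hmt hm => ?_⟩
  rcases lt_or_ge t c with ht | ht
  · rw [hc t ht, Submodule.mem_bot] at hmt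
    rw [hmt, smul_zero]
    exact zero_mem _
  · refine boxSpan_mono y G ?_ (smul_mem_boxSpan y (hd p hp) hm)
    rw [add_assoc, ← Nat.floor_add_natCast (mul_nonneg hD0 (sub_nonneg.2 ht))]
    gcongr
    linarith [hD p hp]

theorem finiteDimensional_gradedLE [Module.Finite R M]
    (hgens : ∀ p ∈ gens, p.1 ∈ 𝒜 p.2 ∧ 0 < p.2)
    (htop : Algebra.adjoin k {f | f ∈ gens.map Prod.fst} = ⊤) {n : ℕ} (y : Fin n → R)
    [Module.Finite (Algebra.adjoin k (Set.range y)) M] (x : ℝ) :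
    FiniteDimensional k (gradedLE ℳ x) := by
  obtain ⟨c, hc⟩ := exists_forall_lt_eq_bot (ℳ := ℳ) hgens htop
  obtain ⟨G, e, D, hle⟩ := exists_gradedLE_le_boxSpan (ℳ := ℳ) hgens htop hc y
  have := finiteDimensional_boxSpan (k := k) y G
  exact Submodule.finiteDimensional_of_le (hle x)

theorem isBigO_hilbertFun_top [Module.Finite R M] (hgens : ∀ p ∈ gens, p.1 ∈ 𝒜 p.2 ∧ 0 < p.2)
    (htop : Algebra.adjoin k {f | f ∈ gens.map Prod.fst} = ⊤) {n : ℕ} (y : Fin n → R)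
    [Module.Finite (Algebra.adjoin k (Set.range y)) M] :
    hilbertFun ℳ ⊤ =O[atTop] fun x : ℝ => x ^ n := by
  obtain ⟨c, hc⟩ := exists_forall_lt_eq_bot (ℳ := ℳ) hgens htop
  obtain ⟨G, e, D, hle⟩ := exists_gradedLE_le_boxSpan (ℳ := ℳ) hgens htop hc y
  have hlinear : (fun x : ℝ => |D * (x - c)| + (e + 1)) =O[atTop] fun x : ℝ => x := by
    have hconst (b : ℝ) : (fun _ : ℝ => b) =O[atTop] fun x : ℝ => x :=
      (isLittleO_const_id_atTop b).isBigO
    exact (((isBigO_refl _ _).sub (hconst c)).const_mul_left D).abs_left.add (hconst _)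
  refine IsBigO.trans (.of_norm_le fun x => ?_)
    ((hlinear.pow n).const_mul_left (G.card : ℝ))
  rw [Real.norm_of_nonneg (hilbertFun_nonneg _ _), hilbertFun, top_inf_eq]
  have := finiteDimensional_boxSpan (k := k) y G
  have hfloor : ((e + ⌊D * (x - c)⌋₊ + 1 : ℕ) : ℝ) ≤ |D * (x - c)| + (e + 1) := by
    have := (Nat.cast_le.2 (Nat.floor_mono (le_abs_self (D * (x - c))))).trans
      (Nat.floor_le (abs_nonneg (D * (x - c))))
    push_cast
    linarith
  calc (Module.finrank k (gradedLE ℳ x) : ℝ)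
      ≤ ((e + ⌊D * (x - c)⌋₊ + 1) ^ n * G.card : ℕ) :=
        Nat.cast_le.2 ((Submodule.finrank_mono (hle x)).trans (finrank_boxSpan_le y G _))
    _ = G.card * ((e + ⌊D * (x - c)⌋₊ + 1 : ℕ) : ℝ) ^ n := by push_cast; ring
    _ ≤ G.card * (|D * (x - c)| + (e + 1)) ^ n := by gcongr

theorem gradedMonoid_gradedLE (𝒜 : ℝ → Submodule k R) [SetLike.GradedMonoid 𝒜] :
    SetLike.GradedMonoid (gradedLE 𝒜) where
  one_mem := le_gradedLE le_rfl (SetLike.GradedOne.one_mem (A := 𝒜))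
  mul_mem := by
    intro x y a b ha hb
    have hleft : ∀ s : Set.Iic x, ∀ r ∈ 𝒜 s, gradedLE 𝒜 y ≤
        (gradedLE 𝒜 (x + y)).comap (LinearMap.mulLeft k r) := fun s r hr =>
      iSup_le fun t b hb => le_gradedLE (add_le_add s.2 t.2) (SetLike.mul_mem_graded hr hb)
    have hright : gradedLE 𝒜 x ≤ (gradedLE 𝒜 (x + y)).comap (LinearMap.mulRight k b) :=
      iSup_le fun s a ha => hleft s a ha hb
    exact hright ha

theorem pow_le_finrank_boxSpan_one {n : ℕ} {y : Fin n → R} (hy : AlgebraicIndependent k y)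
    (j : ℕ) : (j + 1) ^ n ≤ Module.finrank k (boxSpan k y ({1} : Finset R) j) := by
  have := finiteDimensional_boxSpan (k := k) y ({1} : Finset R) j
  let exponent : (Fin n → Fin (j + 1)) → Fin n →₀ ℕ := fun a =>
    Finsupp.equivFunOnFinite.symm fun i => (a i : ℕ)
  have hinj : Function.Injective exponent := fun a b hab => funext fun i => Fin.ext <| by
    simpa [exponent] using DFunLike.congr_fun hab i
  have hmonomial := ((MvPolynomial.basisMonomials (Fin n) k).linearIndependent.map'
    (MvPolynomial.aeval y).toLinearMap (LinearMap.ker_eq_bot.2 hy)).comp exponent hinj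
  let v : (Fin n → Fin (j + 1)) → boxSpan k y ({1} : Finset R) j := fun a =>
    ⟨(∏ i, y i ^ (a i : ℕ)) • 1, prod_pow_smul_mem_boxSpan y
      (fun i => Nat.lt_succ_iff.1 (a i).2) (Finset.mem_singleton_self 1)⟩
  have hv : LinearIndependent k v := by
    refine .of_comp (Submodule.subtype _) ?_
    rwa [show Submodule.subtype _ ∘ v = (⇑(MvPolynomial.aeval y).toLinearMap ∘
      ⇑(MvPolynomial.basisMonomials (Fin n) k)) ∘ exponent from funext fun a => by
        simp [v, exponent, MvPolynomial.aeval_monomial, Finsupp.prod_fintype]]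
  simpa using hv.fintype_card_le_finrank

theorem exists_pow_le_hilbertFun [GradedAlgebra 𝒜] {n : ℕ} {y : Fin n → R}
    (hy : AlgebraicIndependent k y) (hfin : ∀ x, FiniteDimensional k (gradedLE 𝒜 x)) :
    ∃ C : ℝ, 0 < C ∧ ∀ x, 0 ≤ x → (C * x) ^ n ≤ hilbertFun 𝒜 ⊤ x := by
  have hexhaust : ∀ r : R, ∀ᶠ d in atTop, r ∈ gradedLE 𝒜 d := fun r => by
    induction r using DirectSum.Decomposition.inductionOn 𝒜 with
    | zero => exact .of_forall fun d => zero_mem _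
    | @homogeneous t r =>
      filter_upwards [eventually_ge_atTop t] with d hd using le_gradedLE hd r.2
    | add a b ha hb => filter_upwards [ha, hb] with d using add_mem
  obtain ⟨d, hd, hyd⟩ : ∃ d : ℝ, 0 < d ∧ ∀ i, y i ∈ gradedLE 𝒜 d :=
    ((eventually_gt_atTop 0).and (eventually_all.2 fun i => hexhaust (y i))).exists
  have := gradedMonoid_gradedLE 𝒜
  have hbox : ∀ j : ℕ, boxSpan k y ({1} : Finset R) j ≤ gradedLE 𝒜 (j * ((n + 1) * d)) := by
    refine fun j => (boxSpan_le_iff y _).2 fun a ha g hg => ?_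
    rw [Finset.mem_singleton.1 hg, smul_eq_mul, mul_one]
    refine gradedLE_mono ?_ (SetLike.prod_pow_mem_graded (gradedLE 𝒜) (fun _ => d) y a
      (F := Finset.univ) fun i _ => hyd i)
    calc ∑ i, a i • d ≤ ∑ _i : Fin n, j * d := Finset.sum_le_sum fun i _ => by
          rw [nsmul_eq_mul]
          gcongr
          exact ha i
      _ = n * (j * d) := by simp
      _ ≤ j * ((n + 1) * d) := by nlinarith [mul_nonneg j.cast_nonneg hd.le]
  refine ⟨1 / ((n + 1) * d), by positivity, fun x hx => ?_⟩
  set j := ⌊x / ((n + 1) * d)⌋₊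
  have hjx : j * ((n + 1) * d) ≤ x :=
    (le_div_iff₀ (by positivity)).1 (Nat.floor_le (by positivity))
  have := hfin x
  rw [hilbertFun, top_inf_eq]
  calc (1 / ((n + 1) * d) * x) ^ n ≤ (j + 1) ^ n := by
        rw [one_div_mul_eq_div]
        gcongr
        exact (Nat.lt_floor_add_one _).le
    _ ≤ Module.finrank k (gradedLE 𝒜 x) := by
        exact_mod_cast (pow_le_finrank_boxSpan_one hy j).trans
          (Submodule.finrank_mono ((hbox j).trans (gradedLE_mono hjx)))

end Growth

section Coefficients

variable {k R M : Type*} [Field k] [CommRing R] [Algebra k R]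
  [AddCommGroup M] [Module R M] [Module k M] [IsScalarTower k R M]

/-- The finiteness and growth properties by which coefficients of graded submodules are defined and
compared: the Hilbert function of every graded subquotient `P / N` has coefficients `a_n` and, if
`a_n = 0`, `a_{n-1}` in the monoids generated by the densities of the weights `W`. -/
structure HasHilbertExpansion (R : Type*) [CommRing R] [Algebra k R] [Module R M]
    [IsScalarTower k R M] (W : List ℝ) (n : ℕ) (ℳ : ℝ → Submodule k M)
    [DirectSum.Decomposition ℳ] : Prop where
  weight_pos : ∀ v ∈ W, 0 < v
  one_le : 1 ≤ n
  noetherian : IsNoetherian R M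
  finiteDimensional : ∀ x, FiniteDimensional k (gradedLE ℳ x)
  expansion : ∀ {N P : Submodule R M}, N ≤ P → N.IsHomogeneous ℳ → P.IsHomogeneous ℳ →
    ∃ a b, HasRiemannRoch n (moduleHilbertFun ℳ P - moduleHilbertFun ℳ N) a b ∧
      a ∈ densityMonoid W n ∧ (a = 0 → b ∈ densityMonoid W (n - 1))

omit [Module k M] [IsScalarTower k R M] in
theorem isFiniteQuotientOver_of_adjoin_eq_top {X : Set R} (hX : Algebra.adjoin k X = ⊤)
    (N : Submodule R M) {P : Submodule R M} (hP : P.FG) : IsFiniteQuotientOver k X N P := by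
  obtain ⟨s, rfl⟩ := hP
  refine ⟨s, Submodule.subset_span, fun p hp => ⟨p, ?_, by simp⟩⟩
  have hsurj : Function.Surjective (algebraMap (Algebra.adjoin k X) R) :=
    fun r => ⟨⟨r, hX ▸ Algebra.mem_top⟩, rfl⟩
  rwa [← SetLike.mem_coe, ← Submodule.coe_span_eq_span_of_surjective _ R hsurj]

theorem hasHilbertExpansion [IsNoetherian R M] {𝒜 : ℝ → Submodule k R} [SetLike.GradedMonoid 𝒜]
    {ℳ : ℝ → Submodule k M} [DirectSum.Decomposition ℳ] [SetLike.GradedSMul 𝒜 ℳ]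
    {gens : List (R × ℝ)} (hgens : ∀ p ∈ gens, p.1 ∈ 𝒜 p.2 ∧ 0 < p.2)
    (htop : Algebra.adjoin k {f | f ∈ gens.map Prod.fst} = ⊤) {n : ℕ} (hn : 1 ≤ n)
    (y : Fin n → R) [Module.Finite (Algebra.adjoin k (Set.range y)) M] :
    HasHilbertExpansion R (gens.map Prod.snd) n ℳ := by
  obtain ⟨c, hc⟩ := exists_forall_lt_eq_bot (ℳ := ℳ) hgens htop
  have hW : ∀ v ∈ gens.map Prod.snd, 0 < v := List.forall_mem_map.2 fun p hp => (hgens p hp).2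
  have hfin := finiteDimensional_gradedLE (ℳ := ℳ) hgens htop y
  refine ⟨hW, hn, ‹_›, hfin, fun {N P} hNP hN hP => ?_⟩
  refine exists_hasRiemannRoch_of_mem_weightCone
    (moduleHilbertFun_sub_mem_weightCone hfin hc hgens hNP hN hP
      (isFiniteQuotientOver_of_adjoin_eq_top htop N (IsNoetherian.noetherian P))) hW hn
    (IsBigO.trans (.of_bound 1 (.of_forall fun x => ?_))
      (isBigO_hilbertFun_top (ℳ := ℳ) hgens htop y))
  have hle : moduleHilbertFun ℳ N x ≤ moduleHilbertFun ℳ P x :=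
    hilbertFun_mono hfin (U := N.restrictScalars k) hNP x
  rw [one_mul, Pi.sub_apply, Real.norm_of_nonneg (sub_nonneg.2 hle),
    Real.norm_of_nonneg (hilbertFun_nonneg _ _)]
  exact (sub_le_self _ (hilbertFun_nonneg _ _)).trans (hilbertFun_mono hfin le_top x)

variable (n : ℕ) (ℳ : ℝ → Submodule k M)

/-- The pair `(a_n(N), a_{n-1}(N))` of coefficients of a graded submodule `N`, meaningful only
when such coefficients exist. -/
noncomputable def submoduleCoeff (N : Submodule R M) : ℝ × ℝ :=
  Classical.epsilon fun c : ℝ × ℝ => HasRiemannRoch n (moduleHilbertFun ℳ N) c.1 c.2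

/-- The coefficient `a_n` of a graded submodule. -/
noncomputable def leadCoeff (N : Submodule R M) : ℝ := (submoduleCoeff n ℳ N).1

/-- The coefficient `a_{n-1}` of a graded submodule. -/
noncomputable def subleadCoeff (N : Submodule R M) : ℝ := (submoduleCoeff n ℳ N).2

variable {n ℳ} {W : List ℝ}

theorem moduleHilbertFun_bot : moduleHilbertFun ℳ (⊥ : Submodule R M) = 0 :=
  funext hilbertFun_bot

namespace HasHilbertExpansion

variable [DirectSum.Decomposition ℳ] (H : HasHilbertExpansion R W n ℳ) {N P : Submodule R M}

include H

theorem hasRiemannRoch (hN : N.IsHomogeneous ℳ) :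
    HasRiemannRoch n (moduleHilbertFun ℳ N) (leadCoeff n ℳ N) (subleadCoeff n ℳ N) := by
  obtain ⟨a, b, h, -, -⟩ := H.expansion bot_le isHomogeneous_bot hN
  rw [moduleHilbertFun_bot, sub_zero] at h
  exact Classical.epsilon_spec
    (p := fun c : ℝ × ℝ => HasRiemannRoch n (moduleHilbertFun ℳ N) c.1 c.2) ⟨(a, b), h⟩

theorem coeff_eq (hN : N.IsHomogeneous ℳ) {a b : ℝ}
    (h : HasRiemannRoch n (moduleHilbertFun ℳ N) a b) :
    leadCoeff n ℳ N = a ∧ subleadCoeff n ℳ N = b :=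
  (H.hasRiemannRoch hN).unique h

theorem coeff_sub_mem (hNP : N ≤ P) (hN : N.IsHomogeneous ℳ) (hP : P.IsHomogeneous ℳ) :
    leadCoeff n ℳ P - leadCoeff n ℳ N ∈ densityMonoid W n ∧
      (leadCoeff n ℳ N = leadCoeff n ℳ P →
        subleadCoeff n ℳ P - subleadCoeff n ℳ N ∈ densityMonoid W (n - 1)) := by
  obtain ⟨a, b, h, ha, hb⟩ := H.expansion hNP hN hP
  obtain ⟨rfl, rfl⟩ := h.unique ((H.hasRiemannRoch hP).sub (H.hasRiemannRoch hN))
  exact ⟨ha, fun heq => hb (sub_eq_zero.2 heq.symm)⟩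

theorem leadCoeff_mono (hNP : N ≤ P) (hN : N.IsHomogeneous ℳ) (hP : P.IsHomogeneous ℳ) :
    leadCoeff n ℳ N ≤ leadCoeff n ℳ P :=
  sub_nonneg.1 (nonneg_of_mem_densityMonoid H.weight_pos (H.coeff_sub_mem hNP hN hP).1)

theorem subleadCoeff_mono (hNP : N ≤ P) (hN : N.IsHomogeneous ℳ) (hP : P.IsHomogeneous ℳ)
    (heq : leadCoeff n ℳ N = leadCoeff n ℳ P) : subleadCoeff n ℳ N ≤ subleadCoeff n ℳ P :=
  sub_nonneg.1 (nonneg_of_mem_densityMonoid H.weight_pos ((H.coeff_sub_mem hNP hN hP).2 heq))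

theorem coeff_sup_add_inf (hN : N.IsHomogeneous ℳ) (hP : P.IsHomogeneous ℳ) :
    leadCoeff n ℳ (N ⊔ P) + leadCoeff n ℳ (N ⊓ P) = leadCoeff n ℳ N + leadCoeff n ℳ P ∧
      subleadCoeff n ℳ (N ⊔ P) + subleadCoeff n ℳ (N ⊓ P) =
        subleadCoeff n ℳ N + subleadCoeff n ℳ P := by
  have hsum : moduleHilbertFun ℳ (N ⊔ P) + moduleHilbertFun ℳ (N ⊓ P) =
      moduleHilbertFun ℳ N + moduleHilbertFun ℳ P := by
    funext x
    simp only [Pi.add_apply, moduleHilbertFun, Submodule.restrictScalars_sup]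
    exact hilbertFun_sup_add_inf H.finiteDimensional (U := N.restrictScalars k)
      (V := P.restrictScalars k) hN hP x
  refine ((H.hasRiemannRoch (isHomogeneous_sup hN hP)).add
    (H.hasRiemannRoch (isHomogeneous_inf hN hP))).unique ?_
  rw [hsum]
  exact (H.hasRiemannRoch hN).add (H.hasRiemannRoch hP)

theorem coeff_bot : leadCoeff n ℳ (⊥ : Submodule R M) = 0 ∧
    subleadCoeff n ℳ (⊥ : Submodule R M) = 0 := by
  refine H.coeff_eq isHomogeneous_bot ?_
  rw [moduleHilbertFun_bot]
  exact .zero n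

end HasHilbertExpansion

end Coefficients

section CyclicExtension

variable {k R M : Type*} [Field k] [CommRing R] [Algebra k R]
  [AddCommGroup M] [Module R M] [Module k M] [IsScalarTower k R M]
  {ℳ : ℝ → Submodule k M} [DirectSum.Decomposition ℳ]

omit [Algebra k R] [IsScalarTower k R M] in
theorem exists_homogeneous_mem_notMem {N Q : Submodule R M} (hQ : Q.IsHomogeneous ℳ)
    (hQN : ¬ Q ≤ N) : ∃ t, ∃ m ∈ ℳ t, m ∈ Q ∧ m ∉ N := by
  classical
  by_contra! h
  refine hQN fun m hm => ?_
  rw [← DirectSum.sum_support_decompose ℳ m]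
  exact sum_mem fun t _ => h t _ (DirectSum.decompose ℳ m t).2 (hQ t hm)

variable {𝒜 : ℝ → Submodule k R} [SetLike.GradedSMul 𝒜 ℳ] {N : Submodule R M} {m : M} {t : ℝ}

theorem restrictScalars_span_singleton (m : M) : (Submodule.span R {m}).restrictScalars k =
    (⊤ : Submodule k R).map ((LinearMap.toSpanSingleton R M m).restrictScalars k) := by
  ext v
  simp [Submodule.mem_span_singleton]

omit [DirectSum.Decomposition ℳ] in
theorem toSpanSingleton_mem_shift (hm : m ∈ ℳ t) (s : ℝ) (r : R) (hr : r ∈ 𝒜 s) :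
    ((LinearMap.toSpanSingleton R M m).restrictScalars k) r ∈ ℳ (s + t) :=
  SetLike.GradedSMul.smul_mem hr hm

variable [GradedAlgebra 𝒜]

theorem isHomogeneous_span_singleton_of_gradedSMul (𝒜 : ℝ → Submodule k R) [GradedAlgebra 𝒜]
    [SetLike.GradedSMul 𝒜 ℳ] (hm : m ∈ ℳ t) : (Submodule.span R {m}).IsHomogeneous ℳ := by
  change ((Submodule.span R {m}).restrictScalars k).IsHomogeneous ℳ
  rw [restrictScalars_span_singleton]
  exact isHomogeneous_map_shift (toSpanSingleton_mem_shift (𝒜 := 𝒜) hm) isHomogeneous_top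

theorem isHomogeneous_sup_span_singleton (𝒜 : ℝ → Submodule k R) [GradedAlgebra 𝒜]
    [SetLike.GradedSMul 𝒜 ℳ] (hN : N.IsHomogeneous ℳ) (hm : m ∈ ℳ t) :
    (N ⊔ Submodule.span R {m}).IsHomogeneous ℳ :=
  isHomogeneous_sup hN (isHomogeneous_span_singleton_of_gradedSMul 𝒜 hm)

theorem isHomogeneous_comap_toSpanSingleton (hN : N.IsHomogeneous ℳ) (hm : m ∈ ℳ t) :
    (N.comap (LinearMap.toSpanSingleton R M m)).IsHomogeneous 𝒜 :=
  isHomogeneous_comap_shift (toSpanSingleton_mem_shift (𝒜 := 𝒜) hm)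
    (C := N.restrictScalars k) hN

namespace HasHilbertExpansion

variable {W : List ℝ} {n : ℕ} (H : HasHilbertExpansion R W n ℳ)
  (HR : HasHilbertExpansion R W n 𝒜)

include H HR

theorem leadCoeff_sup_span (hN : N.IsHomogeneous ℳ) (hm : m ∈ ℳ t) :
    leadCoeff n ℳ (N ⊔ Submodule.span R {m}) = leadCoeff n ℳ N + (leadCoeff n 𝒜 (⊤ : Ideal R) -
      leadCoeff n 𝒜 (N.comap (LinearMap.toSpanSingleton R M m))) := by
  have hcolon : (N.comap (LinearMap.toSpanSingleton R M m)).IsHomogeneous 𝒜 :=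
    isHomogeneous_comap_toSpanSingleton hN hm
  have hcoeff := (H.hasRiemannRoch hN).add (((HR.hasRiemannRoch isHomogeneous_top).sub
    (HR.hasRiemannRoch hcolon)).comp_sub_right HR.one_le t)
  refine (H.coeff_eq (isHomogeneous_sup_span_singleton 𝒜 hN hm)
    ((congrArg (HasRiemannRoch n · _ _) (funext fun x => ?_)).mpr hcoeff)).1
  have hshift := hilbertFun_sup_map_shift (toSpanSingleton_mem_shift (𝒜 := 𝒜) hm)
    H.finiteDimensional HR.finiteDimensional isHomogeneous_top (C := N.restrictScalars k) hN x
  rw [← restrictScalars_span_singleton, ← Submodule.restrictScalars_sup, top_inf_eq] at hshift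
  exact eq_add_of_sub_eq' hshift

theorem leadCoeff_sup_span_of_injective (hN : N.IsHomogeneous ℳ) (hm : m ∈ ℳ t)
    (hinj : ∀ r : R, r • m ∈ N → r = 0) :
    leadCoeff n ℳ (N ⊔ Submodule.span R {m}) = leadCoeff n ℳ N + leadCoeff n 𝒜 (⊤ : Ideal R) := by
  have hcolon : N.comap (LinearMap.toSpanSingleton R M m) = ⊥ :=
    (Submodule.eq_bot_iff _).2 hinj
  rw [H.leadCoeff_sup_span HR hN hm, hcolon, HR.coeff_bot.1, sub_zero]

omit H in
theorem leadCoeff_ideal [IsDomain R] {J : Ideal R} (hJ : J.IsHomogeneous 𝒜) (hJ0 : J ≠ ⊥) :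
    leadCoeff n 𝒜 J = leadCoeff n 𝒜 (⊤ : Ideal R) := by
  obtain ⟨t, r, hrt, hrJ, hr0⟩ := exists_homogeneous_mem_notMem hJ (mt le_bot_iff.1 hJ0)
  have hprincipal := HR.leadCoeff_sup_span_of_injective HR (N := (⊥ : Ideal R))
    isHomogeneous_bot hrt fun s hs => (mul_eq_zero.1 hs).resolve_right hr0
  rw [HR.coeff_bot.1, zero_add, bot_sup_eq] at hprincipal
  refine le_antisymm (HR.leadCoeff_mono le_top hJ isHomogeneous_top) ?_
  rw [← hprincipal]
  exact HR.leadCoeff_mono ((Submodule.span_singleton_le_iff_mem _ _).2 hrJ)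
    (isHomogeneous_span_singleton_of_gradedSMul 𝒜 hrt) hJ

theorem leadCoeff_sup_span_of_torsion [IsDomain R] (hN : N.IsHomogeneous ℳ) (hm : m ∈ ℳ t)
    {r : R} (hr : r ≠ 0) (hrm : r • m ∈ N) :
    leadCoeff n ℳ (N ⊔ Submodule.span R {m}) = leadCoeff n ℳ N := by
  have hcolon : N.comap (LinearMap.toSpanSingleton R M m) ≠ ⊥ :=
    (Submodule.ne_bot_iff _).2 ⟨r, hrm, hr⟩
  rw [H.leadCoeff_sup_span HR hN hm,
    HR.leadCoeff_ideal (isHomogeneous_comap_toSpanSingleton hN hm) hcolon, sub_self, add_zero]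

end HasHilbertExpansion

end CyclicExtension

section TopDegree

variable {k R M : Type*} [Field k] [CommRing R] [AddCommGroup M] [Module R M] [Module k M]
  {ℳ : ℝ → Submodule k M} [DirectSum.Decomposition ℳ]

omit [CommRing R] [Module R M] in
theorem decompose_eq_zero_of_mem_gradedLE {m : M} {t u : ℝ} (hm : m ∈ gradedLE ℳ t) (htu : t < u) :
    (DirectSum.decompose ℳ m u : M) = 0 := by
  refine Submodule.iSup_induction (fun s : Set.Iic t => ℳ s)
    (motive := fun m => (DirectSum.decompose ℳ m u : M) = 0) hm (fun s m hm => ?_) ?_ ?_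
  · exact DirectSum.decompose_of_mem_ne ℳ hm (s.2.trans_lt htu).ne
  · simp
  · intro a b ha hb
    simp [DirectSum.decompose_add, ha, hb]

theorem exists_sub_mem_gradedLE {N : Submodule R M} (hN : N.IsHomogeneous ℳ) {m : M}
    (hm : m ∉ N) : ∃ t, ∃ u ∈ N, m - u ∈ gradedLE ℳ t ∧
      (DirectSum.decompose ℳ (m - u) t : M) ∉ N := by
  classical
  let S := (DirectSum.decompose ℳ m).support.filter fun i => (DirectSum.decompose ℳ m i : M) ∉ N
  let u := ∑ i ∈ (DirectSum.decompose ℳ m).support.filter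
    fun i => (DirectSum.decompose ℳ m i : M) ∈ N, (DirectSum.decompose ℳ m i : M)
  have hu : u ∈ N := sum_mem fun i hi => (Finset.mem_filter.1 hi).2
  have hmu : m - u = ∑ i ∈ S, (DirectSum.decompose ℳ m i : M) := by
    refine sub_eq_of_eq_add' ?_
    rw [Finset.sum_filter_add_sum_filter_not, DirectSum.sum_support_decompose]
  have hS : S.Nonempty := by
    by_contra hS
    rw [Finset.not_nonempty_iff_eq_empty.1 hS, Finset.sum_empty, sub_eq_zero] at hmu
    exact hm (hmu ▸ hu)
  refine ⟨S.max' hS, u, hu, ?_, fun htop => ?_⟩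
  · rw [hmu]
    exact sum_mem fun i hi => le_gradedLE (S.le_max' i hi) (DirectSum.decompose ℳ m i).2
  · rw [DirectSum.decompose_sub, DirectSum.sub_apply, AddSubgroupClass.coe_sub,
      N.sub_mem_iff_left (hN _ hu)] at htop
    exact (Finset.mem_filter.1 (S.max'_mem hS)).2 htop

variable [Algebra k R] [IsScalarTower k R M] {𝒜 : ℝ → Submodule k R} [GradedAlgebra 𝒜]
  [SetLike.GradedSMul 𝒜 ℳ]

theorem decompose_smul_top_degree {r : R} {m : M} {s t : ℝ} (hr : r ∈ gradedLE 𝒜 s)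
    (hm : m ∈ gradedLE ℳ t) : (DirectSum.decompose ℳ (r • m) (s + t) : M) =
      (DirectSum.decompose 𝒜 r s : R) • (DirectSum.decompose ℳ m t : M) := by
  refine Submodule.iSup_induction (fun i : Set.Iic s => 𝒜 i) (motive := fun r =>
    (DirectSum.decompose ℳ (r • m) (s + t) : M) =
      (DirectSum.decompose 𝒜 r s : R) • (DirectSum.decompose ℳ m t : M)) hr ?_ ?_ ?_
  · intro ⟨i, his⟩ r hr
    have hshift := decompose_map_shift (lsmul_mem_shift (ℳ := ℳ) hr) m (s + t - i)
    rw [sub_add_cancel] at hshift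
    refine hshift.trans ?_
    rcases (Set.mem_Iic.1 his).eq_or_lt with rfl | his
    · rw [DirectSum.decompose_of_mem_same 𝒜 hr, add_sub_cancel_left]
      rfl
    · rw [decompose_eq_zero_of_mem_gradedLE hm (by linarith),
        DirectSum.decompose_of_mem_ne 𝒜 hr his.ne, map_zero, zero_smul]
  · simp
  · intro a b ha hb
    simp [add_smul, DirectSum.decompose_add, ha, hb]

theorem mem_of_smul_mem_of_homogeneous {N P : Submodule R M} (hN : N.IsHomogeneous ℳ)
    (hP : P.IsHomogeneous ℳ) (hNP : N ≤ P)
    (hhom : ∀ (s t : ℝ), ∀ r ∈ 𝒜 s, ∀ m ∈ ℳ t, m ∈ P → r ≠ 0 → r • m ∈ N → m ∈ N)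
    {r : R} (hr : r ≠ 0) {m : M} (hm : m ∈ P) (hrm : r • m ∈ N) : m ∈ N := by
  by_contra hmN
  obtain ⟨s, z, hz, hrs, hrs0⟩ := exists_sub_mem_gradedLE (R := R) (ℳ := 𝒜) isHomogeneous_bot
    (mt (Submodule.mem_bot R).1 hr)
  obtain ⟨t, u, hu, hmt, hmtN⟩ := exists_sub_mem_gradedLE hN hmN
  rw [(Submodule.mem_bot R).1 hz, sub_zero] at hrs hrs0
  refine hmtN (hhom s t _ (DirectSum.decompose 𝒜 r s).2 _ (DirectSum.decompose ℳ (m - u) t).2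
    (hP t (P.sub_mem hm (hNP hu))) (mt (Submodule.mem_bot R).2 hrs0) ?_)
  rw [← decompose_smul_top_degree hrs hmt, smul_sub]
  exact hN _ (N.sub_mem hrm (N.smul_mem r hu))

theorem homogeneous_submodule_induction (𝒜 : ℝ → Submodule k R) [GradedAlgebra 𝒜]
    [SetLike.GradedSMul 𝒜 ℳ] {motive : Submodule R M → Prop} (bot : motive ⊥)
    (sup_span : ∀ N : Submodule R M, N.IsHomogeneous ℳ → motive N →
      ∀ t, ∀ m ∈ ℳ t, motive (N ⊔ Submodule.span R {m}))
    {N : Submodule R M} (hN : N.IsHomogeneous ℳ) (hfg : N.FG) : motive N := by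
  classical
  obtain ⟨s, hs⟩ := hfg
  have hspan : Submodule.span R (Prod.fst '' (homogeneousComponents ℳ s : Set (M × ℝ))) = N := by
    refine le_antisymm (Submodule.span_le.2 ?_) ?_
    · rintro _ ⟨p, hp, rfl⟩
      obtain ⟨m, hm, hmp, -⟩ := mem_homogeneousComponents.1 hp
      exact hmp ▸ hN p.2 (hs ▸ Submodule.subset_span hm)
    · rw [← hs, Submodule.span_le]
      exact fun m hm => mem_of_forall_homogeneousComponents (ℳ := ℳ)
        (fun p hp => Submodule.subset_span (Set.mem_image_of_mem _ hp)) hm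
  suffices ∀ T : Finset (M × ℝ), (∀ p ∈ T, p.1 ∈ ℳ p.2) →
      (Submodule.span R (Prod.fst '' (T : Set (M × ℝ)))).IsHomogeneous ℳ ∧
        motive (Submodule.span R (Prod.fst '' (T : Set (M × ℝ)))) from
    hspan ▸ (this _ fun p => mem_of_mem_homogeneousComponents).2
  intro T hT
  induction T using Finset.induction_on with
  | empty => simpa using ⟨isHomogeneous_bot, bot⟩
  | insert p T _ ih =>
    obtain ⟨hp, hT⟩ := Finset.forall_mem_insert _ _ _ |>.1 hT
    obtain ⟨hhom, hmotive⟩ := ih hT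
    rw [Finset.coe_insert, Set.image_insert_eq, Submodule.span_insert, sup_comm]
    exact ⟨isHomogeneous_sup_span_singleton 𝒜 hhom hp, sup_span _ hhom hmotive p.2 p.1 hp⟩

end TopDegree

section TorsionFree

variable {R M : Type*} [CommRing R] [IsDomain R] [AddCommGroup M] [Module R M]
  [Module.IsTorsionFree R M]

theorem finrank_span_singleton_of_ne_zero {m : M} (hm : m ≠ 0) :
    Module.finrank R (Submodule.span R {m}) = 1 := by
  rw [← (LinearEquiv.toSpanNonzeroSingleton R M m hm).finrank_eq, Module.finrank_self]

variable [IsNoetherian R M]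

omit [Module.IsTorsionFree R M] in
theorem finrank_sup_add_finrank_inf (N P : Submodule R M) :
    Module.finrank R (N ⊔ P : Submodule R M) + Module.finrank R (N ⊓ P : Submodule R M) =
      Module.finrank R N + Module.finrank R P := by
  have hrank := Submodule.rank_sup_add_rank_inf_eq N P
  simp only [← Module.finrank_eq_rank] at hrank
  exact_mod_cast hrank

theorem finrank_sup_span_singleton_of_injective {N : Submodule R M} {m : M}
    (hinj : ∀ r : R, r • m ∈ N → r = 0) :
    Module.finrank R (N ⊔ Submodule.span R {m} : Submodule R M) = Module.finrank R N + 1 := by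
  have hm : m ≠ 0 := fun hm => one_ne_zero (hinj 1 (by simp [hm]))
  have hinf : N ⊓ Submodule.span R {m} = ⊥ := by
    refine (Submodule.eq_bot_iff _).2 fun x hx => ?_
    obtain ⟨r, rfl⟩ := Submodule.mem_span_singleton.1 hx.2
    rw [hinj r hx.1, zero_smul]
  have hsum := finrank_sup_add_finrank_inf N (Submodule.span R {m})
  rwa [hinf, finrank_bot, add_zero, finrank_span_singleton_of_ne_zero hm] at hsum

theorem finrank_sup_span_singleton_of_torsion {N : Submodule R M} {m : M} {r : R} (hr : r ≠ 0)
    (hrm : r • m ∈ N) :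
    Module.finrank R (N ⊔ Submodule.span R {m} : Submodule R M) = Module.finrank R N := by
  by_cases hm : m = 0
  · rw [hm, Submodule.span_zero_singleton, sup_bot_eq]
  have hsum := finrank_sup_add_finrank_inf N (Submodule.span R {m})
  have hle : Module.finrank R (Submodule.span R {r • m}) ≤
      Module.finrank R (N ⊓ Submodule.span R {m} : Submodule R M) :=
    Submodule.finrank_mono ((Submodule.span_singleton_le_iff_mem _ _).2
      ⟨hrm, Submodule.smul_mem _ _ (Submodule.mem_span_singleton_self m)⟩)
  have hge : Module.finrank R N ≤ Module.finrank R (N ⊔ Submodule.span R {m} : Submodule R M) :=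
    Submodule.finrank_mono le_sup_left
  rw [finrank_span_singleton_of_ne_zero (smul_ne_zero hr hm)] at hle
  rw [finrank_span_singleton_of_ne_zero hm] at hsum
  omega

end TorsionFree

section Torsion

variable {k R M : Type*} [Field k] [CommRing R] [Algebra k R]
  [AddCommGroup M] [Module R M] [Module k M] [IsScalarTower k R M]
  {ℳ : ℝ → Submodule k M} [DirectSum.Decomposition ℳ]
  {𝒜 : ℝ → Submodule k R} [GradedAlgebra 𝒜] [SetLike.GradedSMul 𝒜 ℳ]

namespace HasHilbertExpansion

variable {n : ℕ} {W : List ℝ} (H : HasHilbertExpansion R W n ℳ) (HR : HasHilbertExpansion R W n 𝒜)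
  {N P Q : Submodule R M}

include H HR

theorem leadCoeff_lt (hpos : 0 < leadCoeff n 𝒜 (⊤ : Ideal R)) (hN : N.IsHomogeneous ℳ)
    (hQ : Q.IsHomogeneous ℳ) (hNQ : N < Q)
    (htf : ∀ r : R, r ≠ 0 → ∀ m ∈ Q, r • m ∈ N → m ∈ N) : leadCoeff n ℳ N < leadCoeff n ℳ Q := by
  obtain ⟨t, m, hmt, hmQ, hmN⟩ := exists_homogeneous_mem_notMem hQ hNQ.not_ge
  calc leadCoeff n ℳ N < leadCoeff n ℳ N + leadCoeff n 𝒜 (⊤ : Ideal R) := lt_add_of_pos_right _ hpos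
    _ = leadCoeff n ℳ (N ⊔ Submodule.span R {m}) :=
      (H.leadCoeff_sup_span_of_injective HR hN hmt fun r hr =>
        by_contra fun hr0 => hmN (htf r hr0 m hmQ hr)).symm
    _ ≤ leadCoeff n ℳ Q :=
      H.leadCoeff_mono (sup_le hNQ.le ((Submodule.span_singleton_le_iff_mem m Q).2 hmQ))
        (isHomogeneous_sup_span_singleton 𝒜 hN hmt) hQ

variable [IsDomain R]

theorem mem_of_smul_mem (hN : N.IsHomogeneous ℳ) (hP : P.IsHomogeneous ℳ) (hNP : N ≤ P)
    (hlt : ∀ Q : Submodule R M, Q.IsHomogeneous ℳ → N < Q → Q ≤ P →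
      leadCoeff n ℳ N < leadCoeff n ℳ Q) {r : R} (hr : r ≠ 0) {m : M} (hm : m ∈ P)
    (hrm : r • m ∈ N) : m ∈ N := by
  refine mem_of_smul_mem_of_homogeneous (𝒜 := 𝒜) hN hP hNP ?_ hr hm hrm
  intro _ t r _ m hmt hmP hr hrm
  by_contra hmN
  have hlt_sup : N < N ⊔ Submodule.span R {m} :=
    left_lt_sup.2 (mt (Submodule.span_singleton_le_iff_mem m N).1 hmN)
  exact (hlt _ (isHomogeneous_sup_span_singleton 𝒜 hN hmt) hlt_sup
    (sup_le hNP ((Submodule.span_singleton_le_iff_mem m P).2 hmP))).ne'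
      (H.leadCoeff_sup_span_of_torsion HR hN hmt hr hrm)

theorem leadCoeff_eq_of_cyclic {m : M} {t : ℝ} (hN : N.IsHomogeneous ℳ) (hm : m ∈ ℳ t)
    (hQ : Q.IsHomogeneous ℳ) (hNQ : N < Q) (hQm : Q ≤ N ⊔ Submodule.span R {m}) :
    leadCoeff n ℳ Q = leadCoeff n ℳ (N ⊔ Submodule.span R {m}) := by
  refine le_antisymm
    (H.leadCoeff_mono hQm hQ (isHomogeneous_sup_span_singleton 𝒜 hN hm)) ?_
  by_cases hinj : ∀ r : R, r • m ∈ N → r = 0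
  · obtain ⟨s, q, hqs, hqQ, hqN⟩ := exists_homogeneous_mem_notMem hQ hNQ.not_ge
    have hinjq : ∀ r : R, r • q ∈ N → r = 0 := by
      intro r hr
      obtain ⟨p, hp, _, hx, rfl⟩ := Submodule.mem_sup.1 (hQm hqQ)
      obtain ⟨u, rfl⟩ := Submodule.mem_span_singleton.1 hx
      rw [smul_add, N.add_mem_iff_right (N.smul_mem r hp), smul_smul] at hr
      refine (mul_eq_zero.1 (hinj _ hr)).resolve_right fun hu => hqN ?_
      rwa [hu, zero_smul, add_zero]
    rw [H.leadCoeff_sup_span_of_injective HR hN hm hinj,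
      ← H.leadCoeff_sup_span_of_injective HR hN hqs hinjq]
    exact H.leadCoeff_mono (sup_le hNQ.le ((Submodule.span_singleton_le_iff_mem q Q).2 hqQ))
      (isHomogeneous_sup_span_singleton 𝒜 hN hqs) hQ
  · push Not at hinj
    obtain ⟨r, hrm, hr⟩ := hinj
    rw [H.leadCoeff_sup_span_of_torsion HR hN hm hr hrm]
    exact H.leadCoeff_mono hNQ.le hN hQ

open scoped Pointwise in
theorem isPWO_neg_subleadCoeff_sup_span {m : M} {t : ℝ} (hN : N.IsHomogeneous ℳ) (hm : m ∈ ℳ t)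
    (hpwo : ((fun Q => -subleadCoeff n ℳ Q) '' {Q : Submodule R M | Q.IsHomogeneous ℳ ∧
      Q ≤ N}).IsPWO) :
    ((fun Q => -subleadCoeff n ℳ Q) '' {Q : Submodule R M | Q.IsHomogeneous ℳ ∧
      Q ≤ N ⊔ Submodule.span R {m}}).IsPWO := by
  set P := N ⊔ Submodule.span R {m}
  have hP : P.IsHomogeneous ℳ := isHomogeneous_sup_span_singleton 𝒜 hN hm
  have hshift : (((densityMonoid W (n - 1) : Set ℝ) +
      {subleadCoeff n ℳ N - subleadCoeff n ℳ P}) ∪ {0}).IsPWO :=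
    ((isPWO_densityMonoid H.weight_pos _).add (Set.isPWO_singleton _)).union
      (Set.isPWO_singleton _)
  refine (hpwo.add hshift).mono ?_
  rintro _ ⟨Q, ⟨hQ, hQP⟩, rfl⟩
  refine ⟨-subleadCoeff n ℳ (Q ⊓ N), ⟨_, ⟨isHomogeneous_inf hQ hN, inf_le_right⟩, rfl⟩,
    subleadCoeff n ℳ N - subleadCoeff n ℳ (Q ⊔ N), ?_, ?_⟩
  · have hQN := isHomogeneous_sup hQ hN
    have hle : Q ⊔ N ≤ P := sup_le hQP le_sup_left
    rcases (le_sup_right : N ≤ Q ⊔ N).eq_or_lt with heq | hlt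
    · exact .inr (sub_eq_zero.2 (congrArg _ heq))
    · have hlead := H.leadCoeff_eq_of_cyclic HR hN hm hQN hlt hle
      exact .inl ⟨_, (H.coeff_sub_mem hle hQN hP).2 hlead, _, rfl, by ring⟩
  · change _ + _ = -subleadCoeff n ℳ Q
    linarith [(H.coeff_sup_add_inf hQ hN).2]

theorem isPWO_neg_subleadCoeff :
    ((fun Q => -subleadCoeff n ℳ Q) '' {Q : Submodule R M | Q.IsHomogeneous ℳ}).IsPWO := by
  have := H.noetherian
  have hpwo : ((fun Q => -subleadCoeff n ℳ Q) '' {Q : Submodule R M | Q.IsHomogeneous ℳ ∧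
      Q ≤ ⊤}).IsPWO := by
    refine homogeneous_submodule_induction 𝒜 (ℳ := ℳ) (motive := fun P => Set.IsPWO
      ((fun Q => -subleadCoeff n ℳ Q) '' {Q | Q.IsHomogeneous ℳ ∧ Q ≤ P})) ?_
      (fun N hN hpwo t m hm => H.isPWO_neg_subleadCoeff_sup_span HR hN hm hpwo)
      isHomogeneous_top (IsNoetherian.noetherian _)
    refine (Set.isPWO_singleton (-subleadCoeff n ℳ (⊥ : Submodule R M))).mono ?_
    rintro _ ⟨Q, ⟨-, hQ⟩, rfl⟩
    rw [le_bot_iff.1 hQ]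
    rfl
  simpa only [le_top, and_true] using hpwo

theorem leadCoeff_eq_finrank_mul [Module.IsTorsionFree R M] (hN : N.IsHomogeneous ℳ) :
    leadCoeff n ℳ N = Module.finrank R N * leadCoeff n 𝒜 (⊤ : Ideal R) := by
  have := H.noetherian
  refine homogeneous_submodule_induction 𝒜 (motive := fun N => leadCoeff n ℳ N =
    Module.finrank R N * leadCoeff n 𝒜 (⊤ : Ideal R)) ?_ (fun N hN hlead t m hm => ?_) hN
    (IsNoetherian.noetherian N)
  · simp [H.coeff_bot.1]
  by_cases hinj : ∀ r : R, r • m ∈ N → r = 0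
  · rw [H.leadCoeff_sup_span_of_injective HR hN hm hinj, hlead,
      finrank_sup_span_singleton_of_injective hinj, Nat.cast_succ, add_one_mul]
  · push Not at hinj
    obtain ⟨r, hrm, hr⟩ := hinj
    rw [H.leadCoeff_sup_span_of_torsion HR hN hm hr hrm, hlead,
      finrank_sup_span_singleton_of_torsion hr hrm]

omit H [IsDomain R] in
theorem leadCoeff_top_pos {y : Fin n → R} (hy : AlgebraicIndependent k y) :
    0 < leadCoeff n 𝒜 (⊤ : Ideal R) := by
  have hnonneg : 0 ≤ leadCoeff n 𝒜 (⊤ : Ideal R) := by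
    rw [← HR.coeff_bot.1]
    exact HR.leadCoeff_mono bot_le isHomogeneous_bot isHomogeneous_top
  refine hnonneg.lt_of_ne fun hzero => ?_
  obtain ⟨C, hC, hlower⟩ := exists_pow_le_hilbertFun hy HR.finiteDimensional
  have hupper := (HR.hasRiemannRoch (N := (⊤ : Ideal R)) isHomogeneous_top).leading
  simp only [← hzero, zero_div, zero_mul, sub_zero] at hupper
  have hpow : (fun x : ℝ => C ^ n * x ^ n) =O[atTop] moduleHilbertFun 𝒜 (⊤ : Ideal R) := by
    refine .of_bound 1 ?_
    filter_upwards [eventually_ge_atTop (0 : ℝ)] with x hx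
    rw [one_mul, ← mul_pow, Real.norm_of_nonneg (by positivity)]
    exact (hlower x hx).trans (Real.le_norm_self _)
  exact (pow_pos hC n).ne' (eq_zero_of_isLittleO_pow ((hpow.trans hupper).trans_isLittleO
    (isLittleO_pow_pow_atTop_of_lt (Nat.sub_lt HR.one_le one_pos))))

end HasHilbertExpansion

end Torsion

section Transfer

theorem integral_sub_leading_sub_subleading {h : ℝ → ℝ}
    (hint : ∀ S T, IntervalIntegrable h MeasureTheory.volume S T) (a b : ℝ) (m : ℕ) (T : ℝ) :
    ∫ x in (1 : ℝ)..T, (h x - a / (m + 1).factorial * x ^ (m + 1) - b / m.factorial * x ^ m) =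
      ((∫ x in (0 : ℝ)..T, h x) -
        (a / (m + 2).factorial * T ^ (m + 2) + b / (m + 1).factorial * T ^ (m + 1))) +
      (a / (m + 2).factorial + b / (m + 1).factorial - ∫ x in (0 : ℝ)..1, h x) := by
  have hpow : ∀ (c : ℝ) (j : ℕ),
      IntervalIntegrable (fun x : ℝ => c * x ^ j) MeasureTheory.volume 1 T := fun c j =>
    (continuous_const.mul (continuous_pow j)).intervalIntegrable 1 T
  have hfactorial : ∀ (c : ℝ) (j : ℕ), c / j.factorial / (j + 1) = c / (j + 1).factorial := by
    intro c j
    rw [Nat.factorial_succ, Nat.cast_mul, Nat.cast_succ, div_div, mul_comm]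
  rw [intervalIntegral.integral_sub ((hint _ _).sub (hpow _ _)) (hpow _ _),
    intervalIntegral.integral_sub (hint _ _) (hpow _ _), intervalIntegral.integral_const_mul,
    intervalIntegral.integral_const_mul, integral_pow, integral_pow, ← hfactorial a (m + 1),
    ← hfactorial b m, ← intervalIntegral.integral_add_adjacent_intervals (hint 0 1) (hint 1 T)]
  push_cast
  ring

variable {k M : Type*} [Field k] [AddCommGroup M] [Module k M] {n : ℕ} {ℳ : ℝ → Submodule k M}
  {a b : ℝ}

theorem isRiemannRoch_iff_hasRiemannRoch (hn : 1 ≤ n)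
    (hint : ∀ S T, IntervalIntegrable (dimLE ℳ) MeasureTheory.volume S T) :
    IsRiemannRoch n ℳ a b ↔ HasRiemannRoch n (dimLE ℳ) a b := by
  obtain ⟨m, rfl⟩ : ∃ m, n = m + 1 := ⟨n - 1, (Nat.sub_add_cancel hn).symm⟩
  have hconst (c : ℝ) : (fun _ : ℝ => c) =o[atTop] fun T : ℝ => T ^ (m + 1) := by
    simpa using (isLittleO_pow_pow_atTop_of_lt (𝕜 := ℝ) m.succ_pos).const_mul_left c
  have hcesaro : Tendsto (fun T : ℝ => 1 / T ^ (m + 1) * ∫ x in (1 : ℝ)..T, (dimLE ℳ x -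
      a / (m + 1).factorial * x ^ (m + 1) - b / m.factorial * x ^ m)) atTop (𝓝 0) ↔
      (fun T : ℝ => ∫ x in (1 : ℝ)..T, (dimLE ℳ x -
        a / (m + 1).factorial * x ^ (m + 1) - b / m.factorial * x ^ m)) =o[atTop]
        fun T : ℝ => T ^ (m + 1) := by
    rw [isLittleO_iff_tendsto']
    · simp only [div_eq_inv_mul, mul_one]
    · filter_upwards [eventually_gt_atTop (0 : ℝ)] with T hT hzero
      exact absurd hzero (pow_pos hT _).ne'
  have harea : (fun T : ℝ => ∫ x in (1 : ℝ)..T, (dimLE ℳ x -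
      a / (m + 1).factorial * x ^ (m + 1) - b / m.factorial * x ^ m)) =o[atTop]
      (fun T : ℝ => T ^ (m + 1)) ↔ (fun T : ℝ => (∫ x in (0 : ℝ)..T, dimLE ℳ x) -
        (a / (m + 2).factorial * T ^ (m + 2) + b / (m + 1).factorial * T ^ (m + 1))) =o[atTop]
        fun T : ℝ => T ^ (m + 1) := by
    simp only [integral_sub_leading_sub_subleading hint]
    exact ⟨fun h => (h.sub (hconst _)).congr_left fun T => add_sub_cancel_right _ _,
      fun h => h.add (hconst _)⟩
  exact ⟨fun h => ⟨hint, h.leading, harea.1 (hcesaro.1 h.cesaro)⟩,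
    fun h => ⟨h.leading, hcesaro.2 (harea.2 h.area)⟩⟩

theorem HasRiemannRoch.existsUnique_isRiemannRoch (hn : 1 ≤ n)
    (h : HasRiemannRoch n (dimLE ℳ) a b) : ∃! c : ℝ × ℝ, IsRiemannRoch n ℳ c.1 c.2 := by
  refine ⟨(a, b), (isRiemannRoch_iff_hasRiemannRoch hn h.integrable).2 h, fun c hc => ?_⟩
  have hc := ((isRiemannRoch_iff_hasRiemannRoch hn h.integrable).1 hc).unique h
  exact Prod.ext hc.1 hc.2

theorem HasRiemannRoch.rrCoeff_eq (hn : 1 ≤ n) (h : HasRiemannRoch n (dimLE ℳ) a b) :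
    rrCoeff n ℳ = (a, b) := by
  have hex := h.existsUnique_isRiemannRoch hn
  exact hex.unique (Classical.epsilon_spec hex.exists)
    ((isRiemannRoch_iff_hasRiemannRoch hn h.integrable).2 h)

end Transfer

section Subspace

variable {k R M : Type*} [Field k] [CommRing R] [Algebra k R]
  [AddCommGroup M] [Module R M] [Module k M] [IsScalarTower k R M] {P : Submodule R M}

theorem map_comap_subtype_of_le {V : Submodule k M} (hV : V ≤ P.restrictScalars k) :
    (V.comap (P.subtype.restrictScalars k)).map (P.subtype.restrictScalars k) = V :=
  Submodule.map_comap_eq_self fun m hm => ⟨⟨m, hV hm⟩, rfl⟩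

theorem iSup_comap_subtype {ι : Sort*} {V : ι → Submodule k M}
    (hV : ∀ i, V i ≤ P.restrictScalars k) :
    ⨆ i, (V i).comap (P.subtype.restrictScalars k) =
      (⨆ i, V i).comap (P.subtype.restrictScalars k) := by
  refine Submodule.map_injective_of_injective (f := P.subtype.restrictScalars k)
    Subtype.val_injective ?_
  rw [Submodule.map_iSup, map_comap_subtype_of_le (iSup_le hV)]
  exact iSup_congr fun i => map_comap_subtype_of_le (hV i)

theorem finrank_map_mkQ_comap_subtype (N : Submodule R M) {V : Submodule k M}
    [FiniteDimensional k V] (hV : V ≤ P.restrictScalars k) :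
    Module.finrank k ((V.comap (P.subtype.restrictScalars k)).map
      ((N.submoduleOf P).mkQ.restrictScalars k)) +
      Module.finrank k (N.restrictScalars k ⊓ V : Submodule k M) = Module.finrank k V := by
  let restrictEquiv {W : Submodule k M} (hW : W ≤ P.restrictScalars k) :
      W.comap (P.subtype.restrictScalars k) ≃ₗ[k] W :=
    Submodule.comapSubtypeEquivOfLe (q := P.restrictScalars k) hW
  have : FiniteDimensional k (V.comap (P.subtype.restrictScalars k)) :=
    (restrictEquiv hV).symm.finiteDimensional
  have hrank := finrank_sup_map_add_finrank_inf_comap ((N.submoduleOf P).mkQ.restrictScalars k)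
    (V.comap (P.subtype.restrictScalars k)) ⊥
  have hker : V.comap (P.subtype.restrictScalars k) ⊓
      (⊥ : Submodule k _).comap ((N.submoduleOf P).mkQ.restrictScalars k) =
      (N.restrictScalars k ⊓ V).comap (P.subtype.restrictScalars k) := by
    ext p
    exact (and_congr_right' (Submodule.Quotient.mk_eq_zero (N.submoduleOf P))).trans and_comm
  rwa [bot_sup_eq, finrank_bot, zero_add, hker, (restrictEquiv hV).finrank_eq,
    (restrictEquiv (inf_le_right.trans hV)).finrank_eq] at hrank

theorem dimLE_subGrading (ℳ : ℝ → Submodule k M) (P : Submodule R M) (x : ℝ) :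
    dimLE (subGrading ℳ P) x =
      Module.finrank k (⨆ t : Set.Iic x, P.restrictScalars k ⊓ ℳ t : Submodule k M) := by
  have hmap : (⨆ t : Set.Iic x, subGrading ℳ P t).map (P.subtype.restrictScalars k) =
      ⨆ t : Set.Iic x, P.restrictScalars k ⊓ ℳ t := by
    rw [Submodule.map_iSup]
    exact iSup_congr fun t => Submodule.map_comap_subtype (P.restrictScalars k) (ℳ t)
  rw [dimLE, ← hmap, ← (Submodule.equivMapOfInjective (P.subtype.restrictScalars k)
    Subtype.val_injective _).finrank_eq]

end Subspace

section Subquotient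

variable {k R M : Type*} [Field k] [CommRing R] [Algebra k R]
  [AddCommGroup M] [Module R M] [Module k M] [IsScalarTower k R M]
  {ℳ : ℝ → Submodule k M} {N P Q : Submodule R M}

/-- The submodule `Q / N` of `P / N`, for `N ≤ Q ≤ P`. -/
def subquotSubmodule (N P Q : Submodule R M) : Submodule R (P ⧸ N.submoduleOf P) :=
  (Q.submoduleOf P).map (N.submoduleOf P).mkQ

theorem mkQ_mem_subquotSubmodule (hNQ : N ≤ Q) {p : P} :
    (N.submoduleOf P).mkQ p ∈ subquotSubmodule N P Q ↔ (p : M) ∈ Q := by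
  refine ⟨?_, fun h => ⟨p, h, rfl⟩⟩
  rintro ⟨p', hp', heq⟩
  have hsub : (p' : M) - p ∈ N := (Submodule.Quotient.eq (N.submoduleOf P)).1 heq
  exact (Q.sub_mem_iff_right hp').1 (hNQ hsub)

theorem subquotSubmodule_self (N P : Submodule R M) : subquotSubmodule N P P = ⊤ := by
  rw [subquotSubmodule, Submodule.submoduleOf_self, Submodule.map_top, Submodule.range_mkQ]

theorem subquotSubmodule_ne_bot_iff (hNQ : N ≤ Q) (hQP : Q ≤ P) :
    subquotSubmodule N P Q ≠ ⊥ ↔ N < Q := by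
  rw [Submodule.ne_bot_iff, lt_iff_le_and_ne, and_iff_right hNQ]
  constructor
  · rintro ⟨_, ⟨p, hp, rfl⟩, hne⟩ rfl
    exact hne ((Submodule.Quotient.mk_eq_zero _).2 hp)
  · intro hne
    obtain ⟨m, hm, hmN⟩ := SetLike.exists_of_lt (lt_of_le_of_ne hNQ hne)
    exact ⟨_, ⟨⟨m, hQP hm⟩, hm, rfl⟩,
      fun hzero => hmN ((Submodule.Quotient.mk_eq_zero (N.submoduleOf P)).1 hzero)⟩

theorem finrank_subquotSubmodule_add_finrank [IsDomain R] [IsNoetherian R M] (hNQ : N ≤ Q)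
    (hQP : Q ≤ P) :
    Module.finrank R (subquotSubmodule N P Q) + Module.finrank R N = Module.finrank R Q := by
  let f := (N.submoduleOf P).mkQ.domRestrict (Q.submoduleOf P)
  have hle : N.submoduleOf P ≤ Q.submoduleOf P := Submodule.comap_mono hNQ
  have hrange : LinearMap.range f = subquotSubmodule N P Q := LinearMap.range_domRestrict _ _
  have hker : LinearMap.ker f = (N.submoduleOf P).submoduleOf (Q.submoduleOf P) := by
    rw [LinearMap.ker_domRestrict, Submodule.ker_mkQ]
    rfl
  have hrank := Submodule.finrank_quotient_add_finrank (LinearMap.ker f)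
  rwa [f.quotKerEquivRange.finrank_eq, hrange, hker,
    (Submodule.submoduleOfEquivOfLe hle).finrank_eq,
    (Submodule.submoduleOfEquivOfLe hQP).finrank_eq,
    (Submodule.submoduleOfEquivOfLe (hNQ.trans hQP)).finrank_eq] at hrank

theorem subquotSubmodule_inf (hNQ : N ≤ Q) (t : ℝ) :
    (subquotSubmodule N P Q).restrictScalars k ⊓ subquotGrading ℳ N P t =
      ((Q.restrictScalars k ⊓ ℳ t).comap (P.subtype.restrictScalars k)).map
        ((N.submoduleOf P).mkQ.restrictScalars k) := by
  refine le_antisymm ?_ ?_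
  · rintro _ ⟨h, p, hp, rfl⟩
    exact ⟨p, ⟨(mkQ_mem_subquotSubmodule hNQ).1 h, hp⟩, rfl⟩
  · rintro _ ⟨p, hp, rfl⟩
    exact ⟨(mkQ_mem_subquotSubmodule hNQ).2 hp.1, p, hp.2, rfl⟩

theorem iSup_subquotSubmodule_inf {ι : Sort*} (d : ι → ℝ) (hNQ : N ≤ Q) (hQP : Q ≤ P) :
    ⨆ i, (subquotSubmodule N P Q).restrictScalars k ⊓ subquotGrading ℳ N P (d i) =
      ((⨆ i, Q.restrictScalars k ⊓ ℳ (d i)).comap (P.subtype.restrictScalars k)).map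
        ((N.submoduleOf P).mkQ.restrictScalars k) := by
  simp only [subquotSubmodule_inf hNQ]
  rw [← Submodule.map_iSup, iSup_comap_subtype fun i => inf_le_left.trans hQP]

variable [DirectSum.Decomposition ℳ]

theorem iSup_inf_eq_inf_gradedLE (hQ : Q.IsHomogeneous ℳ) (x : ℝ) :
    ⨆ t : Set.Iic x, Q.restrictScalars k ⊓ ℳ t = Q.restrictScalars k ⊓ gradedLE ℳ x := by
  classical
  refine le_antisymm (iSup_le fun t => inf_le_inf_left _ (le_gradedLE t.2)) ?_
  rintro m ⟨hm, hmx⟩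
  rw [← truncation_eq_self hmx, ← DirectSum.sum_support_decompose ℳ m, map_sum]
  refine sum_mem fun t _ => ?_
  rw [truncation_of_mem (DirectSum.decompose ℳ m t).2]
  split_ifs with ht
  · exact Submodule.mem_iSup_of_mem (p := fun t : Set.Iic x => Q.restrictScalars k ⊓ ℳ t) ⟨t, ht⟩
      ⟨hQ t hm, (DirectSum.decompose ℳ m t).2⟩
  · exact zero_mem _

theorem isGradedSubmodule_subquotSubmodule (hQ : Q.IsHomogeneous ℳ) (hNQ : N ≤ Q) (hQP : Q ≤ P) :
    IsGradedSubmodule (subquotGrading ℳ N P) (subquotSubmodule N P Q) := by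
  rw [IsGradedSubmodule, iSup_subquotSubmodule_inf (fun t => t) hNQ hQP,
    ← (isGradedSubmodule_iff_isHomogeneous ℳ Q).2 hQ]
  rfl

theorem isHomogeneous_of_isGradedSubmodule_subquotSubmodule (hN : N.IsHomogeneous ℳ) (hNQ : N ≤ Q)
    (hQP : Q ≤ P) (hgraded : IsGradedSubmodule (subquotGrading ℳ N P) (subquotSubmodule N P Q)) :
    Q.IsHomogeneous ℳ := by
  refine (isGradedSubmodule_iff_isHomogeneous ℳ Q).1
    (le_antisymm (fun m hm => ?_) (iSup_le fun t => inf_le_left))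
  have hmem : (N.submoduleOf P).mkQ ⟨m, hQP hm⟩ ∈ (subquotSubmodule N P Q).restrictScalars k :=
    (mkQ_mem_subquotSubmodule hNQ).2 hm
  rw [hgraded, iSup_subquotSubmodule_inf (fun t => t) hNQ hQP] at hmem
  obtain ⟨p, hpQ, hpm⟩ := hmem
  have hdiff : (p : M) - m ∈ N.restrictScalars k :=
    (Submodule.Quotient.eq (N.submoduleOf P)).1 hpm
  rw [(isGradedSubmodule_iff_isHomogeneous ℳ N).2 hN] at hdiff
  have hNQ' : ⨆ t : ℝ, N.restrictScalars k ⊓ ℳ t ≤ ⨆ t : ℝ, Q.restrictScalars k ⊓ ℳ t :=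
    iSup_mono fun t => inf_le_inf_right (ℳ t) hNQ
  exact (Submodule.sub_mem_iff_right _ (x := (p : M)) hpQ).1 (hNQ' hdiff)

theorem exists_eq_subquotSubmodule (hN : N.IsHomogeneous ℳ) (hNP : N ≤ P)
    {N' : Submodule R (P ⧸ N.submoduleOf P)} (hN' : IsGradedSubmodule (subquotGrading ℳ N P) N') :
    ∃ Q : Submodule R M, Q.IsHomogeneous ℳ ∧ N ≤ Q ∧ Q ≤ P ∧ N' = subquotSubmodule N P Q := by
  let Q : Submodule R M := (N'.comap (N.submoduleOf P).mkQ).map P.subtype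
  have hQP : Q ≤ P := Submodule.map_subtype_le _ _
  have hN'Q : N' = subquotSubmodule N P Q := by
    have hcomap : Q.submoduleOf P = N'.comap (N.submoduleOf P).mkQ :=
      Submodule.comap_map_eq_of_injective Subtype.val_injective _
    rw [subquotSubmodule, hcomap,
      Submodule.map_comap_eq_of_surjective (Submodule.mkQ_surjective _)]
  have hNQ : N ≤ Q := fun m hm =>
    ⟨⟨m, hNP hm⟩, (N.submoduleOf P).le_comap_mkQ N' hm, rfl⟩
  exact ⟨Q, isHomogeneous_of_isGradedSubmodule_subquotSubmodule hN hNQ hQP (hN'Q ▸ hN'), hNQ, hQP,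
    hN'Q⟩

theorem dimLE_subGrading_subquotSubmodule (hfin : ∀ x, FiniteDimensional k (gradedLE ℳ x))
    (hQ : Q.IsHomogeneous ℳ) (hNQ : N ≤ Q) (hQP : Q ≤ P) :
    dimLE (subGrading (subquotGrading ℳ N P) (subquotSubmodule N P Q)) =
      moduleHilbertFun ℳ Q - moduleHilbertFun ℳ N := by
  funext x
  have := finiteDimensional_inf_gradedLE hfin (Q.restrictScalars k) x
  have hrank := finrank_map_mkQ_comap_subtype (P := P) N
    (V := Q.restrictScalars k ⊓ gradedLE ℳ x) (inf_le_left.trans hQP)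
  have hinf : N.restrictScalars k ⊓ (Q.restrictScalars k ⊓ gradedLE ℳ x) =
      N.restrictScalars k ⊓ gradedLE ℳ x := by
    rw [← inf_assoc]
    exact congrArg (· ⊓ gradedLE ℳ x) (inf_eq_left.2 hNQ)
  rw [hinf] at hrank
  rw [dimLE_subGrading, iSup_subquotSubmodule_inf (fun t : Set.Iic x => (t : ℝ)) hNQ hQP,
    iSup_inf_eq_inf_gradedLE hQ, Pi.sub_apply, eq_sub_iff_add_eq]
  simp only [moduleHilbertFun, hilbertFun]
  exact_mod_cast hrank

theorem dimLE_subquotGrading (hfin : ∀ x, FiniteDimensional k (gradedLE ℳ x))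
    (hP : P.IsHomogeneous ℳ) (hNP : N ≤ P) :
    dimLE (subquotGrading ℳ N P) = moduleHilbertFun ℳ P - moduleHilbertFun ℳ N := by
  rw [← dimLE_subGrading_subquotSubmodule hfin hP hNP le_rfl, subquotSubmodule_self]
  funext x
  rw [dimLE_subGrading]
  exact congrArg (fun V : Submodule k (P ⧸ N.submoduleOf P) => (Module.finrank k V : ℝ))
    (iSup_congr fun t => (top_inf_eq _).symm)

end Subquotient

section GradedSubmodules

variable {k R M : Type*} [Field k] [CommRing R] [Algebra k R]
  [AddCommGroup M] [Module R M] [Module k M]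

/-- The lattice of graded submodules of a graded module, to which the Harder-Narasimhan theory of
lattices is applied. -/
abbrev GradedSubmodules (R : Type*) [CommRing R] [Module R M] (ℳ : ℝ → Submodule k M)
    [DirectSum.Decomposition ℳ] : Type _ :=
  {N : Submodule R M // N.IsHomogeneous ℳ}

namespace GradedSubmodules

variable {ℳ : ℝ → Submodule k M} [DirectSum.Decomposition ℳ]

instance : Lattice (GradedSubmodules R ℳ) :=
  Subtype.lattice (fun _ _ => isHomogeneous_sup) fun _ _ => isHomogeneous_inf

instance : BoundedOrder (GradedSubmodules R ℳ) :=
  Subtype.boundedOrder isHomogeneous_bot isHomogeneous_top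

variable [IsScalarTower k R M]

/-- The coefficient `a_n` as a function on the lattice of graded submodules. -/
noncomputable abbrev leadCoeff (n : ℕ) (x : GradedSubmodules R ℳ) : ℝ := _root_.leadCoeff n ℳ x.1

/-- The coefficient `a_{n-1}` as a function on the lattice of graded submodules. -/
noncomputable abbrev subleadCoeff (n : ℕ) (x : GradedSubmodules R ℳ) : ℝ :=
  _root_.subleadCoeff n ℳ x.1

end GradedSubmodules

end GradedSubmodules

section Slope

variable {k R M : Type*} [Field k] [CommRing R] [Algebra k R]
  [AddCommGroup M] [Module R M] [Module k M] [IsScalarTower k R M]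
  {ℳ : ℝ → Submodule k M} [DirectSum.Decomposition ℳ]
  {n : ℕ} {W : List ℝ} {x y z : GradedSubmodules R ℳ}

open GradedSubmodules HarderNarasimhan

namespace HasHilbertExpansion

variable (H : HasHilbertExpansion R W n ℳ)

include H

theorem hasRiemannRoch_dimLE : HasRiemannRoch n (dimLE ℳ)
    (_root_.leadCoeff n ℳ (⊤ : Submodule R M)) (_root_.subleadCoeff n ℳ (⊤ : Submodule R M)) := by
  rw [← funext (hilbertFun_top (ℳ := ℳ))]
  exact H.hasRiemannRoch (N := (⊤ : Submodule R M)) isHomogeneous_top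

theorem rrCoeff_subquotGrading (hxy : x ≤ y) : rrCoeff n (subquotGrading ℳ x.1 y.1) =
    (leadCoeff n y - leadCoeff n x, subleadCoeff n y - subleadCoeff n x) := by
  refine HasRiemannRoch.rrCoeff_eq H.one_le ?_
  rw [dimLE_subquotGrading H.finiteDimensional y.2 hxy]
  exact (H.hasRiemannRoch y.2).sub (H.hasRiemannRoch x.2)

theorem rrCoeff_subGrading (hxz : x ≤ z) (hzy : z ≤ y) :
    rrCoeff n (subGrading (subquotGrading ℳ x.1 y.1) (subquotSubmodule x.1 y.1 z.1)) =
      (leadCoeff n z - leadCoeff n x, subleadCoeff n z - subleadCoeff n x) := by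
  refine HasRiemannRoch.rrCoeff_eq H.one_le ?_
  rw [dimLE_subGrading_subquotSubmodule H.finiteDimensional z.2 hxz hzy]
  exact (H.hasRiemannRoch z.2).sub (H.hasRiemannRoch x.2)

variable [IsDomain R] {𝒜 : ℝ → Submodule k R} [GradedAlgebra 𝒜] [SetLike.GradedSMul 𝒜 ℳ]
  [Module.IsTorsionFree R M] (HR : HasHilbertExpansion R W n 𝒜)

include HR

theorem gradedSlope_subGrading (hxz : x ≤ z) (hzy : z ≤ y) (hlt : leadCoeff n x < leadCoeff n z) :
    gradedSlope n 𝒜 (subGrading (subquotGrading ℳ x.1 y.1) (subquotSubmodule x.1 y.1 z.1)) =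
      intervalSlope (leadCoeff n) (subleadCoeff n) x z -
        _root_.subleadCoeff n 𝒜 (⊤ : Ideal R) / _root_.leadCoeff n 𝒜 (⊤ : Ideal R) := by
  have := H.noetherian
  have hlead : leadCoeff n z - leadCoeff n x =
      (Module.finrank R (subquotSubmodule x.1 y.1 z.1) : ℝ) *
        _root_.leadCoeff n 𝒜 (⊤ : Ideal R) := by
    rw [GradedSubmodules.leadCoeff, GradedSubmodules.leadCoeff, H.leadCoeff_eq_finrank_mul HR z.2,
      H.leadCoeff_eq_finrank_mul HR x.2, ← finrank_subquotSubmodule_add_finrank hxz hzy]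
    push_cast
    ring
  have hrank : (Module.finrank R (subquotSubmodule x.1 y.1 z.1) : ℝ) ≠ 0 :=
    left_ne_zero_of_mul (hlead ▸ (sub_pos.2 hlt).ne')
  rw [gradedSlope, gradedDegree, H.rrCoeff_subGrading hxz hzy,
    HasRiemannRoch.rrCoeff_eq H.one_le HR.hasRiemannRoch_dimLE, sub_div, intervalSlope, hlead,
    mul_div_mul_left _ _ hrank]

theorem gradedSlope_subquotGrading (hxy : x ≤ y) (hlt : leadCoeff n x < leadCoeff n y) :
    gradedSlope n 𝒜 (subquotGrading ℳ x.1 y.1) = intervalSlope (leadCoeff n) (subleadCoeff n) x y -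
      _root_.subleadCoeff n 𝒜 (⊤ : Ideal R) / _root_.leadCoeff n 𝒜 (⊤ : Ideal R) := by
  rw [← H.gradedSlope_subGrading HR hxy le_rfl hlt, gradedSlope, gradedSlope, gradedDegree,
    gradedDegree, H.rrCoeff_subGrading hxy le_rfl, H.rrCoeff_subquotGrading hxy,
    subquotSubmodule_self, finrank_top]

end HasHilbertExpansion

end Slope

section Stability

theorem isTorsionFree_quotient_submoduleOf_iff {R M : Type*} [CommRing R] [IsDomain R]
    [AddCommGroup M] [Module R M] {N P : Submodule R M} :
    Module.IsTorsionFree R (P ⧸ N.submoduleOf P) ↔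
      ∀ r : R, r ≠ 0 → ∀ m ∈ P, r • m ∈ N → m ∈ N := by
  have hmk (p : P) : (N.submoduleOf P).mkQ p = 0 ↔ (p : M) ∈ N :=
    Submodule.Quotient.mk_eq_zero _
  constructor
  · intro h r hr m hm hrm
    refine (hmk ⟨m, hm⟩).1 ((smul_eq_zero.1 ?_).resolve_left hr)
    rw [← map_smul]
    exact (hmk _).2 hrm
  · intro h
    refine ⟨fun r hr => isSMulRegular_iff_right_eq_zero_of_smul.2 fun q hq => ?_⟩
    obtain ⟨p, rfl⟩ := (N.submoduleOf P).mkQ_surjective q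
    rw [← map_smul] at hq
    exact (hmk p).2 (h r hr.ne_zero p p.2 ((hmk _).1 hq))

variable {k R M : Type*} [Field k] [CommRing R] [IsDomain R] [Algebra k R]
  [AddCommGroup M] [Module R M] [Module k M] [IsScalarTower k R M] [Module.IsTorsionFree R M]
  {ℳ : ℝ → Submodule k M} [DirectSum.Decomposition ℳ]
  {𝒜 : ℝ → Submodule k R} [GradedAlgebra 𝒜] [SetLike.GradedSMul 𝒜 ℳ]

open GradedSubmodules HarderNarasimhan

namespace HasHilbertExpansion

variable {n : ℕ} {W : List ℝ} (H : HasHilbertExpansion R W n ℳ)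
  (HR : HasHilbertExpansion R W n 𝒜) {x y : GradedSubmodules R ℳ}

include H HR

theorem isStep_of_isSemistable (hpos : 0 < _root_.leadCoeff n 𝒜 (⊤ : Ideal R)) (hxy : x ≤ y)
    (h : IsSemistable n 𝒜 (subquotGrading ℳ x.1 y.1)) :
    IsStep (leadCoeff n) (subleadCoeff n) x y := by
  have hrank : ∀ z, x < z → z ≤ y → leadCoeff n x < leadCoeff n z := fun z hxz hzy =>
    H.leadCoeff_lt HR hpos x.2 z.2 hxz fun r hr m hm =>
      isTorsionFree_quotient_submoduleOf_iff.1 h.torsionFree r hr m (hzy hm)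
  have hlt : x < y := by
    refine lt_of_le_of_ne hxy fun heq => h.leading_ne_zero ?_
    rw [H.rrCoeff_subquotGrading hxy, heq]
    exact sub_self _
  refine ⟨hlt, hrank, fun z hxz hzy => ?_⟩
  have hslope := h.slope_le _ (isGradedSubmodule_subquotSubmodule z.2 hxz.le hzy)
    ((subquotSubmodule_ne_bot_iff hxz.le hzy).2 hxz)
  rwa [H.gradedSlope_subGrading HR hxz.le hzy (hrank z hxz hzy),
    H.gradedSlope_subquotGrading HR hxy (hrank y hlt le_rfl), sub_le_sub_iff_right] at hslope

theorem isSemistable_of_isStep (h : IsStep (leadCoeff n) (subleadCoeff n) x y) :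
    IsSemistable n 𝒜 (subquotGrading ℳ x.1 y.1) := by
  have hlt := h.rank_lt y h.lt le_rfl
  refine ⟨isTorsionFree_quotient_submoduleOf_iff.2 fun r hr m hm =>
      H.mem_of_smul_mem HR x.2 y.2 h.lt.le (fun Q hQ => h.rank_lt ⟨Q, hQ⟩) hr hm, ?_,
    fun N' hN' hne => ?_⟩
  · rw [H.rrCoeff_subquotGrading h.lt.le]
    exact (sub_pos.2 hlt).ne'
  · obtain ⟨Q, hQ, hxQ, hQy, rfl⟩ := exists_eq_subquotSubmodule x.2 h.lt.le hN'
    have hxz : x < ⟨Q, hQ⟩ := (subquotSubmodule_ne_bot_iff hxQ hQy).1 hne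
    rw [H.gradedSlope_subGrading HR (z := ⟨Q, hQ⟩) hxQ hQy (h.rank_lt _ hxz hQy),
      H.gradedSlope_subquotGrading HR h.lt.le hlt]
    exact sub_le_sub_right (h.slope_le ⟨Q, hQ⟩ hxz hQy) _

theorem strictAnti_gradedSlope_iff {l : ℕ} {F : Fin (l + 1) → GradedSubmodules R ℳ}
    (hF : ∀ i : Fin l, IsStep (leadCoeff n) (subleadCoeff n) (F i.castSucc) (F i.succ)) :
    (StrictAnti fun i : Fin l =>
      gradedSlope n 𝒜 (subquotGrading ℳ (F i.castSucc).1 (F i.succ).1)) ↔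
      StrictAnti fun i : Fin l =>
        intervalSlope (leadCoeff n) (subleadCoeff n) (F i.castSucc) (F i.succ) := by
  simp only [fun i => H.gradedSlope_subquotGrading HR (hF i).lt.le
    ((hF i).rank_lt _ (hF i).lt le_rfl), StrictAnti, sub_lt_sub_iff_right]

theorem isHarderNarasimhan_iff_isFiltration (hpos : 0 < _root_.leadCoeff n 𝒜 (⊤ : Ideal R))
    {l : ℕ} (F : Fin (l + 1) → GradedSubmodules R ℳ) :
    IsHarderNarasimhan n 𝒜 ℳ (fun i => (F i).1) ↔
      IsFiltration (leadCoeff n) (subleadCoeff n) ⊥ F := by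
  constructor
  · intro h
    have hstep (i : Fin l) : IsStep (leadCoeff n) (subleadCoeff n) (F i.castSucc) (F i.succ) :=
      H.isStep_of_isSemistable HR hpos (h.mono i.castSucc_lt_succ.le) (h.semistable i)
    exact ⟨Subtype.ext h.bot, Subtype.ext h.top, hstep,
      (H.strictAnti_gradedSlope_iff HR hstep).1 h.slope_strictAnti⟩
  · intro h
    exact ⟨fun i => (isGradedSubmodule_iff_isHomogeneous ℳ _).2 (F i).2,
      Fin.monotone_iff_le_succ.2 fun i => (h.step i).lt.le, congrArg Subtype.val h.zero,
      congrArg Subtype.val h.last, fun i => H.isSemistable_of_isStep HR (h.step i),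
      (H.strictAnti_gradedSlope_iff HR h.step).2 h.strictAnti⟩

theorem finite_range_leadCoeff :
    (Set.range (leadCoeff n : GradedSubmodules R ℳ → ℝ)).Finite := by
  have := H.noetherian
  refine ((Set.finite_Iic (Module.finrank R M)).image
    fun r : ℕ => r * _root_.leadCoeff n 𝒜 (⊤ : Ideal R)).subset ?_
  rintro _ ⟨z, rfl⟩
  exact ⟨_, Submodule.finrank_le z.1, (H.leadCoeff_eq_finrank_mul HR z.2).symm⟩

theorem existsUnique_isFiltration_bot (hpos : 0 < _root_.leadCoeff n 𝒜 (⊤ : Ideal R)) :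
    ∃! F : (l : ℕ) × (Fin (l + 1) → GradedSubmodules R ℳ),
      IsFiltration (leadCoeff n) (subleadCoeff n) ⊥ F.2 := by
  have := H.noetherian
  have : WellFoundedGT (GradedSubmodules R ℳ) :=
    ⟨InvImage.wf Subtype.val (wellFounded_gt (α := Submodule R M))⟩
  refine existsUnique_isFiltration (fun x y => (H.coeff_sup_add_inf x.2 y.2).1)
    (fun x y => (H.coeff_sup_add_inf x.2 y.2).2) (fun x y hxy => H.leadCoeff_mono hxy x.2 y.2)
    (fun x y hxy => H.subleadCoeff_mono hxy x.2 y.2) (H.finite_range_leadCoeff HR)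
    ((H.isPWO_neg_subleadCoeff HR).mono ?_) fun z hz => ?_
  · rintro _ ⟨z, rfl⟩
    exact ⟨z.1, z.2, rfl⟩
  · exact H.leadCoeff_lt HR hpos isHomogeneous_bot z.2 hz fun r hr m _ hrm =>
      (smul_eq_zero.1 hrm).resolve_left hr

theorem existsUnique_isHarderNarasimhan (hpos : 0 < _root_.leadCoeff n 𝒜 (⊤ : Ideal R)) :
    ∃! F : (l : ℕ) × (Fin (l + 1) → Submodule R M), IsHarderNarasimhan n 𝒜 ℳ F.2 := by
  obtain ⟨⟨l, F⟩, hF, hunique⟩ := H.existsUnique_isFiltration_bot HR hpos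
  refine ⟨⟨l, fun i => (F i).1⟩, (H.isHarderNarasimhan_iff_isFiltration HR hpos F).2 hF, ?_⟩
  rintro ⟨l', G⟩ hG
  let G' (i : Fin (l' + 1)) : GradedSubmodules R ℳ :=
    ⟨G i, (isGradedSubmodule_iff_isHomogeneous ℳ _).1 (hG.graded i)⟩
  have hG' : (⟨l', G'⟩ : (l : ℕ) × (Fin (l + 1) → GradedSubmodules R ℳ)) = ⟨l, F⟩ :=
    hunique ⟨l', G'⟩ ((H.isHarderNarasimhan_iff_isFiltration HR hpos G').1 hG)
  exact congrArg (fun F : (l : ℕ) × (Fin (l + 1) → GradedSubmodules R ℳ) =>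
    (⟨F.1, fun i => (F.2 i).1⟩ : (l : ℕ) × (Fin (l + 1) → Submodule R M))) hG'

end HasHilbertExpansion

end Stability

theorem mainTheorem4_general {k R M : Type*} [Field k]
    [CommRing R] [IsDomain R] [Algebra k R] [Algebra.FiniteType k R]
    (𝒜 : ℝ → Submodule k R) [GradedAlgebra 𝒜]
    (h𝒜_neg : ∀ t : ℝ, t < 0 → 𝒜 t = ⊥) (h𝒜_zero : 𝒜 0 = 1)
    (n : ℕ) (hn : ringKrullDim R = n) (hn_pos : 1 ≤ n)
    [AddCommGroup M] [Module R M] [Module k M] [IsScalarTower k R M]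
    [Module.Finite R M] [Module.IsTorsionFree R M]
    (ℳ : ℝ → Submodule k M) [DirectSum.Decomposition ℳ] [SetLike.GradedSMul 𝒜 ℳ] :
    (∃! c : ℝ × ℝ, IsRiemannRoch n 𝒜 c.1 c.2) ∧
    (∃! c : ℝ × ℝ, IsRiemannRoch n ℳ c.1 c.2) ∧
    (∃! F : (l : ℕ) × (Fin (l + 1) → Submodule R M), IsHarderNarasimhan n 𝒜 ℳ F.2) := by
  obtain ⟨y, hy, hfin⟩ := exists_algebraicIndependent_finite_adjoin (k := k) hn
  obtain ⟨gens, hgens, htop⟩ := exists_homogeneous_algebra_generators 𝒜 h𝒜_neg h𝒜_zero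
  have : IsNoetherianRing R := Algebra.FiniteType.isNoetherianRing k R
  have : Module.Finite (Algebra.adjoin k (Set.range y)) M := .trans R M
  have HR : HasHilbertExpansion R (gens.map Prod.snd) n 𝒜 :=
    hasHilbertExpansion hgens htop hn_pos y
  have H : HasHilbertExpansion R (gens.map Prod.snd) n ℳ :=
    hasHilbertExpansion hgens htop hn_pos y
  exact ⟨HR.hasRiemannRoch_dimLE.existsUnique_isRiemannRoch hn_pos,
    H.hasRiemannRoch_dimLE.existsUnique_isRiemannRoch hn_pos,
    H.existsUnique_isHarderNarasimhan HR (HR.leadCoeff_top_pos hy)⟩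

theorem mainTheorem4 {k R M : Type*} [Field k] [IsAlgClosed k]
    [CommRing R] [IsDomain R] [Algebra k R] [Algebra.FiniteType k R]
    (𝒜 : ℝ → Submodule k R) [GradedAlgebra 𝒜]
    (h𝒜_neg : ∀ t : ℝ, t < 0 → 𝒜 t = ⊥) (h𝒜_zero : 𝒜 0 = 1)
    (n : ℕ) (hn : ringKrullDim R = n) (hn_pos : 1 ≤ n)
    [AddCommGroup M] [Module R M] [Module k M] [IsScalarTower k R M]
    [Module.Finite R M] [Module.IsTorsionFree R M]
    (ℳ : ℝ → Submodule k M) [DirectSum.Decomposition ℳ] [SetLike.GradedSMul 𝒜 ℳ] :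
    (∃! c : ℝ × ℝ, IsRiemannRoch n 𝒜 c.1 c.2) ∧
    (∃! c : ℝ × ℝ, IsRiemannRoch n ℳ c.1 c.2) ∧
    (∃! F : (l : ℕ) × (Fin (l + 1) → Submodule R M), IsHarderNarasimhan n 𝒜 ℳ F.2) :=
  mainTheorem4_general 𝒜 h𝒜_neg h𝒜_zero n hn hn_pos ℳ
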